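/- All graphs are finite, simple and connected; $n$ and $m$ are the numbers of vertices and edges of $G=(V,E)$. Definitions. A 4-Steiner root of $G$ is a finite tree $T$ with $V\subseteq V(T)$ such that distinct $u,v\in V$ are adjacent in $G$ if and only if $\mathrm{dist}_T(u,v)\le 4$; nodes of a tree that are in $V$ are called real, the others Steiner. For $X\subseteq V$, $T\langle X\rangle$ is the smallest subtree of $T$ containing $X$, and $\mathcal C(T\langle X\rangle)$ is its center. Two trees are Steiner-equivalent if they have the same set of real nodes and there is an isomorphism between them that fixes every real node. A clique-intersection of $G$ is an intersection of one or more maximal cliques. Given a clique-intersection $X$, a vertex $v\in X$ is $X$-free if there is no clique-intersection $X'\subsetneq X$ with $v\in X'$ and $|X'|\ge 2$, and there are no clique-intersections $X_1,X_2$ with $X\subsetneq X_1$ and $X\cap X_2=\{v\}\subsetneq X_1\cap X_2$. A 4-Steiner root $T$ of $G$ is well-structured if for every nonempty clique-intersection $X$: 1. every $X$-free vertex is a leaf of $T\langle X\rangle$ (a node with at most one neighbour in it) with eccentricity $\mathrm{diam}(T\langle X\rangle)$; 2. there is $c\in\mathcal C(T\langle X\rangle)$ such that $\mathrm{dist}_T(v,c)=\mathrm{dist}_T(v,\mathcal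 C(T\langle X\rangle))$ for all $X$-free vertices $v$ except at most one; 3. all internal nodes of the path between an $X$-free vertex and the center $\mathcal C(T\langle X\rangle)$ are Steiner nodes that have degree two in $T\langle X\rangle$; 4. if $X$ is a maximal clique and has an $X$-free vertex, then $\mathrm{diam}(T\langle X\rangle)=4$. A minimal separator of $G$ is an inclusion-minimal set $S\subseteq V\setminus\{u,v\}$ such that $u,v$ are disconnected in $G\setminus S$, for some $u,v\in V$. Theorem. There is an algorithm (for a word RAM with words of $O(\log n)$ bits) that, given any connected chordal graph $G$, outputs in $O(n^5m)$ time (in $O(1)$ time if $m=0$) a collection $(\mathcal T_S)_S$, indexed by the minimal separators $S$ of $G$, such that each $\mathcal T_S$ consists of $O(|S|^5)$ trees with set of real nodes $S$, and such that for every well-structured 4-Steiner root $T$ of $G$ and every minimal separator $S$ of $G$ the subtree $T\langle S\rangle$ is Steiner-equivalent to some tree in $\mathcal T_S$. -/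

import Mathlib

/-! ### Graph notions -/

/-- A graph is chordal if it has no induced cycle of length at least four. -/
def IsChordal {V : Type} (G : SimpleGraph V) : Prop :=
  ∀ k : ℕ, 4 ≤ k → IsEmpty (SimpleGraph.cycleGraph k ↪g G)

/-- `S` contains neither `u` nor `v`, and `u`, `v` are disconnected in `G ∖ S`:
every walk from `u` to `v` meets `S`. -/
def IsSeparator {V : Type} (G : SimpleGraph V) (u v : V) (S : Finset V) : Prop :=
  u ∉ S ∧ v ∉ S ∧ ∀ p : G.Walk u v, ∃ x ∈ p.support, x ∈ S

/-- `S` is an inclusion-minimal `uv`-separator for some `u`, `v`. -/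
def IsMinimalSeparator {V : Type} (G : SimpleGraph V) (S : Finset V) : Prop :=
  ∃ u v : V, Minimal (IsSeparator G u v) S

/-- `K` is an inclusion-maximal clique of `G`. -/
def IsMaxClique {V : Type} (G : SimpleGraph V) (K : Finset V) : Prop :=
  Maximal (fun s : Finset V => G.IsClique (s : Set V)) K

/-- `X` is the intersection of a (nonempty) family of maximal cliques of `G`. -/
def IsCliqueIntersection {V : Type} (G : SimpleGraph V) (X : Finset V) : Prop :=
  ∃ F : Set (Finset V), F.Nonempty ∧ (∀ K ∈ F, IsMaxClique G K) ∧
    ∀ v : V, v ∈ X ↔ ∀ K ∈ F, v ∈ K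

/-- The vertex `v` of `X` lies in a strictly smaller clique-intersection with at least two
vertices. -/
def InternallyConstrained {V : Type} (G : SimpleGraph V) (X : Finset V) (v : V) : Prop :=
  ∃ X' : Finset V, IsCliqueIntersection G X' ∧ X' ⊂ X ∧ v ∈ X' ∧ 2 ≤ X'.card

/-- The vertex `v` of `X` is `(X, X₁, X₂)`-sandwiched for some clique-intersections `X₁`, `X₂`:
`X ⊂ X₁` and `X ∩ X₂ = {v} ⊂ X₁ ∩ X₂`, where the inclusions are strict. -/
def Sandwiched {V : Type} (G : SimpleGraph V) (X : Finset V) (v : V) : Prop :=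
  ∃ X₁ X₂ : Finset V, IsCliqueIntersection G X₁ ∧ IsCliqueIntersection G X₂ ∧ X ⊂ X₁ ∧
    (∀ x : V, (x ∈ X ∧ x ∈ X₂) ↔ x = v) ∧ ∃ x : V, x ≠ v ∧ x ∈ X₁ ∧ x ∈ X₂

/-- `v` is an `X`-free vertex. -/
def IsFree {V : Type} (G : SimpleGraph V) (X : Finset V) (v : V) : Prop :=
  v ∈ X ∧ ¬ InternallyConstrained G X v ∧ ¬ Sandwiched G X v

/-! ### Steiner roots

The nodes of a Steiner root of a graph on `V` are `V ⊕ σ`: the real nodes are the vertices in `V`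
(left summand) and the Steiner nodes are the elements of `σ` (right summand). -/

/-- The `k`-th power of `T`. -/
def graphPower {W : Type} (T : SimpleGraph W) (k : ℕ) : SimpleGraph W where
  Adj x y := 0 < T.dist x y ∧ T.dist x y ≤ k
  symm := ⟨fun x y h => by rwa [SimpleGraph.dist_comm]⟩
  loopless := ⟨fun x h => by simp at h⟩

/-- `T` is a tree, and `G` is the subgraph of `T ^ k` induced by the real nodes. -/
def IsSteinerRoot {V σ : Type} (k : ℕ) (G : SimpleGraph V) (T : SimpleGraph (V ⊕ σ)) : Prop :=
  T.IsTree ∧ (graphPower T k).comap Sum.inl = G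

/-- The node set of `T⟨X⟩`, the smallest subtree of `T` that contains `X`. -/
def hull {V σ : Type} (T : SimpleGraph (V ⊕ σ)) (X : Finset V) : Set (V ⊕ σ) :=
  ⋂₀ {A | (∀ v ∈ X, Sum.inl v ∈ A) ∧ (T.induce A).Connected}

/-- The subtree `T⟨X⟩`. -/
abbrev spanTree {V σ : Type} (T : SimpleGraph (V ⊕ σ)) (X : Finset V) :
    SimpleGraph (hull T X) :=
  T.induce (hull T X)

/-- `c` is a central node of `H` at minimum distance from `x`. -/
def IsNearestCentre {W : Type} (H : SimpleGraph W) (x c : W) : Prop :=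
  c ∈ H.center ∧ ∀ c' ∈ H.center, H.dist x c ≤ H.dist x c'

/-- The four conditions on `T⟨X⟩` in a well-structured root. In the single-node tree
the node counts as a leaf, that is, a leaf is a node with at most one neighbour. -/
structure WellStructuredAt {V σ : Type} (G : SimpleGraph V) (T : SimpleGraph (V ⊕ σ))
    (X : Finset V) : Prop where
  /-- `X`-free vertices are leaves of `T⟨X⟩` with eccentricity `diam T⟨X⟩`. -/
  leaf : ∀ (v : V) (x : hull T X), IsFree G X v → x.1 = Sum.inl v →
    ((spanTree T X).neighborSet x).Subsingleton ∧
      (spanTree T X).eccent x = (spanTree T X).ediam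
  /-- Some central node is nearest to all the `X`-free vertices except at most one. -/
  grouped : ∃ c ∈ (spanTree T X).center,
    {x : hull T X | (∃ v : V, IsFree G X v ∧ x.1 = Sum.inl v) ∧
      ¬ IsNearestCentre (spanTree T X) x c}.Subsingleton
  /-- Nodes strictly inside the path from an `X`-free vertex to the centre are Steiner nodes of
  degree two. -/
  path : ∀ (v : V) (x c y : hull T X), IsFree G X v → x.1 = Sum.inl v →
    IsNearestCentre (spanTree T X) x c → y ≠ x → y ≠ c →
    (spanTree T X).dist x y + (spanTree T X).dist y c = (spanTree T X).dist x c →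
    (∃ s : σ, y.1 = Sum.inr s) ∧ ((spanTree T X).neighborSet y).ncard = 2
  /-- If `X` is a maximal clique with an `X`-free vertex, then `T⟨X⟩` has diameter four. -/
  diam_eq : IsMaxClique G X → (∃ v : V, IsFree G X v) →
    (spanTree T X).ediam = 4

/-- `T` is a well-structured `4`-Steiner root of `G`. -/
def IsWellStructuredRoot {V σ : Type} (G : SimpleGraph V) (T : SimpleGraph (V ⊕ σ)) : Prop :=
  IsSteinerRoot 4 G T ∧
    ∀ X : Finset V, IsCliqueIntersection G X → X.Nonempty → WellStructuredAt G T X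

/-- Steiner-equivalence of two trees `T₁`, `T₂`. The functions `r₁`, `r₂` say which vertex of the
graph a node is (`none` for a Steiner node). For trees in which no two nodes are the same vertex,
the condition says that the real nodes of `T₁` and `T₂` are the same and that some isomorphism
fixes all of them. -/
def SteinerEquivalent {V W₁ W₂ : Type} (T₁ : SimpleGraph W₁) (r₁ : W₁ → Option V)
    (T₂ : SimpleGraph W₂) (r₂ : W₂ → Option V) : Prop :=
  ∃ f : T₁ ≃g T₂, ∀ x : W₁, r₂ (f x) = r₁ x

/-- Which vertex a node of `T⟨X⟩` is. -/
def spanName {V σ : Type} (T : SimpleGraph (V ⊕ σ)) (X : Finset V) (x : hull T X) : Option V :=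
  x.1.getLeft?

/-! ### Trees as data -/

/-- A rooted tree on the nodes `0, …, N - 1` as the list of its nodes. For each node the list has
the vertex which it is (`none` for a Steiner node) and its father; the root may be its own
father. -/
abbrev CodedTree (n : ℕ) : Type := List (Option (Fin n) × ℕ)

/-- The underlying graph of a coded tree. -/
def CodedTree.graph {n : ℕ} (Y : CodedTree n) : SimpleGraph (Fin (List.length Y)) :=
  SimpleGraph.fromRel (fun i j => (List.get Y i).2 = j.1)

/-- Which vertex a node of a coded tree is. -/
def CodedTree.name {n : ℕ} (Y : CodedTree n) (i : Fin (List.length Y)) : Option (Fin n) :=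
  (List.get Y i).1

/-- `Y` is a tree whose real nodes are exactly the elements of `S`, each occurring once. -/
def CodedTree.IsTreeOn {n : ℕ} (Y : CodedTree n) (S : Finset (Fin n)) : Prop :=
  Y.graph.IsTree ∧ (∀ v : Fin n, v ∈ S ↔ ∃ i, Y.name i = some v) ∧
    ∀ i j (v : Fin n), Y.name i = some v → Y.name j = some v → i = j

/-- Words for a list: a `1` in front of each element and a `0` at the end. -/
def writeList {α : Type} (f : α → List ℕ) (l : List α) : List ℕ :=
  l.flatMap (fun a => 1 :: f a) ++ [0]

/-- Words for a node of a coded tree: `0` for a Steiner node or `v + 1` for the vertex `v`, then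
the father. -/
def writeNode {n : ℕ} (a : Option (Fin n) × ℕ) : List ℕ :=
  [match a.1 with
    | none => 0
    | some v => v.1 + 1,
   a.2]

/-- Words for a collection of vertex sets (each one as a list of its elements), each with a family
of coded trees. -/
def writeCollection {n : ℕ} (F : List (List (Fin n) × List (CodedTree n))) : List ℕ :=
  writeList (fun p => writeList (fun v => [v.1]) p.1 ++ writeList (writeList writeNode) p.2) F

/-! ### Machine model: structured programs on a word RAM

A machine has words of `w` bits, finitely many registers that occur in the program, a
random-access memory, and a write-only output tape. -/

/-- Arithmetic instructions on words. -/
inductive RamOp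
  | add | sub | mul | div | lt

/-- Arithmetic is modulo `2 ^ w`; subtraction is truncated at `0`. -/
def RamOp.eval (w : ℕ) : RamOp → ℕ → ℕ → ℕ
  | .add, a, b => (a + b) % 2 ^ w
  | .sub, a, b => a - b
  | .mul, a, b => (a * b) % 2 ^ w
  | .div, a, b => a / b
  | .lt, a, b => if a < b then 1 else 0

/-- Programs. Register `x` is written `R x`, memory cell `a` is written `M a`. -/
inductive RamProg
  /-- do nothing -/
  | skip
  /-- `R x := k` -/
  | const (x k : ℕ)
  /-- `R x := R y ∘ R z` -/
  | arith (o : RamOp) (x y z : ℕ)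
  /-- `R x := M (R y)` -/
  | load (x y : ℕ)
  /-- `M (R x) := R y` -/
  | store (x y : ℕ)
  /-- append `R x` to the output -/
  | emit (x : ℕ)
  /-- first `p`, then `q` -/
  | seq (p q : RamProg)
  /-- if `R x ≠ 0` then `p` else `q` -/
  | ite (x : ℕ) (p q : RamProg)
  /-- while `R x ≠ 0` do `p` -/
  | loop (x : ℕ) (p : RamProg)

/-- A configuration: registers, memory, output written so far. -/
structure RamState where
  reg : ℕ → ℕ
  mem : ℕ → ℕ
  out : List ℕ

/-- `RamExec w p s s' t`: with words of `w` bits, program `p` started in `s` halts in `s'` after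
`t` steps. Each instruction and each test of a register takes one step. -/
inductive RamExec (w : ℕ) : RamProg → RamState → RamState → ℕ → Prop
  | skip (s : RamState) : RamExec w .skip s s 1
  | const (x k : ℕ) (s : RamState) :
      RamExec w (.const x k) s { s with reg := Function.update s.reg x (k % 2 ^ w) } 1
  | arith (o : RamOp) (x y z : ℕ) (s : RamState) :
      RamExec w (.arith o x y z) s
        { s with reg := Function.update s.reg x (o.eval w (s.reg y) (s.reg z)) } 1
  | load (x y : ℕ) (s : RamState) :
      RamExec w (.load x y) s { s with reg := Function.update s.reg x (s.mem (s.reg y)) } 1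
  | store (x y : ℕ) (s : RamState) :
      RamExec w (.store x y) s { s with mem := Function.update s.mem (s.reg x) (s.reg y) } 1
  | emit (x : ℕ) (s : RamState) :
      RamExec w (.emit x) s { s with out := s.out ++ [s.reg x] } 1
  | seq {p q : RamProg} {s₁ s₂ s₃ : RamState} {t₁ t₂ : ℕ} :
      RamExec w p s₁ s₂ t₁ → RamExec w q s₂ s₃ t₂ → RamExec w (.seq p q) s₁ s₃ (t₁ + t₂)
  | ite_true {x : ℕ} {p q : RamProg} {s s' : RamState} {t : ℕ} :
      s.reg x ≠ 0 → RamExec w p s s' t → RamExec w (.ite x p q) s s' (t + 1)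
  | ite_false {x : ℕ} {p q : RamProg} {s s' : RamState} {t : ℕ} :
      s.reg x = 0 → RamExec w q s s' t → RamExec w (.ite x p q) s s' (t + 1)
  | loop_true {x : ℕ} {p : RamProg} {s₁ s₂ s₃ : RamState} {t₁ t₂ : ℕ} :
      s₁.reg x ≠ 0 → RamExec w p s₁ s₂ t₁ → RamExec w (.loop x p) s₂ s₃ t₂ →
      RamExec w (.loop x p) s₁ s₃ (t₁ + t₂ + 1)
  | loop_false {x : ℕ} {p : RamProg} {s : RamState} :
      s.reg x = 0 → RamExec w (.loop x p) s s 1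

open Classical in
/-- The input configuration for a graph on `{0, …, n - 1}`: register `0` holds `n`, the cells
`0, …, n ^ 2 - 1` hold the adjacency matrix row by row, all else is zero or empty. -/
noncomputable def inputState {n : ℕ} (G : SimpleGraph (Fin n)) : RamState where
  reg := fun x => if x = 0 then n else 0
  mem := fun a => if ∃ u v : Fin n, a = u.1 * n + v.1 ∧ G.Adj u v then 1 else 0
  out := []

/-! A minimal separator `S` of a chordal graph is a clique, and each of the two sides contains a
vertex adjacent to all of `S`. Hence the minimal separators are exactly the sets of common
neighbours of two vertices `u`, `v` that these sets separate (`IsChordal.isMinimalSeparator_iff`).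
In a 4-Steiner root `T`, such `u` and `v` are at distance at least five, but both are within four of
every element of `S`. The middle of a path of length four between two elements of `S` would be
within two of both `u` and `v`. So `T⟨S⟩` has diameter at most three: it is a star or a bistar, that
is, two adjacent centres with leaves, and every centre that is real lies in `S`
(`IsCommonNeighborSet.isStarAt_or_isBistarAt`). A star is known from its centre. A bistar is known
from its two centres and the partition of the leaves into two sides.

The partition is almost dictated by `G`. If some centre has a single leaf `f`, then `f` describes
it. Otherwise call a vertex deficient if it misses some element of `S`; it is at distance at least
three from the nearer centre. A deficient vertex with two neighbours among the leaves is at distance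
exactly three, and its neighbours among the leaves form one side (`BistarData.adj_iff_of_splits`).
If there is none, a deficient neighbour `y` of a leaf `s` hangs behind `s`, at distance at least
three from it. If `y` also sees a centre, this is the centre of `s`. If `y` sees a vertex `x`
outside `S` that is complete to `S`, then `x` is at distance two from the centre of `s` and three
from the other one. Such witnesses of two leaves are therefore equal or adjacent exactly if the
leaves are on the same side, which leaves one bit `β` undetermined (`UnsplitData.aligned_iff`). All
remaining leaves are `S`-free (`UnsplitData.isFree`), and the second condition of a well-structured
root leaves at most one of them, again called `f`, on one of the sides. Two centres, `f` and `β`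
give cubically many trees, within the required bound (`length_trees_le`,
`IsCommonNeighborSet.exists_mem_trees`).

The algorithm marks all separated pairs, keeps the lexicographically first pair for each separator,
and writes the trees. Its loops over `u`, `v`, two centres, `f` and a leaf are nested six deep, and
`n ^ 6` is `O(n ^ 5 * m)` for a connected graph with an edge. The program is written in a language
of bounded loops. Its compilation to the word RAM is verified once (`LoopStmt.compile_exec`), and
its running time is read off from the nesting depth (`LoopStmt.exists_cost_le`). -/

set_option linter.unusedSimpArgs false

/-! ### A language of bounded loops

Programs in this language consist of loops that run through `0, …, n - 1`, tests, and accesses to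
square tables. Variables are numbered by their binding level. -/

/-- `iterate f k a` is `f (k - 1) (⋯ (f 1 (f 0 a)))`. -/
def iterateUpTo {α : Type*} (f : ℕ → α → α) : ℕ → α → α
  | 0, a => a
  | k + 1, a => f k (iterateUpTo f k a)

/-- Expressions. `count a` is the number of values of the variable it binds for which `a` is
nonzero, and `last a` is the last such value (or `n`). -/
inductive LoopExpr
  | var (x : ℕ)
  | lit (k : ℕ)
  | size
  | tbl (k : ℕ) (a b : LoopExpr)
  | lt (a b : LoopExpr)
  | and (a b : LoopExpr)
  | not (a : LoopExpr)
  | count (a : LoopExpr)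
  | last (a : LoopExpr)

/-- Statements: output, table assignment, sequence, conditional, loop over `0, …, n - 1`, and local
variable. -/
inductive LoopStmt
  | emit (e : LoopExpr)
  | store (k : ℕ) (a b e : LoopExpr)
  | seq (p q : LoopStmt)
  | whn (e : LoopExpr) (p : LoopStmt)
  | each (p : LoopStmt)
  | bind (e : LoopExpr) (p : LoopStmt)

/-- The tables and the output. -/
structure LoopData where
  tab : ℕ → ℕ → ℕ → ℕ
  out : List ℕ

namespace LoopExpr

/-- The number `d` of variables in scope is also the level of the next bound variable. A table
access out of range gives `0`, so that the value `n` of a failed search can be used as an index. -/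
def eval (n : ℕ) (τ : ℕ → ℕ → ℕ → ℕ) : LoopExpr → ℕ → (ℕ → ℕ) → ℕ
  | var x, _, ρ => ρ x
  | lit k, _, _ => k
  | size, _, _ => n
  | tbl k a b, d, ρ =>
      if a.eval n τ d ρ < n ∧ b.eval n τ d ρ < n then τ k (a.eval n τ d ρ) (b.eval n τ d ρ) else 0
  | lt a b, d, ρ => if a.eval n τ d ρ < b.eval n τ d ρ then 1 else 0
  | and a b, d, ρ => if a.eval n τ d ρ ≠ 0 ∧ b.eval n τ d ρ ≠ 0 then 1 else 0
  | not a, d, ρ => if a.eval n τ d ρ = 0 then 1 else 0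
  | count a, d, ρ =>
      iterateUpTo (fun i c => if a.eval n τ (d + 1) (Function.update ρ d i) ≠ 0 then c + 1 else c) n 0
  | last a, d, ρ =>
      iterateUpTo (fun i c => if a.eval n τ (d + 1) (Function.update ρ d i) ≠ 0 then i else c) n n

/-- All variables are bound and all constants are small. -/
def Scoped : LoopExpr → ℕ → Bool
  | var x, d => x < d
  | lit k, _ => k ≤ 8
  | size, _ => true
  | tbl k a b, d => k ≤ 8 && (a.Scoped d && b.Scoped d)
  | lt a b, d => a.Scoped d && b.Scoped d
  | and a b, d => a.Scoped d && b.Scoped d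
  | not a, d => a.Scoped d
  | count a, d => a.Scoped (d + 1)
  | last a, d => a.Scoped (d + 1)

/-- An upper bound for the number of steps of the compiled expression, including address
computations and loop overhead. -/
def cost (n : ℕ) : LoopExpr → ℕ
  | var _ => 1
  | lit _ => 1
  | size => 1
  | tbl _ a b => a.cost n + b.cost n + 12
  | lt a b => a.cost n + b.cost n + 1
  | and a b => a.cost n + b.cost n + 4
  | not a => a.cost n + 2
  | count a => n * (a.cost n + 10) + 10
  | last a => n * (a.cost n + 10) + 10

/-- The nesting depth of loops. -/
def depth : LoopExpr → ℕ
  | var _ => 0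
  | lit _ => 0
  | size => 0
  | tbl _ a b => max a.depth b.depth
  | lt a b => max a.depth b.depth
  | and a b => max a.depth b.depth
  | not a => a.depth
  | count a => a.depth + 1
  | last a => a.depth + 1

end LoopExpr

namespace LoopStmt

def run (n : ℕ) : LoopStmt → ℕ → (ℕ → ℕ) → LoopData → LoopData
  | emit e, d, ρ, D => { D with out := D.out ++ [e.eval n D.tab d ρ] }
  | store k a b e, d, ρ, D =>
      if a.eval n D.tab d ρ < n ∧ b.eval n D.tab d ρ < n then
        { D with tab := fun k' x y =>
            if k' = k ∧ x = a.eval n D.tab d ρ ∧ y = b.eval n D.tab d ρ then e.eval n D.tab d ρ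
            else D.tab k' x y }
      else D
  | seq p q, d, ρ, D => q.run n d ρ (p.run n d ρ D)
  | whn e p, d, ρ, D => if e.eval n D.tab d ρ ≠ 0 then p.run n d ρ D else D
  | each p, d, ρ, D => iterateUpTo (fun i D => p.run n (d + 1) (Function.update ρ d i) D) n D
  | bind e p, d, ρ, D => p.run n (d + 1) (Function.update ρ d (e.eval n D.tab d ρ)) D

def Scoped : LoopStmt → ℕ → Bool
  | emit e, d => e.Scoped d
  | store k a b e, d => k ≤ 8 && (a.Scoped d && (b.Scoped d && e.Scoped d))
  | seq p q, d => p.Scoped d && q.Scoped d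
  | whn e p, d => e.Scoped d && p.Scoped d
  | each p, d => p.Scoped (d + 1)
  | bind e p, d => e.Scoped d && p.Scoped (d + 1)

def cost (n : ℕ) : LoopStmt → ℕ
  | emit e => e.cost n + 1
  | store _ a b e => a.cost n + b.cost n + e.cost n + 12
  | seq p q => p.cost n + q.cost n
  | whn e p => e.cost n + p.cost n + 2
  | each p => n * (p.cost n + 5) + 5
  | bind e p => e.cost n + p.cost n + 1

def depth : LoopStmt → ℕ
  | emit e => e.depth
  | store _ a b e => max (max a.depth b.depth) e.depth
  | seq p q => max p.depth q.depth
  | whn e p => max e.depth p.depth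
  | each p => p.depth + 1
  | bind e p => max e.depth p.depth

end LoopStmt

/-! #### Running time of loop programs -/

theorem add_le_mul_pow_max {n a b A B i j : ℕ} (ha : a ≤ A * (n + 1) ^ i) (hb : b ≤ B * (n + 1) ^ j) :
    a + b ≤ (A + B) * (n + 1) ^ max i j := by
  have h1 : (n + 1) ^ i ≤ (n + 1) ^ max i j := Nat.pow_le_pow_right (by omega) (le_max_left _ _)
  have h2 : (n + 1) ^ j ≤ (n + 1) ^ max i j := Nat.pow_le_pow_right (by omega) (le_max_right _ _)
  nlinarith [Nat.mul_le_mul_left A h1, Nat.mul_le_mul_left B h2]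

theorem add_const_le_mul_pow {n a A i : ℕ} (k : ℕ) (ha : a ≤ A * (n + 1) ^ i) :
    a + k ≤ (A + k) * (n + 1) ^ i := by
  have h1 : 1 ≤ (n + 1) ^ i := Nat.one_le_pow _ _ (by omega)
  nlinarith [Nat.mul_le_mul_left k h1]

theorem mul_add_le_mul_pow_succ {n a A i : ℕ} (k : ℕ) (ha : a ≤ A * (n + 1) ^ i) :
    n * (a + k) + k ≤ (A + k) * (n + 1) ^ (i + 1) := by
  have h1 := add_const_le_mul_pow k ha
  have h2 : (n + 1) * (a + k) ≤ (n + 1) * ((A + k) * (n + 1) ^ i) := Nat.mul_le_mul_left _ h1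
  rw [pow_succ]
  nlinarith

/-- The factor depends on the expression only, so up to a constant the running time is governed by
the nesting depth. -/
theorem LoopExpr.exists_cost_le (e : LoopExpr) : ∃ K, ∀ n, e.cost n ≤ K * (n + 1) ^ e.depth := by
  induction e with
  | var x => exact ⟨1, fun n => by simp [cost, depth]⟩
  | lit x => exact ⟨1, fun n => by simp [cost, depth]⟩
  | size => exact ⟨1, fun n => by simp [cost, depth]⟩
  | tbl k a b iha ihb =>
    obtain ⟨A, hA⟩ := iha
    obtain ⟨B, hB⟩ := ihb
    exact ⟨_, fun n => add_const_le_mul_pow 12 (add_le_mul_pow_max (hA n) (hB n))⟩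
  | lt a b iha ihb =>
    obtain ⟨A, hA⟩ := iha
    obtain ⟨B, hB⟩ := ihb
    exact ⟨_, fun n => add_const_le_mul_pow 1 (add_le_mul_pow_max (hA n) (hB n))⟩
  | and a b iha ihb =>
    obtain ⟨A, hA⟩ := iha
    obtain ⟨B, hB⟩ := ihb
    exact ⟨_, fun n => add_const_le_mul_pow 4 (add_le_mul_pow_max (hA n) (hB n))⟩
  | not a iha =>
    obtain ⟨A, hA⟩ := iha
    exact ⟨_, fun n => add_const_le_mul_pow 2 (hA n)⟩
  | count a iha =>
    obtain ⟨A, hA⟩ := iha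
    exact ⟨_, fun n => mul_add_le_mul_pow_succ 10 (hA n)⟩
  | last a iha =>
    obtain ⟨A, hA⟩ := iha
    exact ⟨_, fun n => mul_add_le_mul_pow_succ 10 (hA n)⟩

theorem LoopStmt.exists_cost_le (p : LoopStmt) : ∃ K, ∀ n, p.cost n ≤ K * (n + 1) ^ p.depth := by
  induction p with
  | emit e =>
    obtain ⟨A, hA⟩ := e.exists_cost_le
    exact ⟨_, fun n => add_const_le_mul_pow 1 (hA n)⟩
  | store k a b e =>
    obtain ⟨A, hA⟩ := a.exists_cost_le
    obtain ⟨B, hB⟩ := b.exists_cost_le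
    obtain ⟨E, hE⟩ := e.exists_cost_le
    exact ⟨_, fun n => add_const_le_mul_pow 12
      (add_le_mul_pow_max (add_le_mul_pow_max (hA n) (hB n)) (hE n))⟩
  | seq p q ihp ihq =>
    obtain ⟨A, hA⟩ := ihp
    obtain ⟨B, hB⟩ := ihq
    exact ⟨_, fun n => add_le_mul_pow_max (hA n) (hB n)⟩
  | whn e p ihp =>
    obtain ⟨A, hA⟩ := e.exists_cost_le
    obtain ⟨B, hB⟩ := ihp
    exact ⟨_, fun n => add_const_le_mul_pow 2 (add_le_mul_pow_max (hA n) (hB n))⟩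
  | each p ihp =>
    obtain ⟨A, hA⟩ := ihp
    exact ⟨_, fun n => mul_add_le_mul_pow_succ 5 (hA n)⟩
  | bind e p ihp =>
    obtain ⟨A, hA⟩ := e.exists_cost_le
    obtain ⟨B, hB⟩ := ihp
    exact ⟨_, fun n => add_const_le_mul_pow 1 (add_le_mul_pow_max (hA n) (hB n))⟩

/-! #### Compilation

Register `0` holds `n`, register `1` holds `1` and register `2` holds `0`. The variable of level `x`
lives in register `2 * x + 3`, the `t`-th temporary value in register `2 * t + 4`. -/

/-- The register of the variable of level `x`. -/
def varReg (x : ℕ) : ℕ := 2 * x + 3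

/-- The register of the `t`-th temporary value. -/
def tmpReg (t : ℕ) : ℕ := 2 * t + 4

theorem varReg_ne_tmpReg (d t : ℕ) : varReg d ≠ tmpReg t := by
  simp only [varReg, tmpReg]; omega

theorem tmpReg_ne {i j : ℕ} (h : i ≠ j) : tmpReg i ≠ tmpReg j := by
  simp only [tmpReg]; omega

theorem ne_varReg {r : ℕ} (h : r ≤ 2) (d : ℕ) : r ≠ varReg d := by
  simp only [varReg]; omega

theorem ne_tmpReg {r : ℕ} (h : r ≤ 2) (t : ℕ) : r ≠ tmpReg t := by
  simp only [tmpReg]; omega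

/-- Let the variable of level `d` run through `0, …, n - 1`. -/
def forLoop (d t : ℕ) (body : RamProg) : RamProg :=
  .seq (.const (varReg d) 0) (.seq (.arith .lt (tmpReg t) (varReg d) 0)
    (.loop (tmpReg t) (.seq body (.seq (.arith .add (varReg d) (varReg d) 1)
      (.arith .lt (tmpReg t) (varReg d) 0)))))

/-- If the temporary values `i` and `j` are less than `n`, replace the value `t` by the address of the
entry `(i, j)` in table `k` and do `p`, else do `q`. -/
def withAddress (k t i j : ℕ) (p q : RamProg) : RamProg :=
  .seq (.arith .lt (tmpReg t) (tmpReg i) 0) (.seq (.arith .lt (tmpReg (t + 1)) (tmpReg j) 0)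
    (.seq (.arith .mul (tmpReg t) (tmpReg t) (tmpReg (t + 1))) (.ite (tmpReg t)
      (.seq (.const (tmpReg t) k) (.seq (.arith .mul (tmpReg t) (tmpReg t) 0)
        (.seq (.arith .add (tmpReg t) (tmpReg t) (tmpReg i))
          (.seq (.arith .mul (tmpReg t) (tmpReg t) 0)
            (.seq (.arith .add (tmpReg t) (tmpReg t) (tmpReg j)) p))))) q)))

/-- The value is left in temporary `t`. Subtracting register `2`, which holds `0`, copies a
register. In the two accumulating loops, temporary `t + 1` serves both as loop test and as value of
the body, since `forLoop` recomputes the test after each round. -/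
def LoopExpr.compile : LoopExpr → ℕ → ℕ → RamProg
  | var x, _, t => .arith .sub (tmpReg t) (varReg x) 2
  | lit k, _, t => .const (tmpReg t) k
  | size, _, t => .arith .sub (tmpReg t) 0 2
  | tbl k a b, d, t =>
      .seq (a.compile d t) (.seq (b.compile d (t + 1)) (withAddress k (t + 2) t (t + 1)
        (.load (tmpReg t) (tmpReg (t + 2))) (.const (tmpReg t) 0)))
  | lt a b, d, t =>
      .seq (a.compile d t) (.seq (b.compile d (t + 1))
        (.arith .lt (tmpReg t) (tmpReg t) (tmpReg (t + 1))))
  | and a b, d, t =>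
      .seq (a.compile d t) (.ite (tmpReg t)
        (.seq (b.compile d t) (.ite (tmpReg t) (.const (tmpReg t) 1) .skip)) .skip)
  | not a, d, t =>
      .seq (a.compile d t) (.ite (tmpReg t) (.const (tmpReg t) 0) (.const (tmpReg t) 1))
  | count a, d, t =>
      .seq (.const (tmpReg t) 0) (forLoop d (t + 1) (.seq (a.compile (d + 1) (t + 1))
        (.ite (tmpReg (t + 1)) (.arith .add (tmpReg t) (tmpReg t) 1) .skip)))
  | last a, d, t =>
      .seq (.arith .sub (tmpReg t) 0 2) (forLoop d (t + 1) (.seq (a.compile (d + 1) (t + 1))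
        (.ite (tmpReg (t + 1)) (.arith .sub (tmpReg t) (varReg d) 2) .skip)))

def LoopStmt.compile : LoopStmt → ℕ → RamProg
  | emit e, d => .seq (e.compile d 0) (.emit (tmpReg 0))
  | store k a b e, d =>
      .seq (e.compile d 0) (.seq (a.compile d 1) (.seq (b.compile d 2)
        (withAddress k 3 1 2 (.store (tmpReg 3) (tmpReg 0)) .skip)))
  | seq p q, d => .seq (p.compile d) (q.compile d)
  | whn e p, d => .seq (e.compile d 0) (.ite (tmpReg 0) (p.compile d) .skip)
  | each p, d => forLoop d 0 (p.compile (d + 1))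
  | bind e p, d =>
      .seq (e.compile d 0) (.seq (.arith .sub (varReg d) (tmpReg 0) 2) (p.compile (d + 1)))

/-- The register `r` is one that an expression with `d` variables in scope and `t` temporary values
in use has to preserve. -/
def Protected (d t r : ℕ) : Prop :=
  r ≤ 2 ∨ (r % 2 = 1 ∧ r < 2 * d + 3) ∨ (r % 2 = 0 ∧ r < 2 * t + 4)

/-- The registers and the memory of `s` represent the variables `ρ` of level less than `d` and the
tables `τ`. -/
structure Represents (n d : ℕ) (ρ : ℕ → ℕ) (τ : ℕ → ℕ → ℕ → ℕ) (s : RamState) : Prop where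
  size : s.reg 0 = n
  one : s.reg 1 = 1
  zero : s.reg 2 = 0
  var : ∀ x < d, s.reg (varReg x) = ρ x
  tab : ∀ k x y, x < n → y < n → s.mem ((k * n + x) * n + y) = τ k x y

theorem Represents.congr {n d : ℕ} {ρ : ℕ → ℕ} {τ : ℕ → ℕ → ℕ → ℕ} {s s' : RamState} {t : ℕ}
    (h : Represents n d ρ τ s) (hm : s'.mem = s.mem)
    (hr : ∀ r, Protected d t r → s'.reg r = s.reg r) : Represents n d ρ τ s' where
  size := (hr _ (by simp [Protected])).trans h.size
  one := (hr _ (by simp [Protected])).trans h.one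
  zero := (hr _ (by simp [Protected])).trans h.zero
  var x hx := (hr _ (by simp only [Protected, varReg]; omega)).trans (h.var x hx)
  tab k x y hx hy := by rw [hm]; exact h.tab k x y hx hy

theorem Represents.push {n d : ℕ} {ρ : ℕ → ℕ} {τ : ℕ → ℕ → ℕ → ℕ} {s : RamState}
    (h : Represents n d ρ τ s) {i : ℕ} (hi : s.reg (varReg d) = i) :
    Represents n (d + 1) (Function.update ρ d i) τ s where
  size := h.size
  one := h.one
  zero := h.zero
  var x hx := by
    rcases Nat.lt_succ_iff_lt_or_eq.1 hx with hx | rfl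
    · rw [Function.update_of_ne hx.ne]; exact h.var x hx
    · simpa using hi
  tab := h.tab

theorem Represents.pop {n d i : ℕ} {ρ : ℕ → ℕ} {τ : ℕ → ℕ → ℕ → ℕ} {s : RamState}
    (h : Represents n (d + 1) (Function.update ρ d i) τ s) : Represents n d ρ τ s where
  size := h.size
  one := h.one
  zero := h.zero
  var x hx := by
    rw [h.var x (by omega), Function.update_of_ne hx.ne]
  tab := h.tab

/-! ### Correctness of the compiled programs -/

theorem forLoop_exec {w n d t b : ℕ} (hw : n < 2 ^ w) (I : ℕ → RamState → Prop) {body : RamProg}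
    (hbase : ∀ i s, I i s → s.reg 0 = n ∧ s.reg 1 = 1)
    (hstable : ∀ i s r v, I i s → r = varReg d ∨ r = tmpReg t →
      I i { s with reg := Function.update s.reg r v })
    (hbody : ∀ i s, i < n → I i s → s.reg (varReg d) = i →
      ∃ s' c, RamExec w body s s' c ∧ c ≤ b ∧ I (i + 1) s' ∧ s'.reg (varReg d) = i)
    {s : RamState} (hs : I 0 s) :
    ∃ s' c, RamExec w (forLoop d t body) s s' c ∧ c ≤ n * (b + 5) + 5 ∧ I n s' := by
  -- Here `j` is the number of rounds left. The invariant ignores the counter and the test register,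
  -- so these can be set freely between rounds.
  have key : ∀ j i s, i + j = n → I i s → s.reg (varReg d) = i →
      (s.reg (tmpReg t) = if i < n then 1 else 0) →
      ∃ s' c, RamExec w (.loop (tmpReg t) (.seq body (.seq (.arith .add (varReg d) (varReg d) 1)
        (.arith .lt (tmpReg t) (varReg d) 0)))) s s' c ∧ c ≤ j * (b + 5) + 1 ∧ I n s' := by
    intro j
    induction j with
    | zero =>
      intro i s hij hI hd ht
      obtain rfl : i = n := by omega
      exact ⟨s, 1, .loop_false (by simpa using ht), by omega, hI⟩
    | succ j ih =>
      intro i s hij hI hd ht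
      obtain ⟨s₁, c₁, h₁, hc₁, hI₁, hd₁⟩ := hbody i s (by omega) hI hd
      have hb₁ := hbase _ _ hI₁
      obtain ⟨s₂, c₂, h₂, hc₂, hI₂⟩ := ih (i + 1)
        { s₁ with
          reg := Function.update (Function.update s₁.reg (varReg d) (i + 1)) (tmpReg t)
            (if i + 1 < n then 1 else 0) } (by omega)
        (hstable _ _ _ _ (hstable _ _ _ _ hI₁ (.inl rfl)) (.inr rfl))
        (by
          simp [Function.update_of_ne (varReg_ne_tmpReg d t)]) (by simp)
      refine ⟨s₂, _, .loop_true (t₂ := c₂) (by rw [ht, if_pos (by omega)]; simp) (.seq h₁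
        (.seq (.arith _ _ _ _ _) (.arith _ _ _ _ _))) ?_, ?_, hI₂⟩
      · convert h₂ using 2
        have e : (s₁.reg (varReg d) + s₁.reg 1) % 2 ^ w = i + 1 := by
          rw [hd₁, hb₁.2, Nat.mod_eq_of_lt (by omega)]
        have h0 : (0 : ℕ) ≠ varReg d := ne_varReg (by omega) d
        simp only [RamOp.eval, Function.update_self, Function.update_of_ne h0]
        rw [e, hb₁.1]
      · rw [Nat.succ_mul]; omega
  have h0 : (0 : ℕ) ≠ varReg d := ne_varReg (by omega) d
  obtain ⟨s', c, h, hc, hI⟩ := key n 0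
    { s with
      reg := Function.update (Function.update s.reg (varReg d) 0) (tmpReg t)
        (if 0 < n then 1 else 0) } (by omega)
    (hstable _ _ _ _ (hstable _ _ _ _ hs (.inl rfl)) (.inr rfl))
    (by
      simp [Function.update_of_ne (varReg_ne_tmpReg d t)]) (by simp)
  refine ⟨s', _, .seq (.const _ _ _) (.seq (.arith _ _ _ _ _) (t₂ := c) ?_), ?_, hI⟩
  · convert h using 2
    simp only [RamOp.eval, Function.update_self, Function.update_of_ne h0, Nat.zero_mod]
    rw [(hbase _ _ hs).1]
  · omega

/-- Words are long enough for all counters, addresses and constants. -/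
theorem word_bounds {n w : ℕ} (hw : (n + 2) ^ 6 ≤ 2 ^ w) :
    8 < 2 ^ w ∧ n < 2 ^ w ∧ 9 * n * n < 2 ^ w := by
  have h1 : 2 ^ 4 * (n + 2) ^ 2 ≤ (n + 2) ^ 6 := by
    rw [show 6 = 4 + 2 from rfl, pow_add (n + 2)]
    exact Nat.mul_le_mul_right _ (Nat.pow_le_pow_left (by omega) 4)
  have h2 : 4 ≤ (n + 2) ^ 2 := Nat.pow_le_pow_left (n := 2) (by omega) 2
  refine ⟨by omega, ?_, ?_⟩ <;> nlinarith

/-- There are nine tables, with numbers up to `8`, of `n * n` cells each. -/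
theorem address_lt {n k x y : ℕ} (hk : k ≤ 8) (hx : x < n) (hy : y < n) :
    (k * n + x) * n + y < 9 * n * n := by
  have : k * n ≤ 8 * n := Nat.mul_le_mul_right _ hk
  have h2 : (k * n + x + 1) * n ≤ (9 * n) * n := Nat.mul_le_mul_right _ (by omega)
  nlinarith

theorem address_injective {n k x y k' x' y' : ℕ} (hx : x < n) (hy : y < n) (hx' : x' < n)
    (hy' : y' < n) (h : (k * n + x) * n + y = (k' * n + x') * n + y') :
    k = k' ∧ x = x' ∧ y = y' := by
  have hn : 0 < n := by omega
  have hyy : y = y' := by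
    have := congrArg (· % n) h
    simpa [Nat.mul_add_mod', Nat.mod_eq_of_lt, hy, hy'] using this
  subst hyy
  have h2 : k * n + x = k' * n + x' := Nat.eq_of_mul_eq_mul_right hn (by omega)
  have hxx : x = x' := by
    have := congrArg (· % n) h2
    simpa [Nat.mul_add_mod', Nat.mod_eq_of_lt, hx, hx'] using this
  subst hxx
  exact ⟨Nat.eq_of_mul_eq_mul_right hn (by omega), rfl, rfl⟩

/-- The state `s₁` is the one in which `p` or `q` starts; `s'` and `c` are left open so that either
branch can be plugged in. The product of the two comparisons is their conjunction. The nine extra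
steps are two comparisons, a product, the test, and the five instructions for the address. -/
theorem withAddress_exec {w n k t i j x y : ℕ} (hw : (n + 2) ^ 6 ≤ 2 ^ w) (hk : k ≤ 8)
    (hi : i < t) (hj : j < t) {p q : RamProg} {s : RamState} (hn : s.reg 0 = n)
    (hx : s.reg (tmpReg i) = x) (hy : s.reg (tmpReg j) = y) :
    ∃ s₁, s₁.mem = s.mem ∧ s₁.out = s.out ∧
      (∀ r, r ≠ tmpReg t → r ≠ tmpReg (t + 1) → s₁.reg r = s.reg r) ∧
      (x < n ∧ y < n → s₁.reg (tmpReg t) = (k * n + x) * n + y) ∧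
      ∀ s' c, (if x < n ∧ y < n then RamExec w p s₁ s' c else RamExec w q s₁ s' c) →
        ∃ c', c' ≤ c + 9 ∧ RamExec w (withAddress k t i j p q) s s' c' := by
  obtain ⟨hw8, hwn, hwa⟩ := word_bounds hw
  have e0 : ∀ t, (0 : ℕ) ≠ tmpReg t := ne_tmpReg (by omega)
  have e1 : tmpReg i ≠ tmpReg t := tmpReg_ne (by omega)
  have e2 : tmpReg j ≠ tmpReg t := tmpReg_ne (by omega)
  have e3 : tmpReg t ≠ tmpReg (t + 1) := tmpReg_ne (by omega)
  have e4 : tmpReg i ≠ tmpReg (t + 1) := tmpReg_ne (by omega)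
  have e5 : tmpReg j ≠ tmpReg (t + 1) := tmpReg_ne (by omega)
  have e6 := e3.symm
  by_cases hxy : x < n ∧ y < n
  · have hlt := address_lt hk hxy.1 hxy.2
    have hkn : k * n + x ≤ (k * n + x) * n := Nat.le_mul_of_pos_right _ (by omega)
    have m1 : k % 2 ^ w = k := Nat.mod_eq_of_lt (by omega)
    have m2 : k * n % 2 ^ w = k * n := Nat.mod_eq_of_lt (by omega)
    have m3 : (k * n + x) % 2 ^ w = k * n + x := Nat.mod_eq_of_lt (by omega)
    have m4 : (k * n + x) * n % 2 ^ w = (k * n + x) * n := Nat.mod_eq_of_lt (by omega)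
    have m5 : ((k * n + x) * n + y) % 2 ^ w = (k * n + x) * n + y := Nat.mod_eq_of_lt (by omega)
    refine ⟨{ s with
      reg := Function.update (Function.update s.reg (tmpReg (t + 1)) 1) (tmpReg t)
        ((k * n + x) * n + y) }, rfl, rfl, fun r h1 h2 => by
        simp [Function.update_of_ne h1, Function.update_of_ne h2], fun _ => by simp, ?_⟩
    intro s' c h
    rw [if_pos hxy] at h
    refine ⟨_, ?_, .seq (.arith _ _ _ _ _) (.seq (.arith _ _ _ _ _) (.seq (.arith _ _ _ _ _)
      (.ite_true ?_ (.seq (.const _ _ _) (.seq (.arith _ _ _ _ _) (.seq (.arith _ _ _ _ _)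
        (.seq (.arith _ _ _ _ _) (.seq (.arith _ _ _ _ _) (t₂ := c) ?_))))))))⟩
    · omega
    · have h1 : 1 % 2 ^ w = 1 := Nat.mod_eq_of_lt (by omega)
      simp [RamOp.eval, e0, e1, e2, e3, e4, e5, e6, hn, hx, hy, hxy.1, hxy.2, h1]
    · convert h using 2
      funext r
      by_cases hr : r = tmpReg t
      · subst hr
        simp [RamOp.eval, hn, hx, hy, m1, m2, m3, m4, m5, e0, e1, e2, e4, e5]
      · by_cases hr' : r = tmpReg (t + 1)
        · subst hr'
          simp [RamOp.eval, hn, hy, hxy.2, e0, e2, e6]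
        · simp [hr, hr']
  · refine ⟨{ s with
      reg := Function.update (Function.update s.reg (tmpReg (t + 1)) (if y < n then 1 else 0))
        (tmpReg t) 0 }, rfl, rfl, fun r h1 h2 => by
        simp [Function.update_of_ne h1, Function.update_of_ne h2], fun h => absurd h hxy, ?_⟩
    intro s' c h
    rw [if_neg hxy] at h
    have hz : (if x < n then 1 else 0) * (if y < n then 1 else 0) = 0 := by
      by_cases h1 : x < n
      · rw [if_neg (fun h2 => hxy ⟨h1, h2⟩)]; rfl
      · rw [if_neg h1, zero_mul]
    refine ⟨_, ?_, .seq (.arith _ _ _ _ _) (.seq (.arith _ _ _ _ _) (.seq (.arith _ _ _ _ _)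
      (.ite_false ?_ (t := c) ?_)))⟩
    · omega
    · simp only [RamOp.eval, ne_eq, e0, e1, e2, e3, e4, e5, e6, not_false_eq_true, Function.update_of_ne,
        Function.update_self, hn, hx, hy, hz, Nat.zero_mod]
    · convert h using 2
      funext r
      by_cases hr : r = tmpReg t
      · subst hr
        simp only [RamOp.eval, ne_eq, e0, e1, e2, e3, e4, e5, e6, not_false_eq_true,
          Function.update_of_ne, Function.update_self, hn, hx, hy, hz, Nat.zero_mod]
      · by_cases hr' : r = tmpReg (t + 1)
        · subst hr'
          simp [RamOp.eval, hn, hy, e0, e2, e6]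
        · simp [hr, hr']

theorem Protected.mono {d t d' t' r : ℕ} (h : Protected d t r) (hd : d ≤ d') (ht : t ≤ t') :
    Protected d' t' r := by
  unfold Protected at *
  omega

theorem Protected.ne_tmpReg {d t r : ℕ} (h : Protected d t r) {i : ℕ} (hi : t ≤ i) :
    r ≠ tmpReg i := by
  unfold Protected at h
  simp only [tmpReg]
  omega

theorem Protected.ne_varReg {d t r : ℕ} (h : Protected d t r) {i : ℕ} (hi : d ≤ i) :
    r ≠ varReg i := by
  unfold Protected at h
  simp only [varReg]
  omega

theorem protected_tmpReg (d : ℕ) {t i : ℕ} (hi : i < t) : Protected d t (tmpReg i) := by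
  simp only [Protected, tmpReg]
  omega

theorem protected_varReg {d : ℕ} (t : ℕ) {i : ℕ} (hi : i < d) : Protected d t (varReg i) := by
  simp only [Protected, varReg]
  omega

/-- The program for an accumulating loop is correct. -/
theorem accumulate_exec {w n d t b v₀ : ℕ} (hw : n < 2 ^ w) {init body : RamProg}
    (step : ℕ → ℕ → ℕ) {s : RamState} {ρ : ℕ → ℕ} {τ : ℕ → ℕ → ℕ → ℕ}
    (hs : Represents n d ρ τ s)
    (hinit : RamExec w init s { s with reg := Function.update s.reg (tmpReg t) v₀ } 1)
    (hbody : ∀ i s, i < n → Represents n (d + 1) (Function.update ρ d i) τ s →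
      s.reg (tmpReg t) = iterateUpTo step i v₀ → s.reg (varReg d) = i →
      ∃ s' c, RamExec w body s s' c ∧ c ≤ b ∧ s'.mem = s.mem ∧ s'.out = s.out ∧
        s'.reg (tmpReg t) = step i (iterateUpTo step i v₀) ∧
        ∀ r, Protected (d + 1) t r → s'.reg r = s.reg r) :
    ∃ s' c, RamExec w (.seq init (forLoop d (t + 1) body)) s s' c ∧ c ≤ n * (b + 5) + 6 ∧
      s'.mem = s.mem ∧ s'.out = s.out ∧ s'.reg (tmpReg t) = iterateUpTo step n v₀ ∧
      ∀ r, Protected d t r → s'.reg r = s.reg r := by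
  let I : ℕ → RamState → Prop := fun i s' => s'.mem = s.mem ∧ s'.out = s.out ∧
    s'.reg (tmpReg t) = iterateUpTo step i v₀ ∧ ∀ r, Protected d t r → s'.reg r = s.reg r
  have hrep : ∀ i s', I i s' → Represents n d ρ τ s' := fun i s' h => hs.congr h.1 h.2.2.2
  obtain ⟨s', c, h, hc, hI⟩ := forLoop_exec (w := w) (n := n) (d := d) (t := t + 1) (b := b) hw I
    (body := body) (fun i s' h => ⟨(hrep i s' h).size, (hrep i s' h).one⟩)
    (by
      rintro i s' r v ⟨h1, h2, h3, h4⟩ hr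
      have hr' : tmpReg t ≠ r := by
        rcases hr with rfl | rfl
        · exact (varReg_ne_tmpReg d t).symm
        · exact tmpReg_ne (by omega)
      refine ⟨h1, h2, by simpa [Function.update_of_ne hr'] using h3, fun q hq => ?_⟩
      have : q ≠ r := by
        rcases hr with rfl | rfl
        · exact hq.ne_varReg le_rfl
        · exact hq.ne_tmpReg (by omega)
      simpa [Function.update_of_ne this] using h4 q hq)
    (by
      rintro i s' hi hI hd
      obtain ⟨s'', c, h, hc, h1, h2, h3, h4⟩ := hbody i s' hi ((hrep i s' hI).push hd) hI.2.2.1 hd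
      exact ⟨s'', c, h, hc, ⟨h1.trans hI.1, h2.trans hI.2.1, h3, fun r hr =>
        (h4 r (hr.mono (by omega) le_rfl)).trans (hI.2.2.2 r hr)⟩,
        (h4 _ (protected_varReg t (by omega))).trans hd⟩)
    (s := { s with reg := Function.update s.reg (tmpReg t) v₀ })
    ⟨rfl, rfl, by simp [iterateUpTo], fun r hr => Function.update_of_ne (hr.ne_tmpReg le_rfl) _ _⟩
  exact ⟨s', 1 + c, .seq hinit h, by omega, hI⟩

/-- Guarantees that a counter never overflows a word. -/
theorem iterateUpTo_count_le (f : ℕ → Prop) [DecidablePred f] (k : ℕ) :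
    iterateUpTo (fun i c => if f i then c + 1 else c) k 0 ≤ k := by
  induction k with
  | zero => simp [iterateUpTo]
  | succ k ih =>
    simp only [iterateUpTo]
    split <;> omega

/-- The preserved registers are what makes the induction work: the value of a first operand sits in
temporary `t` and survives the evaluation of the second one, which only has to respect the
temporaries up to `t`. -/
theorem LoopExpr.compile_exec {w n : ℕ} (hw : (n + 2) ^ 6 ≤ 2 ^ w) {τ : ℕ → ℕ → ℕ → ℕ}
    (e : LoopExpr) : ∀ (d t : ℕ) (ρ : ℕ → ℕ) (s : RamState), e.Scoped d = true →
      Represents n d ρ τ s →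
      ∃ s' c, RamExec w (e.compile d t) s s' c ∧ c ≤ e.cost n ∧ s'.mem = s.mem ∧ s'.out = s.out ∧
        s'.reg (tmpReg t) = e.eval n τ d ρ ∧ ∀ r, Protected d t r → s'.reg r = s.reg r := by
  obtain ⟨hw8, hwn, hwa⟩ := word_bounds hw
  have upd : ∀ (s : RamState) (d t v : ℕ), ∀ r, Protected d t r →
      Function.update s.reg (tmpReg t) v r = s.reg r := fun s d t v r hr =>
    Function.update_of_ne (hr.ne_tmpReg le_rfl) _ _
  induction e with
  | var x =>
    intro d t ρ s hsc hs
    refine ⟨_, _, .arith _ _ _ _ _, le_rfl, rfl, rfl, ?_, upd s d t _⟩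
    simp only [Scoped, decide_eq_true_eq] at hsc
    simp [RamOp.eval, hs.zero, hs.var x hsc, eval]
  | lit k =>
    intro d t ρ s hsc hs
    refine ⟨_, _, .const _ _ _, le_rfl, rfl, rfl, ?_, upd s d t _⟩
    simp only [Scoped, decide_eq_true_eq] at hsc
    simp [eval, Nat.mod_eq_of_lt (show k < 2 ^ w by omega)]
  | size =>
    intro d t ρ s hsc hs
    refine ⟨_, _, .arith _ _ _ _ _, le_rfl, rfl, rfl, ?_, upd s d t _⟩
    simp [RamOp.eval, hs.zero, hs.size, eval]
  | tbl k a b iha ihb =>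
    intro d t ρ s hsc hs
    simp only [Scoped, Bool.and_eq_true, decide_eq_true_eq] at hsc
    obtain ⟨s₁, c₁, h₁, hc₁, hm₁, ho₁, hv₁, hr₁⟩ := iha d t ρ s hsc.2.1 hs
    have hs₁ := hs.congr hm₁ hr₁
    obtain ⟨s₂, c₂, h₂, hc₂, hm₂, ho₂, hv₂, hr₂⟩ := ihb d (t + 1) ρ s₁ hsc.2.2 hs₁
    have hs₂ := hs₁.congr hm₂ hr₂
    obtain ⟨s₃, hm₃, ho₃, hr₃, ha₃, h₃⟩ := withAddress_exec hw hsc.1 (t := t + 2) (i := t)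
      (j := t + 1) (by omega) (by omega) (p := .load (tmpReg t) (tmpReg (t + 2)))
      (q := .const (tmpReg t) 0) hs₂.size rfl rfl
    have hv₁' : s₂.reg (tmpReg t) = a.eval n τ d ρ :=
      (hr₂ _ (protected_tmpReg d (by omega))).trans hv₁
    rw [hv₁', hv₂] at h₃ ha₃
    have hpres : ∀ r, Protected d t r → s₃.reg r = s.reg r := fun r hr =>
      ((hr₃ r (hr.ne_tmpReg (by omega)) (hr.ne_tmpReg (by omega))).trans
        (hr₂ r (hr.mono le_rfl (by omega)))).trans (hr₁ r hr)
    obtain ⟨c₃, hc₃, h₃⟩ := h₃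
      { s₃ with reg := Function.update s₃.reg (tmpReg t) ((tbl k a b).eval n τ d ρ) } 1 (by
        split_ifs with hab
        · have := RamExec.load (w := w) (tmpReg t) (tmpReg (t + 2)) s₃
          convert this using 3
          rw [ha₃ hab, eval, if_pos hab, hm₃, hs₂.tab k _ _ hab.1 hab.2]
        · have := RamExec.const (w := w) (tmpReg t) 0 s₃
          convert this using 3
          rw [eval, if_neg hab, Nat.zero_mod])
    refine ⟨_, _, .seq h₁ (.seq h₂ h₃), ?_, hm₃.trans (hm₂.trans hm₁), ho₃.trans (ho₂.trans ho₁),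
      by simp, fun r hr => (upd s₃ d t _ r hr).trans (hpres r hr)⟩
    simp only [cost]
    omega
  | lt a b iha ihb =>
    intro d t ρ s hsc hs
    simp only [Scoped, Bool.and_eq_true] at hsc
    obtain ⟨s₁, c₁, h₁, hc₁, hm₁, ho₁, hv₁, hr₁⟩ := iha d t ρ s hsc.1 hs
    have hs₁ := hs.congr hm₁ hr₁
    obtain ⟨s₂, c₂, h₂, hc₂, hm₂, ho₂, hv₂, hr₂⟩ := ihb d (t + 1) ρ s₁ hsc.2 hs₁
    have hv₁' : s₂.reg (tmpReg t) = a.eval n τ d ρ :=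
      (hr₂ _ (protected_tmpReg d (by omega))).trans hv₁
    refine ⟨_, _, .seq h₁ (.seq h₂ (.arith _ _ _ _ _)), ?_, hm₂.trans hm₁, ho₂.trans ho₁, ?_,
      fun r hr => (upd s₂ d t _ r hr).trans ((hr₂ r (hr.mono le_rfl (by omega))).trans (hr₁ r hr))⟩
    · simp only [cost]
      omega
    · simp [RamOp.eval, hv₁', hv₂, eval]
  | and a b iha ihb =>
    intro d t ρ s hsc hs
    simp only [Scoped, Bool.and_eq_true] at hsc
    obtain ⟨s₁, c₁, h₁, hc₁, hm₁, ho₁, hv₁, hr₁⟩ := iha d t ρ s hsc.1 hs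
    have hs₁ := hs.congr hm₁ hr₁
    obtain ⟨s₂, c₂, h₂, hc₂, hm₂, ho₂, hv₂, hr₂⟩ := ihb d t ρ s₁ hsc.2 hs₁
    by_cases ha : a.eval n τ d ρ = 0
    · refine ⟨_, _, .seq h₁ (.ite_false (by rw [hv₁, ha]) (.skip _)), ?_, hm₁, ho₁, ?_, hr₁⟩
      · simp only [cost]
        omega
      · rw [hv₁, eval, ha, if_neg (by simp)]
    · by_cases hb : b.eval n τ d ρ = 0
      · refine ⟨_, _, .seq h₁ (.ite_true (by rwa [hv₁]) (.seq h₂ (.ite_false (by rw [hv₂, hb])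
          (.skip _)))), ?_, hm₂.trans hm₁, ho₂.trans ho₁, ?_,
          fun r hr => (hr₂ r hr).trans (hr₁ r hr)⟩
        · simp only [cost]
          omega
        · rw [hv₂, eval, hb, if_neg (by simp)]
      · refine ⟨_, _, .seq h₁ (.ite_true (by rwa [hv₁]) (.seq h₂ (.ite_true (by rwa [hv₂])
          (.const _ _ _)))), ?_, hm₂.trans hm₁, ho₂.trans ho₁, ?_,
          fun r hr => (upd s₂ d t _ r hr).trans ((hr₂ r hr).trans (hr₁ r hr))⟩
        · simp only [cost]
          omega
        · simp [eval, ha, hb, Nat.mod_eq_of_lt (show 1 < 2 ^ w by omega)]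
  | not a iha =>
    intro d t ρ s hsc hs
    obtain ⟨s₁, c₁, h₁, hc₁, hm₁, ho₁, hv₁, hr₁⟩ := iha d t ρ s hsc hs
    by_cases ha : a.eval n τ d ρ = 0
    · refine ⟨_, _, .seq h₁ (.ite_false (by rw [hv₁, ha]) (.const _ _ _)), ?_, hm₁, ho₁, ?_,
        fun r hr => (upd s₁ d t _ r hr).trans (hr₁ r hr)⟩
      · simp only [cost]
        omega
      · simp [eval, ha, Nat.mod_eq_of_lt (show 1 < 2 ^ w by omega)]
    · refine ⟨_, _, .seq h₁ (.ite_true (by rwa [hv₁]) (.const _ _ _)), ?_, hm₁, ho₁, ?_,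
        fun r hr => (upd s₁ d t _ r hr).trans (hr₁ r hr)⟩
      · simp only [cost]
        omega
      · simp [eval, ha]
  | count a iha =>
    intro d t ρ s hsc hs
    obtain ⟨s', c, h, hc, hrest⟩ := accumulate_exec (w := w) (t := t) (b := a.cost n + 2) (v₀ := 0) hwn
      (fun i c => if a.eval n τ (d + 1) (Function.update ρ d i) ≠ 0 then c + 1 else c) hs
      (init := .const (tmpReg t) 0)
      (body := .seq (a.compile (d + 1) (t + 1))
        (.ite (tmpReg (t + 1)) (.arith .add (tmpReg t) (tmpReg t) 1) .skip))
      (by simpa using RamExec.const (w := w) (tmpReg t) 0 s)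
      (by
        intro i s hi hs hv hvar
        obtain ⟨s₁, c₁, h₁, hc₁, hm₁, ho₁, hv₁, hr₁⟩ := iha (d + 1) (t + 1) _ s hsc hs
        have hs₁ := hs.congr hm₁ hr₁
        have hv' := (hr₁ (tmpReg t) (protected_tmpReg _ (by omega))).trans hv
        by_cases ha : a.eval n τ (d + 1) (Function.update ρ d i) = 0
        · refine ⟨_, _, .seq h₁ (.ite_false (by rw [hv₁, ha]) (.skip _)), ?_, hm₁, ho₁, ?_,
            fun r hr => hr₁ r (hr.mono le_rfl (by omega))⟩
          · omega
          · simp only [hv', ha, ne_eq, not_true_eq_false, if_false]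
        · refine ⟨_, _, .seq h₁ (.ite_true (by rwa [hv₁]) (.arith _ _ _ _ _)), ?_, hm₁, ho₁, ?_,
            fun r hr => (upd s₁ (d + 1) t _ r hr).trans (hr₁ r (hr.mono le_rfl (by omega)))⟩
          · omega
          -- Before round `i` the counter is at most `i < n`, so the addition does not wrap around.
          · have hle := iterateUpTo_count_le
              (fun i => a.eval n τ (d + 1) (Function.update ρ d i) ≠ 0) i
            simp only [Function.update_self, RamOp.eval, hv', hs₁.one]
            rw [if_pos ha, Nat.mod_eq_of_lt (by omega)])
    refine ⟨s', c, h, ?_, hrest⟩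
    simp only [cost]
    nlinarith
  | last a iha =>
    intro d t ρ s hsc hs
    obtain ⟨s', c, h, hc, hrest⟩ := accumulate_exec (w := w) (t := t) (b := a.cost n + 2) (v₀ := n) hwn
      (fun i c => if a.eval n τ (d + 1) (Function.update ρ d i) ≠ 0 then i else c) hs
      (init := .arith .sub (tmpReg t) 0 2)
      (body := .seq (a.compile (d + 1) (t + 1))
        (.ite (tmpReg (t + 1)) (.arith .sub (tmpReg t) (varReg d) 2) .skip))
      (by simpa [RamOp.eval, hs.zero, hs.size] using RamExec.arith (w := w) .sub (tmpReg t) 0 2 s)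
      (by
        intro i s hi hs hv hvar
        obtain ⟨s₁, c₁, h₁, hc₁, hm₁, ho₁, hv₁, hr₁⟩ := iha (d + 1) (t + 1) _ s hsc hs
        have hs₁ := hs.congr hm₁ hr₁
        have hv' := (hr₁ (tmpReg t) (protected_tmpReg _ (by omega))).trans hv
        have hvar' := (hr₁ (varReg d) (protected_varReg _ (by omega))).trans hvar
        by_cases ha : a.eval n τ (d + 1) (Function.update ρ d i) = 0
        · refine ⟨_, _, .seq h₁ (.ite_false (by rw [hv₁, ha]) (.skip _)), ?_, hm₁, ho₁, ?_,
            fun r hr => hr₁ r (hr.mono le_rfl (by omega))⟩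
          · omega
          · simp only [hv', ha, ne_eq, not_true_eq_false, if_false]
        · refine ⟨_, _, .seq h₁ (.ite_true (by rwa [hv₁]) (.arith _ _ _ _ _)), ?_, hm₁, ho₁, ?_,
            fun r hr => (upd s₁ (d + 1) t _ r hr).trans (hr₁ r (hr.mono le_rfl (by omega)))⟩
          · omega
          · simp only [Function.update_self, RamOp.eval, hvar', hs₁.zero]
            rw [if_pos ha, Nat.sub_zero])
    refine ⟨s', c, h, ?_, hrest⟩
    simp only [cost]
    nlinarith

/-- No temporary value has to survive a statement, so the invariant speaks only of the variables,
the tables and the output. -/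
theorem LoopStmt.compile_exec {w n : ℕ} (hw : (n + 2) ^ 6 ≤ 2 ^ w) (p : LoopStmt) :
    ∀ (d : ℕ) (ρ : ℕ → ℕ) (D : LoopData) (s : RamState), p.Scoped d = true →
      Represents n d ρ D.tab s → s.out = D.out →
      ∃ s' c, RamExec w (p.compile d) s s' c ∧ c ≤ p.cost n ∧
        Represents n d ρ (p.run n d ρ D).tab s' ∧ s'.out = (p.run n d ρ D).out := by
  obtain ⟨hw8, hwn, hwa⟩ := word_bounds hw
  induction p with
  | emit e =>
    intro d ρ D s hsc hs ho
    obtain ⟨s₁, c₁, h₁, hc₁, hm₁, ho₁, hv₁, hr₁⟩ := e.compile_exec hw d 0 ρ s hsc hs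
    refine ⟨_, _, .seq h₁ (.emit _ _), ?_, (hs.congr hm₁ hr₁).congr (t := 0) rfl fun _ _ => rfl, ?_⟩
    · simp only [cost]
      omega
    · simp [run, ho₁, ho, hv₁]
  | store k a b e =>
    intro d ρ D s hsc hs ho
    simp only [Scoped, Bool.and_eq_true, decide_eq_true_eq] at hsc
    obtain ⟨s₀, c₀, h₀, hc₀, hm₀, ho₀, hv₀, hr₀⟩ := e.compile_exec hw d 0 ρ s hsc.2.2.2 hs
    have hs₀ := hs.congr hm₀ hr₀
    obtain ⟨s₁, c₁, h₁, hc₁, hm₁, ho₁, hv₁, hr₁⟩ := a.compile_exec hw d 1 ρ s₀ hsc.2.1 hs₀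
    have hs₁ := hs₀.congr hm₁ hr₁
    obtain ⟨s₂, c₂, h₂, hc₂, hm₂, ho₂, hv₂, hr₂⟩ := b.compile_exec hw d 2 ρ s₁ hsc.2.2.1 hs₁
    have hs₂ := hs₁.congr hm₂ hr₂
    obtain ⟨s₃, hm₃, ho₃, hr₃, ha₃, h₃⟩ := withAddress_exec hw hsc.1 (t := 3) (i := 1)
      (j := 2) (by omega) (by omega) (p := .store (tmpReg 3) (tmpReg 0))
      (q := .skip) hs₂.size rfl rfl
    have hv₀' : s₃.reg (tmpReg 0) = e.eval n D.tab d ρ :=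
      (hr₃ _ (tmpReg_ne (by omega)) (tmpReg_ne (by omega))).trans
        ((hr₂ _ (protected_tmpReg d (by omega))).trans
          ((hr₁ _ (protected_tmpReg d (by omega))).trans hv₀))
    have hv₁' : s₂.reg (tmpReg 1) = a.eval n D.tab d ρ :=
      (hr₂ _ (protected_tmpReg d (by omega))).trans hv₁
    have hs₃ : Represents n d ρ D.tab s₃ := hs₂.congr (t := 0) hm₃ fun r hr =>
      hr₃ r (hr.ne_tmpReg (by omega)) (hr.ne_tmpReg (by omega))
    rw [hv₁', hv₂] at h₃ ha₃
    have hout : s₃.out = D.out := by rw [ho₃, ho₂, ho₁, ho₀, ho]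
    by_cases hab : a.eval n D.tab d ρ < n ∧ b.eval n D.tab d ρ < n
    · obtain ⟨c₃, hc₃, h₃⟩ := h₃ _ 1 (by rw [if_pos hab]; exact .store _ _ _)
      refine ⟨_, _, .seq h₀ (.seq h₁ (.seq h₂ h₃)), ?_, ⟨hs₃.size, hs₃.one, hs₃.zero, hs₃.var, ?_⟩, ?_⟩
      · simp only [cost]
        omega
      · intro k' x y hx hy
        simp only [run, if_pos hab, ha₃ hab, hv₀']
        by_cases hxy : k' = k ∧ x = a.eval n D.tab d ρ ∧ y = b.eval n D.tab d ρ
        · obtain ⟨rfl, rfl, rfl⟩ := hxy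
          simp
        · rw [if_neg hxy, Function.update_of_ne, hs₃.tab k' x y hx hy]
          exact fun h => hxy (address_injective hx hy hab.1 hab.2 h)
      · simp only [run, if_pos hab, hout]
    · obtain ⟨c₃, hc₃, h₃⟩ := h₃ _ 1 (by rw [if_neg hab]; exact .skip _)
      refine ⟨_, _, .seq h₀ (.seq h₁ (.seq h₂ h₃)), ?_, ?_, ?_⟩
      · simp only [cost]
        omega
      · simpa only [run, if_neg hab] using hs₃
      · simp only [run, if_neg hab, hout]
  | seq p q ihp ihq =>
    intro d ρ D s hsc hs ho
    simp only [Scoped, Bool.and_eq_true] at hsc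
    obtain ⟨s₁, c₁, h₁, hc₁, hs₁, ho₁⟩ := ihp d ρ D s hsc.1 hs ho
    obtain ⟨s₂, c₂, h₂, hc₂, hs₂, ho₂⟩ := ihq d ρ _ s₁ hsc.2 hs₁ ho₁
    exact ⟨s₂, _, .seq h₁ h₂, by simp only [cost]; omega, hs₂, ho₂⟩
  | whn e p ihp =>
    intro d ρ D s hsc hs ho
    simp only [Scoped, Bool.and_eq_true] at hsc
    obtain ⟨s₁, c₁, h₁, hc₁, hm₁, ho₁, hv₁, hr₁⟩ := e.compile_exec hw d 0 ρ s hsc.1 hs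
    have hs₁ := hs.congr hm₁ hr₁
    by_cases he : e.eval n D.tab d ρ = 0
    · refine ⟨_, _, .seq h₁ (.ite_false (by rw [hv₁, he]) (.skip _)), by simp only [cost]; omega, ?_, ?_⟩
      · simpa [run, he] using hs₁
      · simp [run, he, ho₁, ho]
    · obtain ⟨s₂, c₂, h₂, hc₂, hs₂, ho₂⟩ := ihp d ρ D s₁ hsc.2 hs₁ (ho₁.trans ho)
      refine ⟨_, _, .seq h₁ (.ite_true (by rwa [hv₁]) h₂), by simp only [cost]; omega, ?_, ?_⟩
      · simpa [run, he] using hs₂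
      · simp [run, he, ho₂]
  | each p ihp =>
    intro d ρ D s hsc hs ho
    obtain ⟨s', c, h, hc, hI⟩ := forLoop_exec (w := w) (n := n) (d := d) (t := 0) (b := p.cost n) hwn
      (fun i s' => Represents n d ρ
          (iterateUpTo (fun i D => p.run n (d + 1) (Function.update ρ d i) D) i D).tab s' ∧
        s'.out = (iterateUpTo (fun i D => p.run n (d + 1) (Function.update ρ d i) D) i D).out)
      (body := p.compile (d + 1)) (fun i s' h => ⟨h.1.size, h.1.one⟩)
      (by
        rintro i s' r v ⟨h1, h2⟩ hr
        refine ⟨h1.congr (t := 0) rfl fun q hq => Function.update_of_ne ?_ _ _, h2⟩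
        rcases hr with rfl | rfl
        · exact hq.ne_varReg le_rfl
        · exact hq.ne_tmpReg le_rfl)
      (by
        rintro i s' hi ⟨h1, h2⟩ hd
        obtain ⟨s₂, c₂, h₂, hc₂, hs₂, ho₂⟩ := ihp (d + 1) (Function.update ρ d i) _ s' hsc
          (h1.push hd) h2
        refine ⟨s₂, c₂, h₂, hc₂, ⟨hs₂.pop, ho₂⟩, ?_⟩
        simpa using hs₂.var d (by omega))
      (s := s) ⟨hs, ho⟩
    exact ⟨s', c, h, hc, hI⟩
  | bind e p ihp =>
    intro d ρ D s hsc hs ho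
    simp only [Scoped, Bool.and_eq_true] at hsc
    obtain ⟨s₁, c₁, h₁, hc₁, hm₁, ho₁, hv₁, hr₁⟩ := e.compile_exec hw d 0 ρ s hsc.1 hs
    have hs₁ := hs.congr hm₁ hr₁
    have hs' : Represents n d ρ D.tab
        { s₁ with reg := Function.update s₁.reg (varReg d) (e.eval n D.tab d ρ) } :=
      hs₁.congr (t := 0) rfl fun r hr => Function.update_of_ne (hr.ne_varReg le_rfl) _ _
    obtain ⟨s₂, c₂, h₂, hc₂, hs₂, ho₂⟩ := ihp (d + 1) (Function.update ρ d (e.eval n D.tab d ρ)) D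
      _ hsc.2 (hs'.push (Function.update_self _ _ _)) (ho₁.trans ho)
    refine ⟨s₂, _, .seq h₁ (.seq (.arith _ _ _ _ _) (t₂ := c₂) ?_), by simp only [cost]; omega, hs₂.pop,
      ho₂⟩
    convert h₂ using 3
    simp only [RamOp.eval, hv₁, hs₁.zero, Nat.sub_zero]

/-! ### Distances in trees -/

namespace SimpleGraph.IsTree

variable {W : Type*} {T : SimpleGraph W}

/-- Shortest walks from `a` to `p` and from `p` to `b` combine to a walk of length `T.dist a b`,
hence to the unique path from `a` to `b`, and every walk from `a` to `b` contains this path. -/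
theorem mem_support_of_between (hT : T.IsTree) {a b p : W} (h : T.dist a p + T.dist p b = T.dist a b)
    (r : T.Walk a b) : p ∈ r.support := by
  classical
  obtain ⟨q₁, hq₁⟩ := hT.connected.exists_walk_length_eq_dist a p
  obtain ⟨q₂, hq₂⟩ := hT.connected.exists_walk_length_eq_dist p b
  have hpath : (q₁.append q₂).IsPath := Walk.isPath_of_length_eq_dist _ (by
    rw [Walk.length_append, hq₁, hq₂, h])
  have huniq := (hT.existsUnique_path a b).unique hpath r.bypass_isPath
  refine r.support_bypass_subset_support ?_
  rw [← huniq, Walk.mem_support_append_iff]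
  exact .inl q₁.end_mem_support

/-- A node `p` between `a` and `b` lies on the way from any node to `a` or to `b`. -/
theorem dist_eq_or_dist_eq (hT : T.IsTree) {a b p : W} (h : T.dist a p + T.dist p b = T.dist a b)
    (s : W) : T.dist s a = T.dist s p + T.dist p a ∨ T.dist s b = T.dist s p + T.dist p b := by
  classical
  obtain ⟨q₁, hq₁⟩ := hT.connected.exists_walk_length_eq_dist s a
  obtain ⟨q₂, hq₂⟩ := hT.connected.exists_walk_length_eq_dist s b
  have key : ∀ (x : W) (q : T.Walk s x), q.length = T.dist s x → p ∈ q.support →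
      T.dist s x = T.dist s p + T.dist p x := by
    intro x q hq hp
    refine le_antisymm hT.connected.dist_triangle ?_
    rw [← hq, ← q.take_spec hp, Walk.length_append]
    exact add_le_add (dist_le _) (dist_le _)
  -- The walk from `a` via `s` to `b` must visit `p`, on one of its two halves.
  have := hT.mem_support_of_between h (q₁.reverse.append q₂)
  rw [Walk.mem_support_append_iff, Walk.support_reverse, List.mem_reverse] at this
  exact this.imp (key a q₁ hq₁) (key b q₂ hq₂)

end SimpleGraph.IsTree

theorem SimpleGraph.Connected.exists_dist_eq {W : Type*} {T : SimpleGraph W} (hT : T.Connected)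
    (a b : W) {k : ℕ} (hk : k ≤ T.dist a b) :
    ∃ c, T.dist a c = k ∧ k + T.dist c b = T.dist a b := by
  obtain ⟨p, hp⟩ := hT.exists_walk_length_eq_dist a b
  have h1 : T.dist a (p.getVert k) ≤ k := (dist_le (p.take k)).trans (by
    rw [Walk.take_length]; exact min_le_left _ _)
  have h2 : T.dist (p.getVert k) b ≤ T.dist a b - k := (dist_le (p.drop k)).trans (by
    rw [Walk.drop_length, hp])
  have h3 := hT.dist_triangle (u := a) (v := p.getVert k) (w := b)
  exact ⟨p.getVert k, by omega, by omega⟩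

/-! ### The subtree spanned by a set of real nodes -/

theorem mem_hull_of_between {V σ : Type} {T : SimpleGraph (V ⊕ σ)} (hT : T.IsTree) {S : Finset V}
    {a b : V} (ha : a ∈ S) (hb : b ∈ S) {p : V ⊕ σ}
    (h : T.dist (Sum.inl a) p + T.dist p (Sum.inl b) = T.dist (Sum.inl a) (Sum.inl b)) :
    p ∈ hull T S := by
  rintro A ⟨hA, hconn⟩
  obtain ⟨q⟩ := hconn.preconnected ⟨_, hA a ha⟩ ⟨_, hA b hb⟩
  have : p ∈ (q.map (SimpleGraph.Embedding.induce A).toHom).support :=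
    hT.mem_support_of_between h _
  rw [SimpleGraph.Walk.support_map, List.mem_map] at this
  obtain ⟨x, -, rfl⟩ := this
  exact x.2

theorem hull_subset {V σ : Type} {T : SimpleGraph (V ⊕ σ)} {S : Finset V} {A : Set (V ⊕ σ)}
    (hA : ∀ v ∈ S, Sum.inl v ∈ A) (c : V ⊕ σ) (hc : c ∈ A)
    (hconn : ∀ x : A, (T.induce A).Reachable ⟨c, hc⟩ x) : hull T S ⊆ A :=
  Set.sInter_subset_of_mem ⟨hA,
    (SimpleGraph.connected_iff_exists_forall_reachable _).2 ⟨⟨c, hc⟩, hconn⟩⟩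

theorem mem_hull_of_mem {V σ : Type} (T : SimpleGraph (V ⊕ σ)) {S : Finset V} {v : V} (hv : v ∈ S) :
    Sum.inl v ∈ hull T S := fun _ hA => hA.1 v hv

/-- The subtree spanned by `S` is a star with centre `c`. -/
structure IsStarAt {V σ : Type} (T : SimpleGraph (V ⊕ σ)) (S : Finset V) (c : V ⊕ σ) : Prop where
  hull_eq : hull T S = {x | (∃ s ∈ S, x = Sum.inl s) ∨ x = c}
  adj : ∀ s ∈ S, Sum.inl s ≠ c → T.Adj c (Sum.inl s)
  real : ∀ z, c = Sum.inl z → z ∈ S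

/-- The subtree spanned by `S` has diameter three and central nodes `c₁`, `c₂`. -/
structure IsBistarAt {V σ : Type} (T : SimpleGraph (V ⊕ σ)) (S : Finset V) (c₁ c₂ : V ⊕ σ) :
    Prop where
  hull_eq : hull T S = {x | (∃ s ∈ S, x = Sum.inl s) ∨ x = c₁ ∨ x = c₂}
  adj_centre : T.Adj c₁ c₂
  adj : ∀ s ∈ S, Sum.inl s ≠ c₁ → Sum.inl s ≠ c₂ → T.Adj c₁ (Sum.inl s) ∨ T.Adj c₂ (Sum.inl s)
  real₁ : ∀ z, c₁ = Sum.inl z → z ∈ S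
  real₂ : ∀ z, c₂ = Sum.inl z → z ∈ S
  left : ∃ a ∈ S, Sum.inl a ≠ c₂ ∧ T.Adj c₁ (Sum.inl a)
  right : ∃ b ∈ S, Sum.inl b ≠ c₁ ∧ T.Adj c₂ (Sum.inl b)

theorem IsBistarAt.symm {V σ : Type} {T : SimpleGraph (V ⊕ σ)} {S : Finset V} {c₁ c₂ : V ⊕ σ}
    (h : IsBistarAt T S c₁ c₂) : IsBistarAt T S c₂ c₁ where
  hull_eq := by
    rw [h.hull_eq]
    ext x
    exact or_congr Iff.rfl or_comm
  adj_centre := h.adj_centre.symm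
  adj s hs h2 h1 := (h.adj s hs h1 h2).symm
  real₁ := h.real₂
  real₂ := h.real₁
  left := h.right
  right := h.left

/-- `S` is the set of common neighbours of the nonadjacent vertices `u`, `v`. -/
structure IsCommonNeighborSet {V : Type} (G : SimpleGraph V) (S : Finset V) (u v : V) : Prop where
  ne : u ≠ v
  not_adj : ¬ G.Adj u v
  mem_iff : ∀ x, x ∈ S ↔ G.Adj u x ∧ G.Adj v x

/-! ### A separator inside a root spans a star or a bistar -/

section Root

variable {V σ : Type} {G : SimpleGraph V} {T : SimpleGraph (V ⊕ σ)} {S : Finset V} {u v : V}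

theorem IsSteinerRoot.adj_iff {k : ℕ} (h : IsSteinerRoot k G T) (x y : V) :
    G.Adj x y ↔ x ≠ y ∧ T.dist (Sum.inl x) (Sum.inl y) ≤ k := by
  rw [← h.2, SimpleGraph.comap_adj]
  change 0 < _ ∧ _ ↔ _
  refine and_congr_left fun _ => ⟨?_, fun hne => h.1.connected.pos_dist_of_ne (by simpa)⟩
  rintro hpos rfl
  simp at hpos

theorem IsCommonNeighborSet.dist_le_left (h : IsCommonNeighborSet G S u v)
    (hr : IsSteinerRoot 4 G T) {s : V} (hs : s ∈ S) : T.dist (Sum.inl u) (Sum.inl s) ≤ 4 :=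
  ((hr.adj_iff u s).1 ((h.mem_iff s).1 hs).1).2

theorem IsCommonNeighborSet.symm (h : IsCommonNeighborSet G S u v) :
    IsCommonNeighborSet G S v u :=
  ⟨h.ne.symm, fun h' => h.not_adj h'.symm, fun x => by rw [h.mem_iff, and_comm]⟩

theorem IsCommonNeighborSet.four_lt_dist (h : IsCommonNeighborSet G S u v)
    (hr : IsSteinerRoot 4 G T) : 4 < T.dist (Sum.inl u) (Sum.inl v) := by
  by_contra hlt
  exact h.not_adj ((hr.adj_iff u v).2 ⟨h.ne, by omega⟩)

/-- The vertex `u` is at distance at most `4 - k` from a node between two elements of `S` that is at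
distance at least `k` from both. -/
theorem IsCommonNeighborSet.dist_le_of_between (h : IsCommonNeighborSet G S u v)
    (hr : IsSteinerRoot 4 G T) {a b : V} (ha : a ∈ S) (hb : b ∈ S) {p : V ⊕ σ}
    (hp : T.dist (Sum.inl a) p + T.dist p (Sum.inl b) = T.dist (Sum.inl a) (Sum.inl b))
    {k : ℕ} (hka : k ≤ T.dist (Sum.inl a) p) (hkb : k ≤ T.dist p (Sum.inl b)) :
    T.dist (Sum.inl u) p + k ≤ 4 := by
  have h1 := h.dist_le_left hr ha
  have h2 := h.dist_le_left hr hb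
  rw [SimpleGraph.dist_comm] at hka
  rcases hr.1.dist_eq_or_dist_eq hp (Sum.inl u) with h3 | h3 <;> omega

/-- If the distance were four, the middle of the path would be within two of both `u` and `v`, which
would make these adjacent. -/
theorem IsCommonNeighborSet.dist_le_three (h : IsCommonNeighborSet G S u v)
    (hr : IsSteinerRoot 4 G T) (hS : G.IsClique (S : Set V)) {a b : V} (ha : a ∈ S) (hb : b ∈ S) :
    T.dist (Sum.inl a) (Sum.inl b) ≤ 3 := by
  by_cases hab : a = b
  · subst hab
    simp
  have h4 := ((hr.adj_iff a b).1 (hS ha hb hab)).2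
  by_contra hlt
  obtain ⟨p, hp1, hp2⟩ := hr.1.connected.exists_dist_eq (Sum.inl a) (Sum.inl b) (k := 2) (by omega)
  have h1 := h.dist_le_of_between hr ha hb (p := p) (k := 2) (by omega) (by omega) (by omega)
  have h2 := h.symm.dist_le_of_between hr ha hb (p := p) (k := 2) (by omega) (by omega) (by omega)
  have h3 := hr.1.connected.dist_triangle (u := Sum.inl u) (v := p) (w := Sum.inl v)
  have h5 := h.four_lt_dist hr
  rw [SimpleGraph.dist_comm (u := p)] at h3
  omega

/-- A node strictly between two elements of `S` is within three of both `u` and `v`. If it is real,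
it differs from them, because they are further apart, and so it is a common neighbour. -/
theorem IsCommonNeighborSet.mem_of_between (h : IsCommonNeighborSet G S u v)
    (hr : IsSteinerRoot 4 G T) {a b z : V} (ha : a ∈ S) (hb : b ∈ S) {p : V ⊕ σ}
    (hp : T.dist (Sum.inl a) p + T.dist p (Sum.inl b) = T.dist (Sum.inl a) (Sum.inl b))
    (hka : 1 ≤ T.dist (Sum.inl a) p) (hkb : 1 ≤ T.dist p (Sum.inl b)) (hz : p = Sum.inl z) :
    z ∈ S := by
  subst hz
  have h1 := h.dist_le_of_between hr ha hb hp hka hkb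
  have h2 := h.symm.dist_le_of_between hr ha hb hp hka hkb
  have h3 := h.four_lt_dist hr
  have h4 := h.symm.four_lt_dist hr
  rw [h.mem_iff, hr.adj_iff, hr.adj_iff]
  refine ⟨⟨?_, by omega⟩, ?_, by omega⟩
  · rintro rfl
    omega
  · rintro rfl
    omega

/-- The subtree spanned by `S` has diameter at most three. -/
theorem IsCommonNeighborSet.isStarAt_or_isBistarAt (h : IsCommonNeighborSet G S u v)
    (hr : IsSteinerRoot 4 G T) (hS : G.IsClique (S : Set V)) (hne : S.Nonempty) :
    (∃ c, IsStarAt T S c) ∨ ∃ c₁ c₂, IsBistarAt T S c₁ c₂ := by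
  have hT := hr.1
  have hc := hT.connected
  have adj_of : ∀ x y, T.dist x y ≤ 1 → x ≠ y → T.Adj x y := fun x y h1 h2 =>
    SimpleGraph.dist_eq_one_iff_adj.1 (le_antisymm h1 ((hc _ _).pos_dist_of_ne h2))
  have hstar : ∀ c, c ∈ hull T S → (∀ s ∈ S, T.dist (Sum.inl s) c ≤ 1) →
      (∀ z, c = Sum.inl z → z ∈ S) → IsStarAt T S c := by
    intro c hch hd hreal
    have hadj : ∀ s ∈ S, Sum.inl s ≠ c → T.Adj c (Sum.inl s) := fun s hs hsc =>
      (adj_of _ _ (hd s hs) hsc).symm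
    refine ⟨subset_antisymm (hull_subset (fun s hs => .inl ⟨s, hs, rfl⟩) c (.inr rfl) ?_) ?_, hadj,
      hreal⟩
    · rintro ⟨x, hx⟩
      by_cases hxc : x = c
      · subst hxc
        exact .refl _
      · rcases hx with ⟨s, hs, rfl⟩ | rfl
        · exact SimpleGraph.Adj.reachable (hadj s hs hxc)
        · exact absurd rfl hxc
    · rintro x (⟨s, hs, rfl⟩ | rfl)
      · exact mem_hull_of_mem T hs
      · exact hch
  by_cases h3 : ∃ a ∈ S, ∃ b ∈ S, T.dist (Sum.inl a) (Sum.inl b) = 3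
  · right
    -- The centres are the two inner nodes of the path from `a` to `b`.
    obtain ⟨a, ha, b, hb, hab⟩ := h3
    obtain ⟨c₁, hac₁, hc₁b⟩ := hc.exists_dist_eq (Sum.inl a) (Sum.inl b) (k := 1) (by omega)
    obtain ⟨c₂, hc₁₂, hc₂b⟩ := hc.exists_dist_eq c₁ (Sum.inl b) (k := 1) (by omega)
    have tri := hc.dist_triangle (u := Sum.inl a) (v := c₁) (w := c₂)
    have tri' := hc.dist_triangle (u := Sum.inl a) (v := c₂) (w := Sum.inl b)
    have hadj := SimpleGraph.dist_eq_one_iff_adj.1 hc₁₂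
    have hadj₁ : T.Adj c₁ (Sum.inl a) := (SimpleGraph.dist_eq_one_iff_adj.1 hac₁).symm
    have hadj₂ : T.Adj c₂ (Sum.inl b) := SimpleGraph.dist_eq_one_iff_adj.1 (by omega)
    have hs₁₂ : ∀ s ∈ S, Sum.inl s ≠ c₁ → Sum.inl s ≠ c₂ →
        T.Adj c₁ (Sum.inl s) ∨ T.Adj c₂ (Sum.inl s) := by
      intro s hs h1 h2
      have e1 := h.dist_le_three hr hS hs ha
      have e2 := h.dist_le_three hr hS hs hb
      -- The node `s` is nearer to one of the centres. The end of the path beyond the other centre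
      -- is then two further away than the nearer centre, so its distance of at most three from `s`
      -- forces distance at most one to the nearer centre.
      have f := hT.dist_eq_dist_add_one_of_adj (Sum.inl s) hadj
      have g1 := hT.dist_eq_or_dist_eq (p := c₁) (a := Sum.inl a) (b := Sum.inl b) (by omega)
        (Sum.inl s)
      have g2 := hT.dist_eq_or_dist_eq (p := c₂) (a := Sum.inl a) (b := Sum.inl b) (by omega)
        (Sum.inl s)
      rw [SimpleGraph.dist_comm (u := c₁) (v := Sum.inl a)] at g1
      rw [SimpleGraph.dist_comm (u := c₂) (v := Sum.inl a)] at g2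
      by_cases hd : T.dist (Sum.inl s) c₁ ≤ 1
      · exact .inl (adj_of _ _ hd h1).symm
      · exact .inr (adj_of _ _ (by omega) h2).symm
    refine ⟨c₁, c₂, ⟨subset_antisymm (hull_subset (fun s hs => .inl ⟨s, hs, rfl⟩) c₁
      (.inr (.inl rfl)) ?_) ?_, hadj, hs₁₂, ?_, ?_, ⟨a, ha, ?_, hadj₁⟩, ⟨b, hb, ?_, hadj₂⟩⟩⟩
    · have hm₂ : c₂ ∈ {x | (∃ s ∈ S, x = Sum.inl s) ∨ x = c₁ ∨ x = c₂} := .inr (.inr rfl)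
      have hreach₂ : (T.induce {x | (∃ s ∈ S, x = Sum.inl s) ∨ x = c₁ ∨ x = c₂}).Reachable
          ⟨c₁, .inr (.inl rfl)⟩ ⟨c₂, hm₂⟩ := SimpleGraph.Adj.reachable hadj
      rintro ⟨x, hx⟩
      by_cases hx1 : x = c₁
      · subst hx1
        exact .refl _
      by_cases hx2 : x = c₂
      · subst hx2
        exact hreach₂
      rcases hx with ⟨s, hs, rfl⟩ | rfl | rfl
      · rcases hs₁₂ s hs hx1 hx2 with hs' | hs'
        · exact SimpleGraph.Adj.reachable hs'
        · exact hreach₂.trans (SimpleGraph.Adj.reachable hs')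
      · exact absurd rfl hx1
      · exact absurd rfl hx2
    · rintro x (⟨s, hs, rfl⟩ | rfl | rfl)
      · exact mem_hull_of_mem T hs
      · exact mem_hull_of_between hT ha hb (by omega)
      · exact mem_hull_of_between hT ha hb (by omega)
    · exact fun z hz => h.mem_of_between hr ha hb (p := c₁) (by omega) (by omega) (by omega) hz
    · exact fun z hz => h.mem_of_between hr ha hb (p := c₂) (by omega) (by omega) (by omega) hz
    · intro he
      rw [← he] at hc₂b
      omega
    · intro he
      rw [he] at hab
      omega
  left
  -- Diameter two: the centre is the middle node of a longest path.
  by_cases h2 : ∃ a ∈ S, ∃ b ∈ S, T.dist (Sum.inl a) (Sum.inl b) = 2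
  · obtain ⟨a, ha, b, hb, hab⟩ := h2
    obtain ⟨c, hac, hcb⟩ := hc.exists_dist_eq (Sum.inl a) (Sum.inl b) (k := 1) (by omega)
    refine ⟨c, hstar c (mem_hull_of_between hT ha hb (by omega)) ?_ fun z hz =>
      h.mem_of_between hr ha hb (p := c) (by omega) (by omega) (by omega) hz⟩
    intro s hs
    have e1 := h.dist_le_three hr hS hs ha
    have e2 := h.dist_le_three hr hS hs hb
    have e3 : T.dist (Sum.inl s) (Sum.inl a) ≠ 3 := fun e => h3 ⟨s, hs, a, ha, e⟩
    have e4 : T.dist (Sum.inl s) (Sum.inl b) ≠ 3 := fun e => h3 ⟨s, hs, b, hb, e⟩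
    have g := hT.dist_eq_or_dist_eq (p := c) (a := Sum.inl a) (b := Sum.inl b) (by omega)
      (Sum.inl s)
    rw [SimpleGraph.dist_comm (u := c) (v := Sum.inl a)] at g
    omega
  -- All distances are at most one, and any element of `S` can be the centre.
  · obtain ⟨a, ha⟩ := hne
    refine ⟨Sum.inl a, hstar _ (mem_hull_of_mem T ha) (fun s hs => ?_) ?_⟩
    · have e1 := h.dist_le_three hr hS hs ha
      have e3 : T.dist (Sum.inl s) (Sum.inl a) ≠ 3 := fun e => h3 ⟨s, hs, a, ha, e⟩
      have e4 : T.dist (Sum.inl s) (Sum.inl a) ≠ 2 := fun e => h2 ⟨s, hs, a, ha, e⟩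
      omega
    · rintro z hz
      rwa [← Sum.inl.inj hz]

end Root

/-! ### Minimal separators of chordal graphs -/

section Chordal

open SimpleGraph

variable {V : Type} {G : SimpleGraph V}

theorem cycleGraph_adj_iff {d : ℕ} (i j : Fin (d + 2)) :
    (cycleGraph (d + 2)).Adj i j ↔ i.1 + 1 = j.1 ∨ j.1 + 1 = i.1 ∨ (i.1 = 0 ∧ j.1 = d + 1) ∨
      (j.1 = 0 ∧ i.1 = d + 1) := by
  have hi := i.2
  have hj := j.2
  rw [cycleGraph_adj']
  have key : ∀ i j : Fin (d + 2), (i - j).1 = if j.1 ≤ i.1 then i.1 - j.1 else d + 2 + i.1 - j.1 := by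
    intro i j
    have hi := i.2
    have hj := j.2
    split_ifs with h
    · exact Fin.sub_val_of_le h
    · rw [Fin.coe_sub_iff_lt.2 (by simpa using h)]
  rw [key, key]
  split_ifs <;> omega

/-- In a chordal graph there is no vertex adjacent to exactly the ends of a shortest path. -/
theorem IsChordal.exists_adj_getVert (hG : IsChordal G) {C : Set V} {z : V} (hz : z ∉ C) {a b : C}
    (p : (G.induce C).Walk a b) (hp : p.length = (G.induce C).dist a b) (h2 : 2 ≤ p.length)
    (ha : G.Adj z a) (hb : G.Adj z b) : ∃ i, 0 < i ∧ i < p.length ∧ G.Adj z (p.getVert i) := by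
  by_contra hno
  push Not at hno
  set d := p.length with hd
  -- The `i`-th vertex of a shortest path is at distance exactly `i` from its start. Hence the path
  -- is injective and has no chords.
  have hdist : ∀ i ≤ d, (G.induce C).dist a (p.getVert i) = i := by
    intro i hi
    have h1 : (G.induce C).dist a (p.getVert i) ≤ i :=
      (dist_le (p.take i)).trans (by rw [Walk.take_length]; exact min_le_left _ _)
    have h2 : (G.induce C).dist (p.getVert i) b ≤ d - i :=
      (dist_le (p.drop i)).trans (by rw [Walk.drop_length])
    have h3 := (p.take i).reachable.dist_triangle_left b
    omega
  have hinj : ∀ i ≤ d, ∀ j ≤ d, (p.getVert i).1 = (p.getVert j).1 → i = j := by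
    intro i hi j hj h
    rw [← hdist i hi, Subtype.ext h, hdist j hj]
  have hle : ∀ i ≤ d, ∀ j ≤ d, G.Adj (p.getVert i).1 (p.getVert j).1 → j ≤ i + 1 := by
    intro i hi j hj h
    have hadj : (G.induce C).Adj (p.getVert i) (p.getVert j) := h
    have h3 := (p.take i).reachable.dist_triangle_left (p.getVert j)
    rw [hdist i hi, hdist j hj, dist_eq_one_iff_adj.2 hadj] at h3
    exact h3
  have hsucc : ∀ i < d, G.Adj (p.getVert i).1 (p.getVert (i + 1)).1 := fun i hi =>
    p.adj_getVert_succ hi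
  have h0 : (p.getVert 0).1 = a.1 := by rw [Walk.getVert_zero]
  have hl : (p.getVert d).1 = b.1 := by rw [hd, Walk.getVert_length]
  -- The forbidden induced cycle: the path, closed up by `z` at index `d + 1`.
  let f : Fin (d + 2) → V := fun i => if i.1 ≤ d then (p.getVert i.1).1 else z
  have hf : ∀ i : Fin (d + 2), i.1 ≤ d → f i = (p.getVert i.1).1 := fun i hi => if_pos hi
  have hfz : ∀ i : Fin (d + 2), ¬ i.1 ≤ d → f i = z := fun i hi => if_neg hi
  have hzadj : ∀ i : ℕ, i ≤ d → (G.Adj z (p.getVert i).1 ↔ i = 0 ∨ i = d) := by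
    intro i hi
    constructor
    · intro h
      by_contra hne
      exact hno i (by omega) (by omega) h
    · rintro (rfl | rfl)
      · rwa [h0]
      · rwa [hl]
  refine (hG (d + 2) (by omega)).false ⟨⟨f, ?_⟩, ?_⟩
  · intro i j hij
    have hi := i.2
    have hj := j.2
    by_cases hi' : i.1 ≤ d <;> by_cases hj' : j.1 ≤ d
    · rw [hf i hi', hf j hj'] at hij
      exact Fin.ext (hinj _ hi' _ hj' hij)
    · rw [hf i hi', hfz j hj'] at hij
      exact absurd (hij ▸ (p.getVert i.1).2) hz
    · rw [hf j hj', hfz i hi'] at hij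
      exact absurd (hij ▸ (p.getVert j.1).2) hz
    · exact Fin.ext (by omega)
  · intro i j
    have hi := i.2
    have hj := j.2
    change G.Adj (f i) (f j) ↔ _
    rw [cycleGraph_adj_iff]
    by_cases hi' : i.1 ≤ d <;> by_cases hj' : j.1 ≤ d
    · rw [hf i hi', hf j hj']
      constructor
      · intro h
        have h1 := hle _ hi' _ hj' h
        have h2 := hle _ hj' _ hi' h.symm
        have h3 : i.1 ≠ j.1 := fun e => h.ne (by rw [e])
        omega
      · intro h
        have h' : i.1 + 1 = j.1 ∨ j.1 + 1 = i.1 := by omega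
        rcases h' with h' | h'
        · rw [← h']
          exact hsucc _ (by omega)
        · rw [← h']
          exact (hsucc _ (by omega)).symm
    · rw [hf i hi', hfz j hj', adj_comm, hzadj _ hi']
      omega
    · rw [hf j hj', hfz i hi', hzadj _ hj']
      omega
    · rw [hfz i hi', hfz j hj']
      refine ⟨fun h => (h.ne rfl).elim, fun h => by omega⟩

/-- In a chordal graph the neighbours of a vertex in a connected set that does not contain it induce
a connected subgraph. -/
theorem IsChordal.preconnected_inter_neighborSet (hG : IsChordal G) {C : Set V} {z : V} (hz : z ∉ C)
    (hC : (G.induce C).Preconnected) : (G.induce (C ∩ G.neighborSet z)).Preconnected := by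
  have key : ∀ d (a b : C) (ha : G.Adj z a) (hb : G.Adj z b), (G.induce C).dist a b = d →
      (G.induce (C ∩ G.neighborSet z)).Reachable ⟨a, a.2, ha⟩ ⟨b, b.2, hb⟩ := by
    intro d
    -- On a shortest path in `C` of length at least two there is a further neighbour of `z` strictly
    -- between the ends, which splits the problem into two smaller ones.
    induction d using Nat.strong_induction_on with
    | _ d ih =>
    intro a b ha hb hd
    obtain ⟨p, hp⟩ := (hC a b).exists_walk_length_eq_dist
    by_cases h2 : 2 ≤ p.length
    · obtain ⟨i, hi0, hid, hi⟩ := hG.exists_adj_getVert hz p hp h2 ha hb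
      have h1 : (G.induce C).dist a (p.getVert i) ≤ i :=
        (dist_le (p.take i)).trans (by rw [Walk.take_length]; exact min_le_left _ _)
      have h2 : (G.induce C).dist (p.getVert i) b ≤ p.length - i :=
        (dist_le (p.drop i)).trans (by rw [Walk.drop_length])
      exact (ih _ (by omega) a (p.getVert i) ha hi rfl).trans
        (ih _ (by omega) (p.getVert i) b hi hb rfl)
    · have h01 : p.length = 0 ∨ p.length = 1 := by omega
      rcases h01 with h0 | h1
      · obtain rfl := Walk.eq_of_length_eq_zero h0
        exact .refl _
      · have hadj : (G.induce C).Adj a b := Walk.adj_of_length_eq_one h1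
        exact Adj.reachable (G := G.induce (C ∩ G.neighborSet z)) hadj
  rintro ⟨a, haC, ha⟩ ⟨b, hbC, hb⟩
  exact key _ ⟨a, haC⟩ ⟨b, hbC⟩ ha hb rfl

/-- Iterates the previous statement; each element of `Z` stays outside the shrinking set. -/
theorem IsChordal.preconnected_common (hG : IsChordal G) {C : Set V} (Z : Finset V)
    (hZ : ∀ z ∈ Z, z ∉ C) (hC : (G.induce C).Preconnected) :
    (G.induce {x | x ∈ C ∧ ∀ z ∈ Z, G.Adj z x}).Preconnected := by
  classical
  induction Z using Finset.induction_on with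
  | empty =>
    have : {x | x ∈ C ∧ ∀ z ∈ (∅ : Finset V), G.Adj z x} = C := by
      ext x
      simp
    rwa [this]
  | insert z Z _ ih =>
    have h1 := hG.preconnected_inter_neighborSet (z := z)
      (fun h => hZ z (Finset.mem_insert_self _ _) h.1)
      (ih fun z' hz' => hZ z' (Finset.mem_insert_of_mem hz'))
    have : {x | x ∈ C ∧ ∀ z' ∈ insert z Z, G.Adj z' x} =
        {x | x ∈ C ∧ ∀ z' ∈ Z, G.Adj z' x} ∩ G.neighborSet z := by
      ext x
      change (x ∈ C ∧ ∀ z' ∈ insert z Z, G.Adj z' x) ↔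
        (x ∈ C ∧ ∀ z' ∈ Z, G.Adj z' x) ∧ G.Adj z x
      rw [Finset.forall_mem_insert]
      exact ⟨fun h => ⟨⟨h.1, h.2.2⟩, h.2.1⟩, fun h => ⟨h.1.1, h.2, h.1.2⟩⟩
    rwa [this]

/-- There is a walk from `u` to `x` outside `S`. -/
def ReachableAvoiding (G : SimpleGraph V) (S : Finset V) (u x : V) : Prop :=
  ∃ p : G.Walk u x, ∀ y ∈ p.support, y ∉ S

namespace ReachableAvoiding

variable {S : Finset V} {u v x y : V}

theorem refl (hu : u ∉ S) : ReachableAvoiding G S u u := ⟨.nil, by simpa using hu⟩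

theorem symm (h : ReachableAvoiding G S u v) : ReachableAvoiding G S v u := by
  obtain ⟨p, hp⟩ := h
  exact ⟨p.reverse, by simpa using hp⟩

theorem trans (h : ReachableAvoiding G S u v) (h' : ReachableAvoiding G S v x) :
    ReachableAvoiding G S u x := by
  obtain ⟨p, hp⟩ := h
  obtain ⟨q, hq⟩ := h'
  refine ⟨p.append q, fun y hy => ?_⟩
  rw [Walk.mem_support_append_iff] at hy
  exact hy.elim (hp y) (hq y)

theorem left_notMem (h : ReachableAvoiding G S u v) : u ∉ S :=
  h.elim fun p hp => hp _ p.start_mem_support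

theorem right_notMem (h : ReachableAvoiding G S u v) : v ∉ S := h.symm.left_notMem

theorem of_adj (h : G.Adj u v) (hu : u ∉ S) (hv : v ∉ S) : ReachableAvoiding G S u v :=
  ⟨h.toWalk, by simp [hu, hv]⟩

end ReachableAvoiding

/-- Here `y` is the first vertex of the walk in `S`, and `x` is the one before it. -/
theorem exists_adj_mem_of_walk {S : Finset V} {u w : V} (p : G.Walk u w) (hu : u ∉ S)
    (hp : ∃ x ∈ p.support, x ∈ S) :
    ∃ x y, ReachableAvoiding G S u x ∧ G.Adj x y ∧ y ∈ S ∧ y ∈ p.support := by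
  induction p with
  | nil =>
    obtain ⟨x, hx, hxS⟩ := hp
    rw [Walk.support_nil, List.mem_singleton] at hx
    exact absurd (hx ▸ hxS) hu
  | @cons u v w h p ih =>
    by_cases hv : v ∈ S
    · exact ⟨u, v, .refl hu, h, hv, by simp⟩
    · obtain ⟨x, y, hx, hxy, hy, hyp⟩ := ih hv (by
        obtain ⟨x, hx, hxS⟩ := hp
        rw [Walk.support_cons, List.mem_cons] at hx
        rcases hx with rfl | hx
        · exact absurd hxS hu
        · exact ⟨x, hx, hxS⟩)
      exact ⟨x, y, (ReachableAvoiding.of_adj h hu hv).trans hx, hxy, hy, by simp [hyp]⟩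

theorem connected_reachableAvoiding {S : Finset V} {u : V} (hu : u ∉ S) :
    (G.induce {x | ReachableAvoiding G S u x}).Connected := by
  classical
  refine induce_connected_of_patches u (ReachableAvoiding.refl hu) fun {x} hx => ?_
  obtain ⟨p, hp⟩ := hx
  refine ⟨{y | y ∈ p.support}, fun y hy => ?_, p.start_mem_support, p.end_mem_support, ?_⟩
  · exact ⟨p.takeUntil y hy, fun z hz => hp z (p.support_takeUntil_subset_support hy hz)⟩
  · exact p.connected_induce_support.preconnected _ _

theorem Reachable.of_closed {W : Type*} {H : SimpleGraph W} {P : W → Prop} {a b : W}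
    (h : H.Reachable a b) (ha : P a) (hP : ∀ x y, P x → H.Adj x y → P y) : P b := by
  obtain ⟨p⟩ := h
  induction p with
  | nil => exact ha
  | cons hadj p ih => exact ih (hP _ _ ha hadj)

theorem connected_insert {C : Set V} (hC : (G.induce C).Connected) {y c : V} (hc : c ∈ C)
    (hyc : G.Adj c y) : (G.induce (insert y C)).Connected := by
  refine induce_connected_of_patches c (Set.mem_insert_of_mem _ hc) fun {x} hx => ?_
  rcases hx with rfl | hx
  · refine ⟨{c, x}, ?_, by simp, by simp, Adj.reachable hyc⟩
    rintro z (rfl | rfl)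
    · exact Set.mem_insert_of_mem _ hc
    · exact Set.mem_insert _ _
  · exact ⟨C, Set.subset_insert _ _, hc, hx, hC.preconnected _ _⟩

/-! ### Minimal separators are cliques with a complete vertex on each side -/

section Minimal

variable {S : Finset V} {u v : V}

theorem IsSeparator.not_reachableAvoiding (h : IsSeparator G u v S) :
    ¬ ReachableAvoiding G S u v := by
  rintro ⟨p, hp⟩
  obtain ⟨x, hx, hxS⟩ := h.2.2 p
  exact hp x hx hxS

theorem IsSeparator.symm (h : IsSeparator G u v S) : IsSeparator G v u S :=
  ⟨h.2.1, h.1, fun p => by simpa using h.2.2 p.reverse⟩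

theorem minimal_isSeparator_symm (h : Minimal (IsSeparator G u v) S) :
    Minimal (IsSeparator G v u) S :=
  ⟨h.1.symm, fun _ hS' hle => h.2 (IsSeparator.symm hS') hle⟩

/-- By minimality some walk from `u` to `v` avoids `S` except for `s`; its first entry into `S` is
at `s`. -/
theorem exists_adj_of_minimal (h : Minimal (IsSeparator G u v) S) {s : V} (hs : s ∈ S) :
    ∃ x, ReachableAvoiding G S u x ∧ G.Adj x s := by
  classical
  have hnot : ¬ IsSeparator G u v (S.erase s) := fun h' =>
    Finset.notMem_erase s S (h.2 h' (Finset.erase_subset _ _) hs)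
  have : ∃ p : G.Walk u v, ∀ x ∈ p.support, x ∉ S.erase s := by
    by_contra hno
    push Not at hno
    exact hnot ⟨fun hu => h.1.1 (Finset.mem_of_mem_erase hu),
      fun hv => h.1.2.1 (Finset.mem_of_mem_erase hv), hno⟩
  obtain ⟨p, hp⟩ := this
  obtain ⟨x, y, hx, hxy, hy, hyp⟩ := exists_adj_mem_of_walk p h.1.1 (h.1.2.2 p)
  have : y = s := by
    by_contra hne
    exact hp y hyp (Finset.mem_erase.2 ⟨hne, hy⟩)
  exact ⟨x, hx, this ▸ hxy⟩

/-- Suppose that `x` and `y` in `S` are not adjacent. The two sides together with `y` form a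
connected set without `x`, so by chordality the neighbours of `x` in it are connected. They occur on
both sides, but `y` is not among them, so they join the sides outside `S`. -/
theorem IsChordal.isClique_of_minimal (hG : IsChordal G) (h : Minimal (IsSeparator G u v) S) :
    G.IsClique (S : Set V) := by
  intro x hx y hy hxy
  by_contra hnadj
  obtain ⟨a, ha, hax⟩ := exists_adj_of_minimal h hx
  obtain ⟨a', ha', hay⟩ := exists_adj_of_minimal h hy
  obtain ⟨b, hb, hbx⟩ := exists_adj_of_minimal (minimal_isSeparator_symm h) hx
  obtain ⟨b', hb', hby⟩ := exists_adj_of_minimal (minimal_isSeparator_symm h) hy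
  have h1 := connected_insert (connected_reachableAvoiding (G := G) h.1.1) ha' hay
  have h2 := connected_insert (connected_reachableAvoiding (G := G) h.1.2.1) hb' hby
  have h3 := induce_union_connected h1.preconnected h2.preconnected
    ⟨y, Set.mem_insert _ _, Set.mem_insert _ _⟩
  have h4 := hG.preconnected_inter_neighborSet (z := x) (by
    rintro ((rfl | hx') | (rfl | hx'))
    · exact hxy rfl
    · exact hx'.right_notMem hx
    · exact hxy rfl
    · exact hx'.right_notMem hx) h3.preconnected
  -- A walk among the neighbours of `x` never meets `y`, hence never leaves the side of `u`.
  have h5 := Reachable.of_closed (P := fun z => ReachableAvoiding G S u z.1)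
    (h4 ⟨a, .inl (.inr ha), hax.symm⟩ ⟨b, .inr (.inr hb), hbx.symm⟩) ha (by
      intro z z' hz hzz'
      have hzz' : G.Adj z.1 z'.1 := hzz'
      have hy : z'.1 ≠ y := fun e => hnadj (e ▸ z'.2.2)
      rcases z'.2.1 with hz' | hz'
      · exact hz'.resolve_left hy
      · have hz' := hz'.resolve_left hy
        exact hz.trans (.of_adj hzz' hz.right_notMem hz'.right_notMem))
  exact h.1.not_reachableAvoiding (h5.trans hb.symm)

/-- The elements of `S` are treated one at a time. Let `w` on the side of `u` be adjacent to all of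
`Z`, and add `y` to this side. By chordality the common neighbours of `Z` in the enlarged set are
connected, and both `y` and `w` are among them. The first vertex after `y` on a walk to `w` is on
the side of `u` and adjacent to `y` and to all of `Z`. -/
theorem IsChordal.exists_complete_of_minimal (hG : IsChordal G) (h : Minimal (IsSeparator G u v) S) :
    ∃ w, ReachableAvoiding G S u w ∧ ∀ z ∈ S, G.Adj w z := by
  classical
  have hS := hG.isClique_of_minimal h
  suffices H : ∀ Z : Finset V, Z ⊆ S → ∃ w, ReachableAvoiding G S u w ∧ ∀ z ∈ Z, G.Adj w z from
    H S subset_rfl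
  intro Z
  induction Z using Finset.induction_on with
  | empty => exact fun _ => ⟨u, .refl h.1.1, by simp⟩
  | insert y Z hyZ ih =>
    intro hsub
    rw [Finset.insert_subset_iff] at hsub
    obtain ⟨w, hw, hwZ⟩ := ih hsub.2
    obtain ⟨a, ha, hay⟩ := exists_adj_of_minimal h hsub.1
    have h1 := connected_insert (connected_reachableAvoiding (G := G) h.1.1) ha hay
    have h2 := hG.preconnected_common Z (C := insert y {x | ReachableAvoiding G S u x}) (by
      rintro z hz (rfl | hz')
      · exact hyZ hz
      · exact hz'.right_notMem (hsub.2 hz)) h1.preconnected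
    obtain ⟨p⟩ := h2 ⟨y, Set.mem_insert _ _, fun z hz =>
        hS (hsub.2 hz) hsub.1 (fun e => hyZ (e ▸ hz))⟩
      ⟨w, Set.mem_insert_of_mem _ hw, fun z hz => (hwZ z hz).symm⟩
    cases p with
    | nil => exact absurd hsub.1 hw.right_notMem
    | @cons _ x _ hadj p =>
      have hyx : G.Adj y x.1 := hadj
      refine ⟨x.1, x.2.1.resolve_left hyx.ne', ?_⟩
      rw [Finset.forall_mem_insert]
      exact ⟨hyx.symm, fun z hz => (x.2.2 z hz).symm⟩

end Minimal

/-- Minimality holds since each common neighbour `s` gives a walk `u`, `s`, `v` that every separator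
has to meet in `s`. -/
theorem IsCommonNeighborSet.minimal_isSeparator {S : Finset V} {u v : V}
    (h : IsCommonNeighborSet G S u v) (hsep : ¬ ReachableAvoiding G S u v) :
    Minimal (IsSeparator G u v) S := by
  refine ⟨⟨fun hu => G.irrefl ((h.mem_iff u).1 hu).1,
    fun hv => G.irrefl ((h.mem_iff v).1 hv).2, fun p => ?_⟩, ?_⟩
  · by_contra hno
    push Not at hno
    exact hsep ⟨p, hno⟩
  · intro S' hS' _ s hs
    obtain ⟨hus, hvs⟩ := (h.mem_iff s).1 hs
    obtain ⟨x, hx, hxS⟩ := hS'.2.2 (.cons hus (.cons hvs.symm .nil))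
    simp only [Walk.support_cons, Walk.support_nil, List.mem_cons, List.not_mem_nil, or_false] at hx
    rcases hx with rfl | rfl | rfl
    · exact absurd hxS hS'.1
    · exact hxS
    · exact absurd hxS hS'.2.1

/-- The minimal separators of a chordal graph are the sets of common neighbours of two nonadjacent
vertices that separate these. -/
theorem IsChordal.isMinimalSeparator_iff (hG : IsChordal G) (S : Finset V) :
    IsMinimalSeparator G S ↔ ∃ u v, IsCommonNeighborSet G S u v ∧ ¬ ReachableAvoiding G S u v := by
  constructor
  · rintro ⟨u, v, h⟩
    obtain ⟨w, hw, hwS⟩ := hG.exists_complete_of_minimal h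
    obtain ⟨x, hx, hxS⟩ := hG.exists_complete_of_minimal (minimal_isSeparator_symm h)
    have hsep : ¬ ReachableAvoiding G S w x := fun h' =>
      h.1.not_reachableAvoiding ((hw.trans h').trans hx.symm)
    refine ⟨w, x, ⟨?_, ?_, ?_⟩, hsep⟩
    · rintro rfl
      exact hsep (.refl hw.right_notMem)
    · exact fun h' => hsep (.of_adj h' hw.right_notMem hx.right_notMem)
    -- A common neighbour of `w` and `x` outside `S` would join the two sides.
    · refine fun y => ⟨fun hy => ⟨hwS y hy, hxS y hy⟩, fun hy => ?_⟩
      by_contra hyS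
      exact hsep ((ReachableAvoiding.of_adj hy.1 hw.right_notMem hyS).trans
        (.of_adj hy.2.symm hyS hx.right_notMem))
  · rintro ⟨u, v, h, hsep⟩
    exact ⟨u, v, h.minimal_isSeparator hsep⟩

end Chordal

/-! ### Coded trees -/

/-- A bijective homomorphism from a connected graph to an acyclic graph is an isomorphism. -/
theorem SimpleGraph.Connected.adj_iff_of_equiv {α β : Type*} {A : SimpleGraph α} {B : SimpleGraph β}
    (hA : A.Connected) (hB : B.IsAcyclic) (e : α ≃ β) (hom : ∀ x y, A.Adj x y → B.Adj (e x) (e y))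
    {x y : α} : A.Adj x y ↔ B.Adj (e x) (e y) := by
  classical
  refine ⟨hom x y, fun h => ?_⟩
  obtain ⟨p, hp⟩ := (hA x y).exists_isPath
  let f : A →g B := ⟨e, fun {x y} => hom x y⟩
  have h1 : (p.map f).IsPath := hp.map e.injective
  -- The image of a path from `x` to `y` is a path in an acyclic graph, hence it is the single edge
  -- `h`.
  have h2 := (hB.subsingleton_path (e x) (e y)).elim ⟨p.map f, h1⟩ (.singleton h)
  have h3 : (p.map f).length = 1 := by
    rw [show p.map f = (Path.singleton h : B.Walk (e x) (e y)) from congrArg Subtype.val h2]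
    rfl
  rw [Walk.length_map] at h3
  exact Walk.adj_of_length_eq_one h3

namespace CodedTree

variable {n : ℕ}

theorem graph_adj_iff (Y : CodedTree n) (i j : Fin (List.length Y)) :
    Y.graph.Adj i j ↔ i ≠ j ∧ ((List.get Y i).2 = j.1 ∨ (List.get Y j).2 = i.1) :=
  SimpleGraph.fromRel_adj _ _ _

/-- The root comes first, and all fathers come before their children. -/
structure IsOrdered (Y : CodedTree n) : Prop where
  pos : 0 < List.length Y
  root : ∀ i : Fin (List.length Y), i.1 = 0 → (List.get Y i).2 = 0
  lt : ∀ i : Fin (List.length Y), i.1 ≠ 0 → (List.get Y i).2 < i.1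

/-- Following fathers leads to the root, so the graph is connected. Every edge joins a node other
than the root to its father, so there are fewer edges than nodes. -/
theorem IsOrdered.isTree {Y : CodedTree n} (h : Y.IsOrdered) : Y.graph.IsTree := by
  classical
  have hfather : ∀ i : Fin (List.length Y), (List.get Y i).2 < List.length Y := fun i => by
    by_cases hi : i.1 = 0
    · rw [h.root i hi]
      exact h.pos
    · exact (h.lt i hi).trans i.2
  have hconn : Y.graph.Connected := by
    rw [SimpleGraph.connected_iff_exists_forall_reachable]
    refine ⟨⟨0, h.pos⟩, ?_⟩
    have : ∀ k, ∀ i : Fin (List.length Y), i.1 = k → Y.graph.Reachable ⟨0, h.pos⟩ i := by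
      intro k
      induction k using Nat.strong_induction_on with
      | _ k ih =>
      intro i hi
      by_cases hk : k = 0
      · obtain rfl : i = ⟨0, h.pos⟩ := Fin.ext (hi.trans hk)
        exact .refl _
      · have hlt := h.lt i (by omega)
        refine (ih (List.get Y i).2 (by omega) ⟨_, hfather i⟩ rfl).trans (SimpleGraph.Adj.reachable ?_)
        rw [graph_adj_iff]
        exact ⟨fun e => hlt.ne (congrArg Fin.val e), .inr rfl⟩
    exact fun i => this _ i rfl
  rw [SimpleGraph.isTree_iff_connected_and_card]
  refine ⟨hconn, le_antisymm ?_ hconn.card_vert_le_card_edgeSet_add_one⟩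
  have hsub : Y.graph.edgeSet ⊆
      (fun i : Fin (List.length Y) => s(i, ⟨_, hfather i⟩)) '' {i | i.1 ≠ 0} := by
    intro e he
    induction e using Sym2.ind with
    | _ i j =>
    rw [SimpleGraph.mem_edgeSet, graph_adj_iff] at he
    obtain ⟨hne, he | he⟩ := he
    · refine ⟨i, fun hi => hne ?_, ?_⟩
      · rw [h.root i hi] at he
        exact Fin.ext (by omega)
      · simp only [he]
    · refine ⟨j, fun hj => hne ?_, ?_⟩
      · rw [h.root j hj] at he
        exact Fin.ext (by omega)
      · simp only [he]
        exact Sym2.eq_swap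
  have h1 := Set.ncard_le_ncard hsub (Set.toFinite _)
  have h2 := Set.ncard_image_le (s := {i : Fin (List.length Y) | i.1 ≠ 0})
    (f := fun i : Fin (List.length Y) => s(i, (⟨_, hfather i⟩ : Fin (List.length Y)))) (Set.toFinite _)
  have h3 : {i : Fin (List.length Y) | i.1 ≠ 0}.ncard + 1 ≤ List.length Y := by
    have : {i : Fin (List.length Y) | i.1 ≠ 0} = ({⟨0, h.pos⟩}ᶜ : Set (Fin (List.length Y))) := by
      ext i
      simp [Fin.ext_iff]
    have h4 := Set.ncard_add_ncard_compl ({⟨0, h.pos⟩} : Set (Fin (List.length Y)))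
    rw [this]
    rw [Set.ncard_singleton, Nat.card_eq_fintype_card, Fintype.card_fin] at h4
    omega
  rw [Nat.card_eq_fintype_card (α := Fin _), Fintype.card_fin]
  have : Nat.card Y.graph.edgeSet = Y.graph.edgeSet.ncard := rfl
  omega

theorem IsOrdered.isTreeOn {Y : CodedTree n} (h : Y.IsOrdered) {S : Finset (Fin n)}
    (hmem : ∀ v, v ∈ S ↔ some v ∈ List.map Prod.fst Y)
    (hinj : List.Pairwise (fun a b => ∀ v : Fin n, a.1 = some v → b.1 ≠ some v) Y) :
    Y.IsTreeOn S := by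
  refine ⟨h.isTree, fun v => ?_, fun i j v hi hj => ?_⟩
  · rw [hmem, List.mem_map]
    constructor
    · rintro ⟨a, ha, hav⟩
      obtain ⟨i, rfl⟩ := List.get_of_mem ha
      exact ⟨i, hav⟩
    · rintro ⟨i, hi⟩
      exact ⟨_, List.get_mem Y i, hi⟩
  · rw [List.pairwise_iff_get] at hinj
    rcases lt_trichotomy i j with hij | hij | hij
    · exact absurd hj (hinj i j hij v hi)
    · exact hij
    · exact absurd hi (hinj j i hij v hj)

/-- A coded tree is Steiner-equivalent to a spanned subtree if its nodes correspond to those of the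
subtree. -/
theorem IsOrdered.steinerEquivalent {σ : Type} {T : SimpleGraph (Fin n ⊕ σ)} (hT : T.IsTree)
    {S : Finset (Fin n)} {Y : CodedTree n} (h : Y.IsOrdered) (N : List (Fin n ⊕ σ))
    (hlen : List.length Y = N.length) (hnd : N.Nodup) (hmem : ∀ x, x ∈ N ↔ x ∈ hull T S)
    (hname : ∀ (i : ℕ) (hi : i < List.length Y), Y[i].1 = (N[i]'(hlen ▸ hi)).getLeft?)
    (hadj : ∀ (i j : ℕ) (hi : i < List.length Y), i ≠ 0 → (hj : Y[i].2 = j) → (hj' : j < N.length) →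
      T.Adj (N[i]'(hlen ▸ hi)) (N[j]'hj')) :
    SteinerEquivalent (spanTree T S) (spanName T S) Y.graph Y.name := by
  let g : Fin (List.length Y) → hull T S := fun i =>
    ⟨N[i.1]'(hlen ▸ i.2), (hmem _).1 (List.getElem_mem _)⟩
  have hg : Function.Bijective g := by
    constructor
    · intro i j hij
      exact Fin.ext ((hnd.getElem_inj_iff).1 (congrArg Subtype.val hij))
    · rintro ⟨x, hx⟩
      obtain ⟨i, hi, rfl⟩ := List.getElem_of_mem ((hmem x).2 hx)
      exact ⟨⟨i, hlen ▸ hi⟩, rfl⟩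
  let e := Equiv.ofBijective g hg
  have hfather : ∀ i j : Fin (List.length Y), i ≠ j → (List.get Y i).2 = j.1 →
      (spanTree T S).Adj (e i) (e j) := by
    intro i j hij hf
    by_cases hi : i.1 = 0
    · rw [h.root i hi] at hf
      exact absurd (Fin.ext (by omega)) hij
    · exact hadj i.1 j.1 i.2 hi hf (hlen ▸ j.2)
  have hom : ∀ i j, Y.graph.Adj i j → (spanTree T S).Adj (e i) (e j) := by
    intro i j hij
    rw [graph_adj_iff] at hij
    rcases hij.2 with hf | hf
    · exact hfather i j hij.1 hf
    · exact (hfather j i hij.1.symm hf).symm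
  let f : Y.graph ≃g spanTree T S :=
    ⟨e, fun {i j} => (h.isTree.connected.adj_iff_of_equiv (hT.isAcyclic.induce _) e hom).symm⟩
  refine ⟨f.symm, fun x => ?_⟩
  obtain ⟨i, rfl⟩ := f.surjective x
  rw [f.symm_apply_apply]
  exact hname i.1 i.2

/-- A star with leaves `L`. -/
def star (c : Option (Fin n)) (L : List (Fin n)) : CodedTree n :=
  (c, 0) :: L.map fun s => (some s, 0)

/-- A tree with two adjacent inner nodes and leaves `L`; `φ s` is the index of the father of `s`. -/
def bistar (c₁ c₂ : Option (Fin n)) (L : List (Fin n)) (φ : Fin n → ℕ) : CodedTree n :=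
  (c₁, 0) :: (c₂, 0) :: L.map fun s => (some s, φ s)

theorem star_isOrdered (c : Option (Fin n)) (L : List (Fin n)) : (star c L).IsOrdered := by
  refine ⟨by simp [star], ?_, ?_⟩
  · rintro ⟨_ | i, hi⟩ h
    · rfl
    · simp at h
  · rintro ⟨_ | i, hi⟩ h
    · simp at h
    · simp [star]

theorem bistar_isOrdered (c₁ c₂ : Option (Fin n)) (L : List (Fin n)) {φ : Fin n → ℕ}
    (hφ : ∀ s, φ s ≤ 1) : (bistar c₁ c₂ L φ).IsOrdered := by
  refine ⟨by simp [bistar], ?_, ?_⟩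
  · rintro ⟨_ | i, hi⟩ h
    · rfl
    · simp at h
  · rintro ⟨_ | _ | i, hi⟩ h
    · simp at h
    · simp [bistar]
    · simp only [bistar, List.get_eq_getElem, List.getElem_cons_succ, List.getElem_map]
      exact lt_of_le_of_lt (hφ _) (by omega)

theorem star_isTreeOn {c : Option (Fin n)} {L : List (Fin n)} {S : Finset (Fin n)} (hL : L.Nodup)
    (hS : ∀ v, v ∈ S ↔ c = some v ∨ v ∈ L) (hc : ∀ v ∈ L, c ≠ some v) : (star c L).IsTreeOn S := by
  refine (star_isOrdered c L).isTreeOn (fun v => ?_) ?_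
  · rw [hS]
    simp [star, eq_comm]
  · simp only [star, List.pairwise_cons, List.mem_map, List.pairwise_map]
    refine ⟨?_, hL.imp ?_⟩
    · rintro _ ⟨s, hs, rfl⟩ v hv h
      obtain rfl := Option.some.inj h
      exact hc s hs hv
    · intro a b hab v ha hb
      exact hab ((Option.some.inj ha).trans (Option.some.inj hb).symm)

theorem bistar_isTreeOn {c₁ c₂ : Option (Fin n)} {L : List (Fin n)} {φ : Fin n → ℕ}
    {S : Finset (Fin n)} (hL : L.Nodup) (hφ : ∀ s, φ s ≤ 1)
    (hS : ∀ v, v ∈ S ↔ c₁ = some v ∨ c₂ = some v ∨ v ∈ L) (hc₁ : ∀ v ∈ L, c₁ ≠ some v)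
    (hc₂ : ∀ v ∈ L, c₂ ≠ some v) (hc : ∀ v, c₁ = some v → c₂ ≠ some v) :
    (bistar c₁ c₂ L φ).IsTreeOn S := by
  refine (bistar_isOrdered c₁ c₂ L hφ).isTreeOn (fun v => ?_) ?_
  · rw [hS]
    simp [bistar, eq_comm]
  · simp only [bistar, List.pairwise_cons, List.mem_cons, List.mem_map, List.pairwise_map]
    refine ⟨?_, ?_, hL.imp ?_⟩
    · rintro _ (rfl | ⟨s, hs, rfl⟩) v hv h
      · exact hc v hv h
      · obtain rfl := Option.some.inj h
        exact hc₁ s hs hv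
    · rintro _ ⟨s, hs, rfl⟩ v hv h
      obtain rfl := Option.some.inj h
      exact hc₂ s hs hv
    · intro a b hab v ha hb
      exact hab ((Option.some.inj ha).trans (Option.some.inj hb).symm)

end CodedTree

/-! ### Spanned stars and bistars as coded trees -/

section Span

variable {n : ℕ} {σ : Type} {T : SimpleGraph (Fin n ⊕ σ)} {S : Finset (Fin n)} {L : List (Fin n)}

theorem IsStarAt.steinerEquivalent {c : Fin n ⊕ σ} (h : IsStarAt T S c) (hT : T.IsTree) (hL : L.Nodup)
    (hLS : ∀ v, v ∈ L ↔ v ∈ S ∧ Sum.inl v ≠ c) :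
    SteinerEquivalent (spanTree T S) (spanName T S)
      (CodedTree.star c.getLeft? L).graph (CodedTree.star c.getLeft? L).name := by
  refine (CodedTree.star_isOrdered _ _).steinerEquivalent hT (c :: L.map Sum.inl)
    (by simp [CodedTree.star]) ?_ ?_ ?_ ?_
  · rw [List.nodup_cons, List.mem_map]
    exact ⟨fun ⟨s, hs, hsc⟩ => ((hLS s).1 hs).2 hsc, hL.map Sum.inl_injective⟩
  · intro x
    rw [h.hull_eq, List.mem_cons, List.mem_map]
    change _ ↔ (∃ s ∈ S, x = Sum.inl s) ∨ x = c
    constructor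
    · rintro (rfl | ⟨s, hs, rfl⟩)
      · exact .inr rfl
      · exact .inl ⟨s, ((hLS s).1 hs).1, rfl⟩
    · rintro (⟨s, hs, rfl⟩ | rfl)
      · by_cases hsc : Sum.inl s = c
        · exact .inl hsc
        · exact .inr ⟨s, (hLS s).2 ⟨hs, hsc⟩, rfl⟩
      · exact .inl rfl
  · rintro (_ | i) hi
    · rfl
    · simp [CodedTree.star]
  · rintro (_ | i) j hi h0 hj hj'
    · exact absurd rfl h0
    · simp only [CodedTree.star, List.getElem_cons_succ, List.getElem_map] at hj ⊢
      subst hj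
      have hi' : i < L.length := by simpa [CodedTree.star] using hi
      have := (hLS _).1 (List.getElem_mem hi')
      exact (h.adj _ this.1 this.2).symm

/-- The function `φ` only has to recognise the leaves at `c₁`; by the shape of a bistar the others
are at `c₂`. -/
theorem IsBistarAt.steinerEquivalent {c₁ c₂ : Fin n ⊕ σ} (h : IsBistarAt T S c₁ c₂) (hT : T.IsTree)
    (hL : L.Nodup) (hLS : ∀ v, v ∈ L ↔ v ∈ S ∧ Sum.inl v ≠ c₁ ∧ Sum.inl v ≠ c₂) {φ : Fin n → ℕ}
    (hφ : ∀ s, φ s ≤ 1) (hφ₁ : ∀ s ∈ L, (φ s = 0 ↔ T.Adj c₁ (Sum.inl s))) :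
    SteinerEquivalent (spanTree T S) (spanName T S)
      (CodedTree.bistar c₁.getLeft? c₂.getLeft? L φ).graph
      (CodedTree.bistar c₁.getLeft? c₂.getLeft? L φ).name := by
  refine (CodedTree.bistar_isOrdered _ _ _ hφ).steinerEquivalent hT (c₁ :: c₂ :: L.map Sum.inl)
    (by simp [CodedTree.bistar]) ?_ ?_ ?_ ?_
  · rw [List.nodup_cons, List.nodup_cons, List.mem_cons, List.mem_map, List.mem_map]
    refine ⟨?_, fun ⟨s, hs, hsc⟩ => ((hLS s).1 hs).2.2 hsc, hL.map Sum.inl_injective⟩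
    rintro (hc | ⟨s, hs, hsc⟩)
    · exact h.adj_centre.ne hc
    · exact ((hLS s).1 hs).2.1 hsc
  · intro x
    rw [h.hull_eq, List.mem_cons, List.mem_cons, List.mem_map]
    change _ ↔ (∃ s ∈ S, x = Sum.inl s) ∨ x = c₁ ∨ x = c₂
    constructor
    · rintro (rfl | rfl | ⟨s, hs, rfl⟩)
      · exact .inr (.inl rfl)
      · exact .inr (.inr rfl)
      · exact .inl ⟨s, ((hLS s).1 hs).1, rfl⟩
    · rintro (⟨s, hs, rfl⟩ | rfl | rfl)
      · by_cases hsc : Sum.inl s = c₁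
        · exact .inl hsc
        by_cases hsc' : Sum.inl s = c₂
        · exact .inr (.inl hsc')
        · exact .inr (.inr ⟨s, (hLS s).2 ⟨hs, hsc, hsc'⟩, rfl⟩)
      · exact .inl rfl
      · exact .inr (.inl rfl)
  · rintro (_ | _ | i) hi
    · rfl
    · rfl
    · simp [CodedTree.bistar]
  · rintro (_ | _ | i) j hi h0 hj hj'
    · exact absurd rfl h0
    · simp only [CodedTree.bistar, List.getElem_cons_succ, List.getElem_cons_zero] at hj ⊢
      subst hj
      exact h.adj_centre.symm
    · simp only [CodedTree.bistar, List.getElem_cons_succ, List.getElem_map] at hj ⊢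
      subst hj
      have hi' : i < L.length := by simpa [CodedTree.bistar] using hi
      have hm := List.getElem_mem hi'
      have := (hLS _).1 hm
      have h01 : φ L[i] = 0 ∨ φ L[i] = 1 := by
        have := hφ L[i]
        omega
      rcases h01 with h0 | h1
      · simp only [h0, List.getElem_cons_zero]
        exact ((hφ₁ _ hm).1 h0).symm
      · simp only [h1, List.getElem_cons_succ, List.getElem_cons_zero]
        refine ((h.adj _ this.1 this.2.1 this.2.2).resolve_left fun h' => ?_).symm
        rw [(hφ₁ _ hm).2 h'] at h1
        omega

end Span

/-! ### Sides of the leaves -/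

section Sides

variable {n : ℕ}

open Classical in
/-- The last element that satisfies `P`. -/
noncomputable def lastSat (P : Fin n → Prop) : Option (Fin n) :=
  if h : ∃ i, P i ∧ ∀ j, i < j → ¬ P j then some h.choose else none

theorem lastSat_eq_some {P : Fin n → Prop} {i : Fin n} (h : lastSat P = some i) :
    P i ∧ ∀ j, i < j → ¬ P j := by
  unfold lastSat at h
  split_ifs at h with h'
  rw [← Option.some.inj h]
  exact h'.choose_spec

theorem lastSat_eq_none_iff {P : Fin n → Prop} : lastSat P = none ↔ ∀ i, ¬ P i := by
  classical
  constructor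
  · intro h i hi
    have hne : (Finset.univ.filter P).Nonempty := ⟨i, by simpa using hi⟩
    unfold lastSat at h
    split_ifs at h with h'
    refine h' ⟨(Finset.univ.filter P).max' hne, ?_, fun j hj hPj => ?_⟩
    · simpa using (Finset.univ.filter P).max'_mem hne
    · exact (Finset.le_max' _ j (by simpa using hPj)).not_gt hj
  · intro h
    unfold lastSat
    rw [dif_neg]
    exact fun ⟨i, hi, _⟩ => h i hi

theorem lastSat_eq_some_iff {P : Fin n → Prop} {i : Fin n} :
    lastSat P = some i ↔ P i ∧ ∀ j, i < j → ¬ P j := by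
  refine ⟨lastSat_eq_some, fun h => ?_⟩
  cases hl : lastSat P with
  | none => exact absurd h.1 (lastSat_eq_none_iff.1 hl i)
  | some j =>
    have hj := lastSat_eq_some hl
    rcases lt_trichotomy i j with hij | rfl | hij
    · exact absurd hj.1 (h.2 j hij)
    · rfl
    · exact absurd h.1 (hj.2 i hij)

variable (G : SimpleGraph (Fin n)) (S : Finset (Fin n))

/-- `y` is not adjacent to all elements of `S` (other than itself). -/
def Deficient (y : Fin n) : Prop := ∃ s ∈ S, s ≠ y ∧ ¬ G.Adj y s

/-- `x` shows that `s` may be sandwiched. -/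
def Witness (s x : Fin n) : Prop :=
  x ∉ S ∧ ¬ Deficient G S x ∧ ∃ y, Deficient G S y ∧ G.Adj y s ∧ G.Adj y x

/-- Some deficient vertex is adjacent to both `s` and the element `c` of `S`. -/
def Pinned (s c : Fin n) : Prop := c ∈ S ∧ ∃ y, Deficient G S y ∧ G.Adj y s ∧ G.Adj y c

/-- `s` is an element of `S` other than `c₁`, `c₂`. -/
def IsLeafOf (c₁ c₂ s : Fin n) : Prop := s ∈ S ∧ s ≠ c₁ ∧ s ≠ c₂

/-- The deficient vertex `y` is adjacent to at least two elements of `S` other than `c₁`, `c₂`. -/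
def Splits (c₁ c₂ y : Fin n) : Prop :=
  Deficient G S y ∧ 1 < {b : Fin n | IsLeafOf S c₁ c₂ b ∧ G.Adj y b}.ncard

noncomputable def witness (s : Fin n) : Option (Fin n) := lastSat (Witness G S s)

/-- A leaf with a witness, for reference. -/
noncomputable def reference (c₁ c₂ : Fin n) : Option (Fin n) :=
  lastSat fun s => IsLeafOf S c₁ c₂ s ∧ witness G S s ≠ none

/-- The witnesses of `s` and of the reference leaf are equal or adjacent. -/
def AlignedWith (c₁ c₂ s : Fin n) : Prop :=
  ∃ r x y, reference G S c₁ c₂ = some r ∧ witness G S s = some x ∧ witness G S r = some y ∧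
    (x = y ∨ G.Adj x y)

/-- The leaf `s` is attached to `c₁` in the tree for the parameters `c₁`, `c₂`, `β`, `f`. -/
def Label (c₁ c₂ : Fin n) (β : Prop) (f s : Fin n) : Prop :=
  (∃ y, lastSat (Splits G S c₁ c₂) = some y ∧ (G.Adj y s ↔ β)) ∨
  (lastSat (Splits G S c₁ c₂) = none ∧
    (Pinned G S s c₁ ∨ (¬ Pinned G S s c₂ ∧
      ((witness G S s ≠ none ∧ (AlignedWith G S c₁ c₂ s ↔ β)) ∨ (witness G S s = none ∧ s ≠ f)))))

end Sides

/-- Once a step has led away from `x`, every further step other than the one straight back leads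
away as well. -/
theorem SimpleGraph.IsTree.dist_step {W : Type*} {T : SimpleGraph W} (hT : T.IsTree) {a b s x : W}
    (hab : T.Adj a b) (hbs : T.Adj b s) (hne : s ≠ a) (h : T.dist x b = T.dist x a + 1) :
    T.dist x s = T.dist x b + 1 := by
  have h1 := SimpleGraph.dist_eq_one_iff_adj.2 hab
  have h2 := SimpleGraph.dist_eq_one_iff_adj.2 hbs
  have h3 := hT.dist_eq_dist_add_one_of_adj a hbs
  have h4 := hT.connected.pos_dist_of_ne hne.symm
  have h5 := hT.dist_eq_or_dist_eq (a := a) (b := s) (p := b) (by omega) x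
  rw [SimpleGraph.dist_comm (u := b) (v := a)] at h5
  omega

/-! ### How vertices outside a bistar reveal the sides of its leaves -/

section Bistar

variable {n : ℕ} {σ : Type} {G : SimpleGraph (Fin n)} {T : SimpleGraph (Fin n ⊕ σ)}
  {S : Finset (Fin n)} {c₁ c₂ : Fin n ⊕ σ} {p₁ p₂ : Fin n}

/-- The vertex `p` stands for the node `c`: either `p` is `c`, or `p ∉ S` and `c` is not in `S`. -/
def Represented (S : Finset (Fin n)) (p : Fin n) (c : Fin n ⊕ σ) : Prop :=
  ∀ x ∈ S, x = p ↔ Sum.inl x = c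

/-- A subtree spanned by `S` in a root of `G`, where it has diameter three and the vertices `p₁`, `p₂`
stand for its central nodes. -/
structure BistarData (G : SimpleGraph (Fin n)) (T : SimpleGraph (Fin n ⊕ σ)) (S : Finset (Fin n))
    (c₁ c₂ : Fin n ⊕ σ) (p₁ p₂ : Fin n) : Prop where
  root : IsSteinerRoot 4 G T
  clique : G.IsClique (S : Set (Fin n))
  bistar : IsBistarAt T S c₁ c₂
  rep₁ : Represented S p₁ c₁
  rep₂ : Represented S p₂ c₂

namespace BistarData

theorem symm (h : BistarData G T S c₁ c₂ p₁ p₂) : BistarData G T S c₂ c₁ p₂ p₁ :=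
  ⟨h.root, h.clique, h.bistar.symm, h.rep₂, h.rep₁⟩

theorem isLeafOf_iff (h : BistarData G T S c₁ c₂ p₁ p₂) (s : Fin n) :
    IsLeafOf S p₁ p₂ s ↔ s ∈ S ∧ Sum.inl s ≠ c₁ ∧ Sum.inl s ≠ c₂ :=
  and_congr_right fun hs => and_congr (not_congr (h.rep₁ s hs)) (not_congr (h.rep₂ s hs))

theorem isLeafOf_comm {s : Fin n} : IsLeafOf S p₁ p₂ s ↔ IsLeafOf S p₂ p₁ s :=
  and_congr_right fun _ => and_comm

theorem splits_comm {y : Fin n} : Splits G S p₁ p₂ y ↔ Splits G S p₂ p₁ y := by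
  unfold Splits
  simp only [isLeafOf_comm (p₁ := p₁) (p₂ := p₂)]

theorem adj_of_dist (h : BistarData G T S c₁ c₂ p₁ p₂) {x y : Fin n} (hne : x ≠ y)
    (hd : T.dist (Sum.inl x) (Sum.inl y) ≤ 4) : G.Adj x y := (h.root.adj_iff x y).2 ⟨hne, hd⟩

theorem dist_of_adj (h : BistarData G T S c₁ c₂ p₁ p₂) {x y : Fin n} (hxy : G.Adj x y) :
    T.dist (Sum.inl x) (Sum.inl y) ≤ 4 := ((h.root.adj_iff x y).1 hxy).2

/-- A leaf is attached to exactly one of the central nodes. -/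
theorem adj_right_iff (h : BistarData G T S c₁ c₂ p₁ p₂) {s : Fin n} (hs : IsLeafOf S p₁ p₂ s) :
    T.Adj c₂ (Sum.inl s) ↔ ¬ T.Adj c₁ (Sum.inl s) := by
  rw [h.isLeafOf_iff] at hs
  refine ⟨fun h2 h1 => ?_, fun h1 => (h.bistar.adj s hs.1 hs.2.1 hs.2.2).resolve_left h1⟩
  have := h.root.1.dist_eq_dist_add_one_of_adj (Sum.inl s) h.bistar.adj_centre
  rw [SimpleGraph.dist_eq_one_iff_adj.2 h1.symm, SimpleGraph.dist_eq_one_iff_adj.2 h2.symm] at this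
  omega

theorem isLeafOf_of_left (h : BistarData G T S c₁ c₂ p₁ p₂) {s : Fin n} (hs : s ∈ S)
    (h1 : T.Adj c₁ (Sum.inl s)) (h2 : Sum.inl s ≠ c₂) : IsLeafOf S p₁ p₂ s :=
  (h.isLeafOf_iff s).2 ⟨hs, h1.ne', h2⟩

/-- The distances from a node that is closer to `c₁` than to `c₂` to the elements of `S`. -/
theorem dist_cases (h : BistarData G T S c₁ c₂ p₁ p₂) {x : Fin n ⊕ σ}
    (hx : T.dist x c₂ = T.dist x c₁ + 1) {s : Fin n} (hs : IsLeafOf S p₁ p₂ s) :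
    (T.Adj c₁ (Sum.inl s) → T.dist x (Sum.inl s) = T.dist x c₁ + 1 ∨
      T.dist x c₁ = T.dist x (Sum.inl s) + 1) ∧
    (¬ T.Adj c₁ (Sum.inl s) → T.dist x (Sum.inl s) = T.dist x c₁ + 2) := by
  constructor
  · intro h1
    have := h.root.1.dist_eq_dist_add_one_of_adj x h1
    omega
  · intro h1
    rw [h.root.1.dist_step h.bistar.adj_centre ((h.adj_right_iff hs).2 h1)
      ((h.isLeafOf_iff s).1 hs).2.1 hx, hx]

/-- A tree is bipartite, so no node is equally far from two adjacent ones. -/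
theorem closer (h : BistarData G T S c₁ c₂ p₁ p₂) (x : Fin n ⊕ σ) :
    T.dist x c₂ = T.dist x c₁ + 1 ∨ T.dist x c₁ = T.dist x c₂ + 1 := by
  have := h.root.1.dist_eq_dist_add_one_of_adj x h.bistar.adj_centre
  omega

/-- Every element of `S` is within two of `c₁`, so a vertex within two of `c₁` is adjacent to all of
them. -/
theorem three_le_of_deficient (h : BistarData G T S c₁ c₂ p₁ p₂) {y : Fin n}
    (hy : Deficient G S y) (hc : T.dist (Sum.inl y) c₂ = T.dist (Sum.inl y) c₁ + 1) :
    3 ≤ T.dist (Sum.inl y) c₁ := by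
  obtain ⟨s, hs, hne, hadj⟩ := hy
  by_contra hlt
  refine hadj (h.adj_of_dist hne.symm ?_)
  by_cases h1 : Sum.inl s = c₁
  · rw [h1]
    omega
  by_cases h2 : Sum.inl s = c₂
  · rw [h2]
    omega
  have := h.dist_cases hc ((h.isLeafOf_iff s).2 ⟨hs, h1, h2⟩)
  by_cases h3 : T.Adj c₁ (Sum.inl s)
  · have := this.1 h3
    omega
  · have := this.2 h3
    omega

/-- Seen from `y`, the leaves at `c₁` are at distance four or two, those at `c₂` at distance five.
-/
theorem adj_iff_of_eq_three (h : BistarData G T S c₁ c₂ p₁ p₂) {y : Fin n}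
    (hc : T.dist (Sum.inl y) c₂ = T.dist (Sum.inl y) c₁ + 1) (h3 : T.dist (Sum.inl y) c₁ = 3)
    {s : Fin n} (hs : IsLeafOf S p₁ p₂ s) : G.Adj y s ↔ T.Adj c₁ (Sum.inl s) := by
  have hd := h.dist_cases hc hs
  constructor
  · intro h'
    have h4 := h.dist_of_adj h'
    by_contra hn
    have := hd.2 hn
    omega
  · intro h'
    have := hd.1 h'
    refine h.adj_of_dist ?_ (by omega)
    rintro rfl
    rw [SimpleGraph.dist_self] at this
    omega

/-- From so far away, only a leaf on the path from `y` to `c₁` can be within four of `y`. -/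
theorem dist_of_four_le (h : BistarData G T S c₁ c₂ p₁ p₂) {y : Fin n}
    (hc : T.dist (Sum.inl y) c₂ = T.dist (Sum.inl y) c₁ + 1) (h4 : 4 ≤ T.dist (Sum.inl y) c₁)
    {s : Fin n} (hs : IsLeafOf S p₁ p₂ s) (hys : G.Adj y s) :
    T.Adj c₁ (Sum.inl s) ∧ T.dist (Sum.inl y) c₁ = T.dist (Sum.inl y) (Sum.inl s) + 1 := by
  have hd := h.dist_cases hc hs
  have hle := h.dist_of_adj hys
  by_cases h1 : T.Adj c₁ (Sum.inl s)
  · have := hd.1 h1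
    exact ⟨h1, by omega⟩
  · have := hd.2 h1
    omega

/-- The path from `y` to `c₁` enters `c₁` through only one leaf. -/
theorem subsingleton_of_four_le (h : BistarData G T S c₁ c₂ p₁ p₂) {y : Fin n}
    (hc : T.dist (Sum.inl y) c₂ = T.dist (Sum.inl y) c₁ + 1) (h4 : 4 ≤ T.dist (Sum.inl y) c₁)
    {s s' : Fin n} (hs : IsLeafOf S p₁ p₂ s) (hs' : IsLeafOf S p₁ p₂ s') (hys : G.Adj y s)
    (hys' : G.Adj y s') : s = s' := by
  obtain ⟨h1, h2⟩ := h.dist_of_four_le hc h4 hs hys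
  obtain ⟨h1', h2'⟩ := h.dist_of_four_le hc h4 hs' hys'
  by_contra hne
  have := h.root.1.dist_step h1.symm h1' (fun e => hne (Sum.inl.inj e).symm) h2
  omega

/-- A splitting vertex is adjacent to exactly the leaves on one side. -/
theorem adj_iff_of_splits (h : BistarData G T S c₁ c₂ p₁ p₂) {y : Fin n}
    (hy : Splits G S p₁ p₂ y) :
    (∀ s, IsLeafOf S p₁ p₂ s → (G.Adj y s ↔ T.Adj c₁ (Sum.inl s))) ∨
      ∀ s, IsLeafOf S p₁ p₂ s → (G.Adj y s ↔ ¬ T.Adj c₁ (Sum.inl s)) := by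
  have key : ∀ {c₁ c₂ : Fin n ⊕ σ} {p₁ p₂ : Fin n}, BistarData G T S c₁ c₂ p₁ p₂ →
      Splits G S p₁ p₂ y → T.dist (Sum.inl y) c₂ = T.dist (Sum.inl y) c₁ + 1 →
      ∀ s, IsLeafOf S p₁ p₂ s → (G.Adj y s ↔ T.Adj c₁ (Sum.inl s)) := by
    intro c₁ c₂ p₁ p₂ h hy hc s hs
    have h3 := h.three_le_of_deficient hy.1 hc
    refine h.adj_iff_of_eq_three hc ?_ hs
    -- At distance four or more, `y` would see only one leaf.
    by_contra hne
    obtain ⟨a, ha, b, hb, hab⟩ := (Set.one_lt_ncard (Set.toFinite _)).1 hy.2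
    exact hab (h.subsingleton_of_four_le hc (by omega) ha.1 hb.1 ha.2 hb.2)
  rcases h.closer (Sum.inl y) with hc | hc
  · exact .inl (key h hy hc)
  · right
    intro s hs
    rw [key h.symm (splits_comm.1 hy) hc s (isLeafOf_comm.1 hs), h.adj_right_iff hs]

/-- If there are two leaves at `c₁` and no vertex is splitting, a deficient vertex with a neighbour
among the leaves at `c₁` is far away behind that leaf. -/
theorem dist_of_not_splits (h : BistarData G T S c₁ c₂ p₁ p₂)
    (hA : ∃ a a', a ≠ a' ∧ IsLeafOf S p₁ p₂ a ∧ IsLeafOf S p₁ p₂ a' ∧ T.Adj c₁ (Sum.inl a) ∧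
      T.Adj c₁ (Sum.inl a')) {y s : Fin n} (hy : Deficient G S y) (hns : ¬ Splits G S p₁ p₂ y)
    (hs : IsLeafOf S p₁ p₂ s) (h1 : T.Adj c₁ (Sum.inl s)) (hys : G.Adj y s) :
    T.dist (Sum.inl y) c₂ = T.dist (Sum.inl y) c₁ + 1 ∧ 4 ≤ T.dist (Sum.inl y) c₁ ∧
      T.dist (Sum.inl y) c₁ = T.dist (Sum.inl y) (Sum.inl s) + 1 := by
  have hle := h.dist_of_adj hys
  rcases h.closer (Sum.inl y) with hc | hc
  · have h3 := h.three_le_of_deficient hy hc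
    have h4 : 4 ≤ T.dist (Sum.inl y) c₁ := by
      by_contra hlt
      obtain ⟨a, a', hne, ha, ha', haA, haA'⟩ := hA
      refine hns ⟨hy, (Set.one_lt_ncard (Set.toFinite _)).2 ⟨a, ⟨ha, ?_⟩, a', ⟨ha', ?_⟩, hne⟩⟩
      · exact (h.adj_iff_of_eq_three hc (by omega) ha).2 haA
      · exact (h.adj_iff_of_eq_three hc (by omega) ha').2 haA'
    exact ⟨hc, h4, (h.dist_of_four_le hc h4 hs hys).2⟩
  · have h3 := h.symm.three_le_of_deficient hy hc
    have := (h.symm.dist_cases hc (isLeafOf_comm.1 hs)).2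
      (fun h2 => (h.adj_right_iff hs).1 h2 h1)
    omega

end BistarData

/-- The situation where both central nodes have two leaves and no vertex is splitting. -/
structure UnsplitData (G : SimpleGraph (Fin n)) (T : SimpleGraph (Fin n ⊕ σ)) (S : Finset (Fin n))
    (c₁ c₂ : Fin n ⊕ σ) (p₁ p₂ : Fin n) : Prop extends BistarData G T S c₁ c₂ p₁ p₂ where
  two_left : ∃ a a', a ≠ a' ∧ IsLeafOf S p₁ p₂ a ∧ IsLeafOf S p₁ p₂ a' ∧ T.Adj c₁ (Sum.inl a) ∧
    T.Adj c₁ (Sum.inl a')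
  two_right : ∃ a a', a ≠ a' ∧ IsLeafOf S p₁ p₂ a ∧ IsLeafOf S p₁ p₂ a' ∧ T.Adj c₂ (Sum.inl a) ∧
    T.Adj c₂ (Sum.inl a')
  not_splits : ∀ y, ¬ Splits G S p₁ p₂ y

namespace UnsplitData

theorem symm (h : UnsplitData G T S c₁ c₂ p₁ p₂) : UnsplitData G T S c₂ c₁ p₂ p₁ := by
  refine ⟨h.toBistarData.symm, ?_, ?_, fun y hy => h.not_splits y (BistarData.splits_comm.1 hy)⟩
  · simpa only [BistarData.isLeafOf_comm (p₁ := p₂) (p₂ := p₁)] using h.two_right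
  · simpa only [BistarData.isLeafOf_comm (p₁ := p₂) (p₂ := p₁)] using h.two_left

/-- If `s` were attached to `c₂`, then `y` would be behind it, at distance at least four from `c₂`
and thus at least five from `c₁`. But `c₁` is the vertex `p₁`, which `y` is adjacent to. -/
theorem adj_of_pinned (h : UnsplitData G T S c₁ c₂ p₁ p₂) {s : Fin n} (hs : IsLeafOf S p₁ p₂ s)
    (hp : Pinned G S s p₁) : T.Adj c₁ (Sum.inl s) := by
  obtain ⟨hp₁, y, hy, hys, hyp⟩ := hp
  by_contra h1
  have := h.symm.dist_of_not_splits h.symm.two_left hy (h.symm.not_splits y)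
    (BistarData.isLeafOf_comm.1 hs) ((h.adj_right_iff hs).2 h1) hys
  have h2 := h.dist_of_adj hyp
  rw [(h.rep₁ p₁ hp₁).1 rfl] at h2
  omega

theorem not_adj_of_pinned (h : UnsplitData G T S c₁ c₂ p₁ p₂) {s : Fin n}
    (hs : IsLeafOf S p₁ p₂ s) (hp : Pinned G S s p₂) : ¬ T.Adj c₁ (Sum.inl s) :=
  (h.adj_right_iff hs).1 (h.symm.adj_of_pinned (BistarData.isLeafOf_comm.1 hs) hp)

/-- The witness `x` hangs behind `s`: otherwise its path to `y` would run through `s`, beyond which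
`y` is at least three away, and `x` would have to be `c₁` itself, hence in `S`. So `x` is at
distance at least two from `c₁`. Being adjacent to a leaf at `c₂`, it is at distance at most two. -/
theorem dist_of_witness (h : UnsplitData G T S c₁ c₂ p₁ p₂) {s x : Fin n}
    (hs : IsLeafOf S p₁ p₂ s) (h1 : T.Adj c₁ (Sum.inl s)) (hx : Witness G S s x) :
    T.dist (Sum.inl x) c₁ = 2 ∧ T.dist (Sum.inl x) c₂ = 3 := by
  obtain ⟨hxS, hxd, y, hy, hys, hyx⟩ := hx
  have hT := h.root.1
  have hyd := h.dist_of_not_splits h.two_left hy (h.not_splits y) hs h1 hys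
  have hne : (Sum.inl s : Fin n ⊕ σ) ≠ c₂ := ((h.isLeafOf_iff s).1 hs).2.2
  have hxs : 0 < T.dist (Sum.inl x) (Sum.inl s : Fin n ⊕ σ) := hT.connected.pos_dist_of_ne
    fun e => hxS (Sum.inl.inj e ▸ hs.1)
  have hfar : T.dist (Sum.inl x) c₁ = T.dist (Sum.inl x) (Sum.inl s) + 1 := by
    rcases hT.dist_eq_dist_add_one_of_adj (Sum.inl x) h1 with hd | hd
    · exact hd
    · exfalso
      have h3 := SimpleGraph.dist_eq_one_iff_adj.2 h1
      have h4 := hT.dist_eq_or_dist_eq (a := Sum.inl y) (b := c₁) (p := Sum.inl s)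
        (by rw [SimpleGraph.dist_comm (v := c₁)]; omega) (Sum.inl x)
      rw [SimpleGraph.dist_comm (u := Sum.inl s) (v := Sum.inl y),
        SimpleGraph.dist_comm (u := Sum.inl s) (v := c₁)] at h4
      have h5 := h.dist_of_adj hyx.symm
      have h6 : T.dist (Sum.inl x) c₁ = 0 := by omega
      rw [hT.connected.dist_eq_zero_iff] at h6
      exact hxS (h.bistar.real₁ x h6.symm)
  obtain ⟨b, b', -, hb, -, hbB, -⟩ := h.two_right
  have h2 := hT.dist_step h1.symm h.bistar.adj_centre hne.symm hfar
  have h3 := hT.dist_step h.bistar.adj_centre hbB ((h.isLeafOf_iff b).1 hb).2.1 h2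
  have hxb : G.Adj x b := by
    by_contra hn
    exact hxd ⟨b, hb.1, fun e => hxS (e ▸ hb.1), hn⟩
  have h4 := h.dist_of_adj hxb
  omega

/-- Two witnesses for the side of `c₁` are within `2 + 2` of each other, while witnesses for
different sides are at distance `2 + 1 + 2`. -/
theorem aligned_iff_left (h : UnsplitData G T S c₁ c₂ p₁ p₂) {s s' x x' : Fin n}
    (hs : IsLeafOf S p₁ p₂ s) (hs' : IsLeafOf S p₁ p₂ s') (hx : Witness G S s x)
    (hx' : Witness G S s' x') (h1 : T.Adj c₁ (Sum.inl s)) :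
    (x' = x ∨ G.Adj x' x) ↔ T.Adj c₁ (Sum.inl s') := by
  have hd := h.dist_of_witness hs h1 hx
  constructor
  · intro hxx
    by_contra h1'
    have hd' := h.symm.dist_of_witness (BistarData.isLeafOf_comm.1 hs') ((h.adj_right_iff hs').2 h1')
      hx'
    have h2 := SimpleGraph.dist_eq_one_iff_adj.2 h.bistar.adj_centre
    have h3 := h.root.1.dist_eq_or_dist_eq (a := Sum.inl x) (b := c₂) (p := c₁) (by omega)
      (Sum.inl x')
    rw [SimpleGraph.dist_comm (u := c₁) (v := Sum.inl x)] at h3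
    have h4 : T.dist (Sum.inl x') (Sum.inl x) ≤ 4 := by
      rcases hxx with rfl | hxx
      · simp
      · exact h.dist_of_adj hxx
    omega
  · intro h1'
    have hd' := h.dist_of_witness hs' h1' hx'
    have h3 := h.root.1.connected.dist_triangle (u := Sum.inl x') (v := c₁) (w := Sum.inl x)
    rw [SimpleGraph.dist_comm (u := c₁) (v := Sum.inl x)] at h3
    by_cases hxx : x' = x
    · exact .inl hxx
    · exact .inr (h.adj_of_dist hxx (by omega))

/-- Two leaves with witnesses are on the same side if and only if the witnesses are equal or
adjacent. -/
theorem aligned_iff (h : UnsplitData G T S c₁ c₂ p₁ p₂) {s s' x x' : Fin n}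
    (hs : IsLeafOf S p₁ p₂ s) (hs' : IsLeafOf S p₁ p₂ s') (hx : Witness G S s x)
    (hx' : Witness G S s' x') :
    (x' = x ∨ G.Adj x' x) ↔ (T.Adj c₁ (Sum.inl s') ↔ T.Adj c₁ (Sum.inl s)) := by
  by_cases h1 : T.Adj c₁ (Sum.inl s)
  · rw [h.aligned_iff_left hs hs' hx hx' h1]
    tauto
  · have h2 := (h.adj_right_iff hs).2 h1
    rw [h.symm.aligned_iff_left (BistarData.isLeafOf_comm.1 hs) (BistarData.isLeafOf_comm.1 hs') hx hx'
      h2, h.adj_right_iff hs']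
    tauto

end UnsplitData

end Bistar

/-! ### Free leaves -/

theorem IsMaxClique.exists_not_adj {V : Type} {G : SimpleGraph V} {K : Finset V}
    (hK : IsMaxClique G K) {t : V} (ht : t ∉ K) : ∃ y ∈ K, y ≠ t ∧ ¬ G.Adj y t := by
  classical
  by_contra hno
  push Not at hno
  have : G.IsClique ((insert t K : Finset V) : Set V) := by
    rw [Finset.coe_insert, SimpleGraph.isClique_insert]
    exact ⟨hK.1, fun y hy hty => (hno y hy hty.symm).symm⟩
  exact ht (hK.2 this (Finset.subset_insert _ _) (Finset.mem_insert_self _ _))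

theorem exists_isMaxClique_superset {V : Type} [Finite V] {G : SimpleGraph V} {S : Finset V}
    (hS : G.IsClique (S : Set V)) : ∃ K, IsMaxClique G K ∧ S ⊆ K := by
  obtain ⟨K, hSK, hK⟩ := (Set.toFinite {s : Finset V | G.IsClique (s : Set V)}).exists_le_maximal hS
  exact ⟨K, hK, hSK⟩

/-- Extend `S` by `u` and by `v`, respectively, to maximal cliques. Their intersection consists of
common neighbours of `u` and `v`, since neither clique contains both. -/
theorem IsCommonNeighborSet.isCliqueIntersection {V : Type} [Finite V] {G : SimpleGraph V}
    {S : Finset V} {u v : V} (h : IsCommonNeighborSet G S u v) (hS : G.IsClique (S : Set V)) :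
    IsCliqueIntersection G S := by
  classical
  have key : ∀ w, (∀ s ∈ S, G.Adj w s) → ∃ K, IsMaxClique G K ∧ insert w S ⊆ K := fun w hw =>
    exists_isMaxClique_superset (by
      rw [Finset.coe_insert, SimpleGraph.isClique_insert]
      exact ⟨hS, fun s hs _ => hw s hs⟩)
  obtain ⟨K₁, hK₁, h₁⟩ := key u fun s hs => ((h.mem_iff s).1 hs).1
  obtain ⟨K₂, hK₂, h₂⟩ := key v fun s hs => ((h.mem_iff s).1 hs).2
  rw [Finset.insert_subset_iff] at h₁ h₂
  have hvK₁ : v ∉ K₁ := fun hv => h.not_adj (hK₁.1 h₁.1 hv h.ne)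
  have huK₂ : u ∉ K₂ := fun hu => h.not_adj (hK₂.1 hu h₂.1 h.ne)
  refine ⟨{K₁, K₂}, ⟨K₁, by simp⟩, ?_, fun x => ⟨?_, fun hx => ?_⟩⟩
  · rintro K (rfl | rfl)
    · exact hK₁
    · exact hK₂
  · rintro hx K (rfl | rfl)
    · exact h₁.2 hx
    · exact h₂.2 hx
  · have hx₁ := hx K₁ (by simp)
    have hx₂ := hx K₂ (by simp)
    rw [h.mem_iff]
    exact ⟨hK₁.1 h₁.1 hx₁ fun e => huK₂ (e ▸ hx₂), hK₂.1 h₂.1 hx₂ fun e => hvK₁ (e ▸ hx₁)⟩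

/-! ### Free leaves and the centre of a bistar -/

section Bistar

variable {n : ℕ} {σ : Type} {G : SimpleGraph (Fin n)} {T : SimpleGraph (Fin n ⊕ σ)}
  {S : Finset (Fin n)} {c₁ c₂ : Fin n ⊕ σ} {p₁ p₂ : Fin n}

/-- A leaf without a label is free. -/
theorem UnsplitData.isFree (h : UnsplitData G T S c₁ c₂ p₁ p₂) {s : Fin n}
    (hs : IsLeafOf S p₁ p₂ s) (h1 : ¬ Pinned G S s p₁) (h2 : ¬ Pinned G S s p₂)
    (h3 : ∀ x, ¬ Witness G S s x) : IsFree G S s := by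
  refine ⟨hs.1, ?_, ?_⟩
  -- Suppose that `s` lies in a smaller clique-intersection `X`. Some maximal clique around `X`
  -- misses an element `t` of `S`, and its member `y` that is not adjacent to `t` is deficient and
  -- complete to `X`. A second element of `X` is a leaf, so that `y` is splitting, or a centre, so
  -- that `s` is pinned.
  · rintro ⟨X, ⟨F, -, hF, hXF⟩, hXS, hsX, hcard⟩
    obtain ⟨t, htS, htX⟩ := Finset.exists_of_ssubset hXS
    obtain ⟨K, hK, htK⟩ : ∃ K ∈ F, t ∉ K := by
      by_contra hno
      push Not at hno
      exact htX ((hXF t).2 hno)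
    obtain ⟨y, hyK, hyt, hadj⟩ := (hF K hK).exists_not_adj htK
    have hy : Deficient G S y := ⟨t, htS, hyt.symm, hadj⟩
    have hyX : ∀ x ∈ X, G.Adj y x := by
      intro x hx
      have hxK := (hXF x).1 hx K hK
      refine (hF K hK).1 hyK hxK fun e => hadj ?_
      rw [e]
      exact h.clique (hXS.1 hx) htS fun e' => htK (e' ▸ hxK)
    obtain ⟨s', hs'X, hne⟩ := Finset.exists_mem_ne (by omega : 1 < X.card) s
    have hys' := hyX s' hs'X
    by_cases hleaf : IsLeafOf S p₁ p₂ s'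
    · exact h.not_splits y ⟨hy, (Set.one_lt_ncard (Set.toFinite _)).2
        ⟨s, ⟨hs, hyX s hsX⟩, s', ⟨hleaf, hys'⟩, hne.symm⟩⟩
    · have hs'S := hXS.1 hs'X
      by_cases e1 : s' = p₁
      · exact h1 ⟨e1 ▸ hs'S, y, hy, hyX s hsX, e1 ▸ hys'⟩
      by_cases e2 : s' = p₂
      · exact h2 ⟨e2 ▸ hs'S, y, hy, hyX s hsX, e2 ▸ hys'⟩
      exact hleaf ⟨hs'S, e1, e2⟩
  -- Suppose that `s` is sandwiched. The additional vertex `x` of `X₁ ∩ X₂` is outside `S` and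
  -- complete to `S`. A maximal clique around `X₂` misses some `t` in `S`, and its member `y` that
  -- is not adjacent to `t` is deficient and adjacent to `s` and `x`. So `x` is a witness.
  · rintro ⟨X₁, X₂, ⟨F₁, ⟨K₁, hK₁⟩, hF₁, hX₁⟩, ⟨F₂, -, hF₂, hX₂⟩, hSX, hinter, x, hxs, hx₁, hx₂⟩
    have hxS : x ∉ S := fun hx => hxs ((hinter x).1 ⟨hx, hx₂⟩)
    have hcomplete : ∀ t ∈ S, G.Adj x t := fun t ht =>
      (hF₁ K₁ hK₁).1 ((hX₁ x).1 hx₁ K₁ hK₁) ((hX₁ t).1 (hSX.1 ht) K₁ hK₁) fun e => hxS (e ▸ ht)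
    obtain ⟨t, ht, hts⟩ : ∃ t ∈ S, t ≠ s := by
      obtain ⟨a, a', hne, ha, ha', -⟩ := h.two_left
      by_cases has : a = s
      · exact ⟨a', ha'.1, fun e => hne (has.trans e.symm)⟩
      · exact ⟨a, ha.1, has⟩
    have hsX₂ : s ∈ X₂ := ((hinter s).2 rfl).2
    have htX₂ : t ∉ X₂ := fun ht₂ => hts ((hinter t).1 ⟨ht, ht₂⟩)
    obtain ⟨K, hK, htK⟩ : ∃ K ∈ F₂, t ∉ K := by
      by_contra hno
      push Not at hno
      exact htX₂ ((hX₂ t).2 hno)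
    obtain ⟨y, hyK, hyt, hadj⟩ := (hF₂ K hK).exists_not_adj htK
    have hmem : ∀ z ∈ X₂, G.Adj z t → G.Adj y z := fun z hz hzt =>
      (hF₂ K hK).1 hyK ((hX₂ z).1 hz K hK) fun e => hadj (e ▸ hzt)
    refine h3 x ⟨hxS, fun ⟨t', ht', _, hn⟩ => hn (hcomplete t' ht'), y, ⟨t, ht, hyt.symm, hadj⟩,
      hmem s hsX₂ (h.clique hs.1 ht hts.symm), hmem x hx₂ (hcomplete t ht)⟩

theorem le_edist_induce {W : Type*} {T : SimpleGraph W} (A : Set W) (x y : A) :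
    (T.dist x y : ℕ∞) ≤ (T.induce A).edist x y := by
  refine le_iInf fun p => ?_
  have : T.dist x y ≤ (p.map (SimpleGraph.Embedding.induce A).toHom).length :=
    SimpleGraph.dist_le _
  rw [SimpleGraph.Walk.length_map] at this
  exact_mod_cast this

theorem edist_le_of_adj_adj {W : Type*} {H : SimpleGraph W} {x y z : W} (h1 : H.Adj x y)
    (h2 : H.Adj y z) : H.edist x z ≤ 2 :=
  SimpleGraph.Walk.edist_le (.cons h1 (.cons h2 .nil))

theorem edist_le_two_of_adj {W : Type*} {H : SimpleGraph W} {x y : W} (h1 : H.Adj x y) :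
    H.edist x y ≤ 2 :=
  (SimpleGraph.Walk.edist_le (.cons h1 .nil)).trans (by norm_num)

namespace IsBistarAt

theorem mem_hull_left (h : IsBistarAt T S c₁ c₂) : c₁ ∈ hull T S := by
  rw [h.hull_eq]
  exact .inr (.inl rfl)

theorem mem_hull_right (h : IsBistarAt T S c₁ c₂) : c₂ ∈ hull T S := by
  rw [h.hull_eq]
  exact .inr (.inr rfl)

theorem eccent_left_le (h : IsBistarAt T S c₁ c₂) :
    (spanTree T S).eccent ⟨c₁, h.mem_hull_left⟩ ≤ 2 := by
  rw [SimpleGraph.eccent_le_iff]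
  rintro ⟨x, hx⟩
  by_cases h1 : x = c₁
  · subst h1
    simp
  have h12 : (spanTree T S).Adj ⟨c₁, h.mem_hull_left⟩ ⟨c₂, h.mem_hull_right⟩ := h.adj_centre
  by_cases h2 : x = c₂
  · subst h2
    exact edist_le_two_of_adj h12
  have hx' := hx
  rw [h.hull_eq] at hx'
  rcases hx' with ⟨s, hs, rfl⟩ | rfl | rfl
  · rcases h.adj s hs h1 h2 with hadj | hadj
    · exact edist_le_two_of_adj hadj
    · exact edist_le_of_adj_adj h12 hadj
  · exact absurd rfl h1
  · exact absurd rfl h2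

theorem dist_left_right (h : IsBistarAt T S c₁ c₂) (hT : T.IsTree) {b : Fin n}
    (hb : Sum.inl b ≠ c₁) (hadj : T.Adj c₂ (Sum.inl b)) : T.dist c₁ (Sum.inl b) = 2 := by
  have h12 := SimpleGraph.dist_eq_one_iff_adj.2 h.adj_centre
  rw [hT.dist_step h.adj_centre hadj hb (x := c₁) (by rw [h12, SimpleGraph.dist_self]), h12]

theorem two_le_eccent_left (h : IsBistarAt T S c₁ c₂) (hT : T.IsTree) :
    2 ≤ (spanTree T S).eccent ⟨c₁, h.mem_hull_left⟩ := by
  obtain ⟨b, hb, hb1, hadj⟩ := h.right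
  have h1 := le_edist_induce (T := T) (hull T S) ⟨c₁, h.mem_hull_left⟩
    ⟨Sum.inl b, mem_hull_of_mem T hb⟩
  rw [h.dist_left_right hT hb1 hadj] at h1
  exact le_trans h1 SimpleGraph.edist_le_eccent

theorem three_le_eccent_leaf (h : IsBistarAt T S c₁ c₂) (hT : T.IsTree) {a : Fin n} (ha : a ∈ S)
    (ha2 : Sum.inl a ≠ c₂) (hadj : T.Adj c₁ (Sum.inl a)) :
    3 ≤ (spanTree T S).eccent ⟨Sum.inl a, mem_hull_of_mem T ha⟩ := by
  obtain ⟨b, hb, hb1, hadjb⟩ := h.right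
  have h1 := le_edist_induce (T := T) (hull T S) ⟨Sum.inl a, mem_hull_of_mem T ha⟩
    ⟨Sum.inl b, mem_hull_of_mem T hb⟩
  have h2 := SimpleGraph.dist_eq_one_iff_adj.2 hadj.symm
  have h3 := hT.dist_step hadj.symm h.adj_centre ha2.symm (x := Sum.inl a)
    (by rw [h2, SimpleGraph.dist_self])
  have h4 := hT.dist_step h.adj_centre hadjb hb1 h3
  have h5 : T.dist (Sum.inl a) (Sum.inl b : Fin n ⊕ σ) = 3 := by omega
  rw [h5] at h1
  exact le_trans h1 SimpleGraph.edist_le_eccent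

/-- Together with `eccent_left_le` and its mirror image, this identifies the centre of the bistar as
`c₁` and `c₂`. -/
theorem two_le_eccent (h : IsBistarAt T S c₁ c₂) (hT : T.IsTree) (x : hull T S) :
    2 ≤ (spanTree T S).eccent x ∧ (x.1 = c₁ ∨ x.1 = c₂ ∨ 3 ≤ (spanTree T S).eccent x) := by
  obtain ⟨x, hx⟩ := x
  by_cases h1 : x = c₁
  · subst h1
    exact ⟨h.two_le_eccent_left hT, .inl rfl⟩
  by_cases h2 : x = c₂
  · subst h2
    exact ⟨h.symm.two_le_eccent_left hT, .inr (.inl rfl)⟩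
  have hx' := hx
  rw [h.hull_eq] at hx'
  rcases hx' with ⟨s, hs, rfl⟩ | rfl | rfl
  · have h3 : 3 ≤ (spanTree T S).eccent ⟨Sum.inl s, hx⟩ := by
      rcases h.adj s hs h1 h2 with hadj | hadj
      · exact h.three_le_eccent_leaf hT hs h2 hadj
      · exact h.symm.three_le_eccent_leaf hT hs h1 hadj
    exact ⟨le_trans (by norm_num) h3, .inr (.inr h3)⟩
  · exact absurd rfl h1
  · exact absurd rfl h2

theorem left_mem_center (h : IsBistarAt T S c₁ c₂) (hT : T.IsTree) :
    (⟨c₁, h.mem_hull_left⟩ : hull T S) ∈ (spanTree T S).center := by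
  rw [SimpleGraph.mem_center_iff]
  exact le_antisymm (le_trans h.eccent_left_le (le_iInf fun x => (h.two_le_eccent hT x).1))
    (iInf_le _ _)

theorem eq_of_mem_center (h : IsBistarAt T S c₁ c₂) (hT : T.IsTree) {x : hull T S}
    (hx : x ∈ (spanTree T S).center) : x.1 = c₁ ∨ x.1 = c₂ := by
  rw [SimpleGraph.mem_center_iff] at hx
  have h1 : (spanTree T S).eccent x ≤ 2 := hx.le.trans ((iInf_le _ _).trans h.eccent_left_le)
  rcases (h.two_le_eccent hT x).2 with h2 | h2 | h2
  · exact .inl h2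
  · exact .inr h2
  · exact absurd (h2.trans h1) (by norm_num)

theorem not_isNearestCentre (h : IsBistarAt T S c₁ c₂) (hT : T.IsTree) {s : Fin n} (hs : s ∈ S)
    (h1 : Sum.inl s ≠ c₁) (hadj : T.Adj c₂ (Sum.inl s)) :
    ¬ IsNearestCentre (spanTree T S) ⟨Sum.inl s, mem_hull_of_mem T hs⟩ ⟨c₁, h.mem_hull_left⟩ := by
  intro hn
  have hle := hn.2 _ (h.symm.left_mem_center hT)
  have hadj2 : (spanTree T S).Adj ⟨Sum.inl s, mem_hull_of_mem T hs⟩ ⟨c₂, h.mem_hull_right⟩ :=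
    hadj.symm
  have h12 : (spanTree T S).Adj ⟨c₂, h.mem_hull_right⟩ ⟨c₁, h.mem_hull_left⟩ := h.adj_centre.symm
  rw [SimpleGraph.dist_eq_one_iff_adj.2 hadj2] at hle
  -- Reachability matters: an unreachable node would have distance `0` by convention. The shortest
  -- walk found here, viewed in `T`, has length at least two.
  obtain ⟨p, hp⟩ := (hadj2.reachable.trans h12.reachable).exists_walk_length_eq_dist
  have h3 : T.dist (Sum.inl s) c₁ ≤ (p.map (SimpleGraph.Embedding.induce (hull T S)).toHom).length :=
    SimpleGraph.dist_le _
  rw [SimpleGraph.Walk.length_map, hp, SimpleGraph.dist_comm, h.dist_left_right hT h1 hadj] at h3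
  omega

end IsBistarAt

/-- On one of the two sides there is at most one free leaf. -/
theorem BistarData.free_subsingleton (h : BistarData G T S c₁ c₂ p₁ p₂)
    (hw : WellStructuredAt G T S) :
    (∀ s s', IsLeafOf S p₁ p₂ s → IsLeafOf S p₁ p₂ s' → IsFree G S s → IsFree G S s' →
      ¬ T.Adj c₁ (Sum.inl s) → ¬ T.Adj c₁ (Sum.inl s') → s = s') ∨
    (∀ s s', IsLeafOf S p₁ p₂ s → IsLeafOf S p₁ p₂ s' → IsFree G S s → IsFree G S s' →
      T.Adj c₁ (Sum.inl s) → T.Adj c₁ (Sum.inl s') → s = s') := by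
  have hT := h.root.1
  -- The distinguished node `c` is one of the two centres, and every free leaf at the other centre
  -- counts as an exception.
  obtain ⟨⟨c, hc⟩, hcc, hsub⟩ := hw.grouped
  have key : ∀ s s' (hs : s ∈ S) (hs' : s' ∈ S), IsFree G S s → IsFree G S s' →
      ¬ IsNearestCentre (spanTree T S) ⟨Sum.inl s, mem_hull_of_mem T hs⟩ ⟨c, hc⟩ →
      ¬ IsNearestCentre (spanTree T S) ⟨Sum.inl s', mem_hull_of_mem T hs'⟩ ⟨c, hc⟩ → s = s' := by
    intro s s' hs hs' hf hf' hn hn'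
    exact Sum.inl.inj (congrArg Subtype.val (hsub ⟨⟨s, hf, rfl⟩, hn⟩ ⟨⟨s', hf', rfl⟩, hn'⟩))
  rcases h.bistar.eq_of_mem_center hT hcc with hc' | hc' <;> dsimp only at hc' <;> subst hc'
  · left
    intro s s' hs hs' hf hf' hn hn'
    refine key s s' hs.1 hs'.1 hf hf' ?_ ?_
    · exact h.bistar.not_isNearestCentre hT hs.1 ((h.isLeafOf_iff s).1 hs).2.1
        ((h.adj_right_iff hs).2 hn)
    · exact h.bistar.not_isNearestCentre hT hs'.1 ((h.isLeafOf_iff s').1 hs').2.1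
        ((h.adj_right_iff hs').2 hn')
  · right
    intro s s' hs hs' hf hf' hn hn'
    refine key s s' hs.1 hs'.1 hf hf' ?_ ?_
    · exact h.bistar.symm.not_isNearestCentre hT hs.1 ((h.isLeafOf_iff s).1 hs).2.2 hn
    · exact h.bistar.symm.not_isNearestCentre hT hs'.1 ((h.isLeafOf_iff s').1 hs').2.2 hn'

/-- If at most one free leaf is attached to `c₂`, some labelling is correct. -/
theorem UnsplitData.exists_label (h : UnsplitData G T S c₁ c₂ p₁ p₂) {u : Fin n} (hu : u ∉ S)
    (hfree : ∀ s s', IsLeafOf S p₁ p₂ s → IsLeafOf S p₁ p₂ s' → IsFree G S s → IsFree G S s' →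
      ¬ T.Adj c₁ (Sum.inl s) → ¬ T.Adj c₁ (Sum.inl s') → s = s') :
    ∃ f β, (f ∈ S ∨ f = u) ∧ ∀ s, IsLeafOf S p₁ p₂ s →
      (Label G S p₁ p₂ β f s ↔ T.Adj c₁ (Sum.inl s)) := by
  have hns : lastSat (Splits G S p₁ p₂) = none := lastSat_eq_none_iff.2 h.not_splits
  -- Take for `f` the free leaf at `c₂`. If there is none, `u` serves as a dummy, since it is not a
  -- leaf.
  obtain ⟨f, hfS, hf⟩ : ∃ f, (f ∈ S ∨ f = u) ∧ ∀ s, IsLeafOf S p₁ p₂ s → IsFree G S s →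
      (s ≠ f ↔ T.Adj c₁ (Sum.inl s)) := by
    by_cases hex : ∃ f, IsLeafOf S p₁ p₂ f ∧ IsFree G S f ∧ ¬ T.Adj c₁ (Sum.inl f)
    · obtain ⟨f, hfl, hff, hfn⟩ := hex
      refine ⟨f, .inl hfl.1, fun s hs hsf => ⟨fun hne => ?_, ?_⟩⟩
      · by_contra hn
        exact hne (hfree s f hs hfl hsf hff hn hfn)
      · rintro hadj rfl
        exact hfn hadj
    · push Not at hex
      exact ⟨u, .inr rfl, fun s hs hsf => ⟨fun _ => hex s hs hsf, fun _ e => hu (e ▸ hs.1)⟩⟩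
  -- The bit `β` records the side of the reference leaf. If there is no reference leaf, no leaf has
  -- a witness, and any `β` will do.
  obtain ⟨β, hβ⟩ : ∃ β : Prop, ∀ s, IsLeafOf S p₁ p₂ s → witness G S s ≠ none →
      ((AlignedWith G S p₁ p₂ s ↔ β) ↔ T.Adj c₁ (Sum.inl s)) := by
    cases hr : reference G S p₁ p₂ with
    | none =>
      refine ⟨True, fun s hs hw => ?_⟩
      exact absurd ⟨hs, hw⟩ (lastSat_eq_none_iff.1 hr s)
    | some r =>
      obtain ⟨hrl, hrw⟩ := (lastSat_eq_some hr).1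
      obtain ⟨y, hy⟩ := Option.ne_none_iff_exists'.1 hrw
      refine ⟨T.Adj c₁ (Sum.inl r), fun s hs hw => ?_⟩
      obtain ⟨x, hx⟩ := Option.ne_none_iff_exists'.1 hw
      have h1 : AlignedWith G S p₁ p₂ s ↔ (x = y ∨ G.Adj x y) := by
        constructor
        · rintro ⟨r', x', y', hr', hx', hy', hxy⟩
          obtain rfl := Option.some.inj (hr.symm.trans hr')
          obtain rfl := Option.some.inj (hx.symm.trans hx')
          obtain rfl := Option.some.inj (hy.symm.trans hy')
          exact hxy
        · exact fun hxy => ⟨r, x, y, hr, hx, hy, hxy⟩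
      rw [h1, h.aligned_iff hrl hs (lastSat_eq_some hy).1 (lastSat_eq_some hx).1]
      tauto
  refine ⟨f, β, hfS, fun s hs => ?_⟩
  unfold Label
  rw [hns]
  by_cases h1 : Pinned G S s p₁
  · simp [h1, h.adj_of_pinned hs h1]
  by_cases h2 : Pinned G S s p₂
  · simp [h1, h2, h.not_adj_of_pinned hs h2]
  cases hw : witness G S s with
  | some x =>
    have := hβ s hs (by rw [hw]; simp)
    simpa [h1, h2] using this
  | none =>
    have := hf s hs (h.isFree hs h1 h2 (lastSat_eq_none_iff.1 hw))
    simpa [h1, h2] using this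

end Bistar

/-! ### The family of trees for a separator -/

section Family

variable {n : ℕ}

open Classical in
noncomputable def commonNbrs (G : SimpleGraph (Fin n)) (u v : Fin n) : Finset (Fin n) :=
  Finset.univ.filter fun x => G.Adj u x ∧ G.Adj v x

theorem mem_commonNbrs {G : SimpleGraph (Fin n)} {u v x : Fin n} :
    x ∈ commonNbrs G u v ↔ G.Adj u x ∧ G.Adj v x := by simp [commonNbrs]

open Classical in
/-- The name of the node for which `p` stands. -/
noncomputable def nameIn (S : Finset (Fin n)) (p : Fin n) : Option (Fin n) :=
  if p ∈ S then some p else none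

theorem nameIn_eq_some {S : Finset (Fin n)} {p v : Fin n} :
    nameIn S p = some v ↔ p = v ∧ v ∈ S := by
  unfold nameIn
  split_ifs with h
  · rw [Option.some.injEq]
    exact ⟨fun e => ⟨e, e ▸ h⟩, fun e => e.1⟩
  · simp only [reduceCtorEq, false_iff, not_and]
    exact fun e hv => h (e ▸ hv)

open Classical in
noncomputable def leafList (S : Finset (Fin n)) (c₁ c₂ : Fin n) : List (Fin n) :=
  (List.finRange n).filter fun s => IsLeafOf S c₁ c₂ s

theorem mem_leafList {S : Finset (Fin n)} {c₁ c₂ s : Fin n} :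
    s ∈ leafList S c₁ c₂ ↔ IsLeafOf S c₁ c₂ s := by simp [leafList]

theorem nodup_leafList (S : Finset (Fin n)) (c₁ c₂ : Fin n) : (leafList S c₁ c₂).Nodup :=
  (List.nodup_finRange n).filter _

open Classical in
noncomputable def fatherOf (P : Fin n → Prop) (s : Fin n) : ℕ := if P s then 0 else 1

theorem fatherOf_le (P : Fin n → Prop) (s : Fin n) : fatherOf P s ≤ 1 := by
  unfold fatherOf
  split_ifs <;> omega

theorem fatherOf_eq_zero_iff {P : Fin n → Prop} {s : Fin n} : fatherOf P s = 0 ↔ P s := by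
  unfold fatherOf
  split_ifs with h <;> simp [h]

noncomputable def starTree (S : Finset (Fin n)) (c : Fin n) : CodedTree n :=
  .star (nameIn S c) (leafList S c c)

noncomputable def bistarTree (S : Finset (Fin n)) (c₁ c₂ : Fin n) (P : Fin n → Prop) : CodedTree n :=
  .bistar (nameIn S c₁) (nameIn S c₂) (leafList S c₁ c₂) (fatherOf P)

open Classical in
/-- The bistars with centres `c₁`, `c₂`. -/
noncomputable def bistarTrees (G : SimpleGraph (Fin n)) (S : Finset (Fin n)) (u c₁ c₂ : Fin n) :
    List (CodedTree n) :=
  (List.finRange n).flatMap fun f => if f ∈ S ∨ f = u then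
    [bistarTree S c₁ c₂ (· = f), bistarTree S c₁ c₂ (Label G S c₁ c₂ True f),
      bistarTree S c₁ c₂ (Label G S c₁ c₂ False f)] else []

open Classical in
/-- The trees whose first centre is `c₁`. -/
noncomputable def treesAt (G : SimpleGraph (Fin n)) (S : Finset (Fin n)) (u c₁ : Fin n) :
    List (CodedTree n) :=
  starTree S c₁ :: (List.finRange n).flatMap fun c₂ =>
    if (c₂ ∈ S ∨ c₂ = u) ∧ (c₁ ≠ c₂ ∨ c₁ = u) then bistarTrees G S u c₁ c₂ else []

open Classical in
/-- All candidates for the subtree spanned by `S`; a centre that is a Steiner node is encoded by the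
vertex `u`, which is not in `S`. -/
noncomputable def trees (G : SimpleGraph (Fin n)) (S : Finset (Fin n)) (u : Fin n) :
    List (CodedTree n) :=
  (List.finRange n).flatMap fun c₁ => if c₁ ∈ S ∨ c₁ = u then treesAt G S u c₁ else []

variable {G : SimpleGraph (Fin n)} {S : Finset (Fin n)} {u : Fin n}

theorem length_flatMap_ite_le {α : Type} (P : Fin n → Prop) [DecidablePred P] (g : Fin n → List α)
    {B : ℕ} (hB : ∀ i, P i → (g i).length ≤ B) :
    ((List.finRange n).flatMap fun i => if P i then g i else []).length ≤
      (Finset.univ.filter P).card * B := by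
  rw [List.length_flatMap, ← List.sum_toFinset _ (List.nodup_finRange n), List.toFinset_finRange]
  calc _ ≤ ∑ i : Fin n, if P i then B else 0 := Finset.sum_le_sum fun i _ => by
        split_ifs with h
        · exact hB i h
        · simp
    _ = _ := by rw [← Finset.sum_filter, Finset.sum_const, smul_eq_mul]

theorem card_filter_le (S : Finset (Fin n)) (u : Fin n) (P : Fin n → Prop) [DecidablePred P]
    (hP : ∀ i, P i → i ∈ S ∨ i = u) : (Finset.univ.filter P).card ≤ S.card + 1 := by
  refine (Finset.card_le_card (t := insert u S) fun i hi => ?_).trans (Finset.card_insert_le _ _)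
  rw [Finset.mem_insert]
  exact (hP i (Finset.mem_filter.1 hi).2).symm

/-- With `k = S.card` there are `k + 1` choices for each of `c₁`, `c₂` and `f`, and three trees for
each triple, besides one star per centre. Since `k ≥ 1`, `k + 1` may be replaced by `2 * k`, which
gives `32 * k ^ 3`. -/
theorem length_trees_le (hS : S.Nonempty) : (trees G S u).length ≤ 32 * S.card ^ 5 := by
  classical
  have hk : 1 ≤ S.card := hS.card_pos
  set k := S.card with hkdef
  have h1 : ∀ c₁ c₂, (bistarTrees G S u c₁ c₂).length ≤ (k + 1) * 3 := fun c₁ c₂ =>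
    (length_flatMap_ite_le (B := 3) _ _ fun _ _ => by simp).trans
      (Nat.mul_le_mul_right _ (card_filter_le S u _ fun _ h => h))
  have h2 : ∀ c₁, (treesAt G S u c₁).length ≤ (k + 1) * ((k + 1) * 3) + 1 := fun c₁ => by
    rw [treesAt, List.length_cons]
    exact Nat.succ_le_succ ((length_flatMap_ite_le _ _ fun c₂ _ => h1 c₁ c₂).trans
      (Nat.mul_le_mul_right _ (card_filter_le S u _ fun _ h => h.1)))
  have h3 : (trees G S u).length ≤ (k + 1) * ((k + 1) * ((k + 1) * 3) + 1) :=
    (length_flatMap_ite_le _ _ fun c₁ _ => h2 c₁).trans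
      (Nat.mul_le_mul_right _ (card_filter_le S u _ fun _ h => h))
  have h4 : (k + 1) * ((k + 1) * ((k + 1) * 3) + 1) ≤ (2 * k) * ((2 * k) * ((2 * k) * 3) + 2 * k * (2 * k)) := by
    refine Nat.mul_le_mul (by omega) (Nat.add_le_add (Nat.mul_le_mul (by omega)
      (Nat.mul_le_mul_right _ (by omega))) ?_)
    nlinarith
  have h5 : k ^ 3 ≤ k ^ 5 := Nat.pow_le_pow_right hk (by omega)
  nlinarith

theorem starTree_isTreeOn (S : Finset (Fin n)) (c : Fin n) :
    (starTree S c).IsTreeOn S := by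
  refine CodedTree.star_isTreeOn (nodup_leafList _ _ _) (fun v => ?_) fun v hv => ?_
  · rw [nameIn_eq_some, mem_leafList]
    unfold IsLeafOf
    constructor
    · intro hv
      by_cases hcv : c = v
      · exact .inl ⟨hcv, hv⟩
      · exact .inr ⟨hv, Ne.symm hcv, Ne.symm hcv⟩
    · rintro (h | h)
      · exact h.2
      · exact h.1
  · rw [Ne, nameIn_eq_some]
    exact fun h => (mem_leafList.1 hv).2.1 h.1.symm

/-- Equal centres are allowed only if both are the dummy `u`, that is, if both are Steiner nodes. A
vertex of `S` is never used twice. -/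
theorem bistarTree_isTreeOn {c₁ c₂ : Fin n} (hu : u ∉ S) (hc : c₁ ≠ c₂ ∨ c₁ = u)
    (P : Fin n → Prop) : (bistarTree S c₁ c₂ P).IsTreeOn S := by
  refine CodedTree.bistar_isTreeOn (nodup_leafList _ _ _) (fatherOf_le P) (fun v => ?_)
    (fun v hv => ?_) (fun v hv => ?_) fun v hv => ?_
  · rw [nameIn_eq_some, nameIn_eq_some, mem_leafList]
    unfold IsLeafOf
    constructor
    · intro hv
      by_cases h1 : c₁ = v
      · exact .inl ⟨h1, hv⟩
      by_cases h2 : c₂ = v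
      · exact .inr (.inl ⟨h2, hv⟩)
      exact .inr (.inr ⟨hv, Ne.symm h1, Ne.symm h2⟩)
    · rintro (h | h | h)
      · exact h.2
      · exact h.2
      · exact h.1
  · rw [Ne, nameIn_eq_some]
    exact fun h => (mem_leafList.1 hv).2.1 h.1.symm
  · rw [Ne, nameIn_eq_some]
    exact fun h => (mem_leafList.1 hv).2.2 h.1.symm
  · rw [Ne, nameIn_eq_some]
    rw [nameIn_eq_some] at hv
    rintro ⟨rfl, -⟩
    rcases hc with hc | hc
    · exact hc hv.1
    · exact hu (hc ▸ hv.1 ▸ hv.2)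

theorem mem_trees {Y : CodedTree n} : Y ∈ trees G S u ↔ ∃ c₁, (c₁ ∈ S ∨ c₁ = u) ∧
    (Y = starTree S c₁ ∨ ∃ c₂, (c₂ ∈ S ∨ c₂ = u) ∧ (c₁ ≠ c₂ ∨ c₁ = u) ∧ ∃ f, (f ∈ S ∨ f = u) ∧
      (Y = bistarTree S c₁ c₂ (· = f) ∨ Y = bistarTree S c₁ c₂ (Label G S c₁ c₂ True f) ∨
        Y = bistarTree S c₁ c₂ (Label G S c₁ c₂ False f))) := by
  classical
  simp only [trees, treesAt, bistarTrees, List.mem_flatMap, List.mem_finRange, true_and,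
    List.mem_ite_nil_right, List.mem_cons, List.not_mem_nil, or_false, and_assoc]

theorem isTreeOn_of_mem_trees (hu : u ∉ S) {Y : CodedTree n} (hY : Y ∈ trees G S u) :
    Y.IsTreeOn S := by
  rw [mem_trees] at hY
  obtain ⟨c₁, hc₁, rfl | ⟨c₂, hc₂, hc, f, hf, rfl | rfl | rfl⟩⟩ := hY
  · exact starTree_isTreeOn S c₁
  all_goals exact bistarTree_isTreeOn hu hc _

/-! ### Every spanned subtree occurs in the family -/

section Realize

variable {σ : Type} {T : SimpleGraph (Fin n ⊕ σ)}

theorem exists_represented (hu : u ∉ S) {c : Fin n ⊕ σ} (hc : ∀ z, c = Sum.inl z → z ∈ S) :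
    ∃ p, (p ∈ S ∨ p = u) ∧ Represented S p c ∧ nameIn S p = c.getLeft? ∧
      (p = u ∨ c = Sum.inl p) := by
  cases c with
  | inl z =>
    have hz := hc z rfl
    exact ⟨z, .inl hz, fun x _ => by rw [Sum.inl.injEq], by simp [nameIn, hz], .inr rfl⟩
  | inr s =>
    refine ⟨u, .inr rfl, fun x hx => ?_, by simp [nameIn, hu], .inl rfl⟩
    simp only [reduceCtorEq, iff_false]
    exact fun e => hu (e ▸ hx)

theorem BistarData.steinerEquivalent {c₁ c₂ : Fin n ⊕ σ} {p₁ p₂ : Fin n}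
    (h : BistarData G T S c₁ c₂ p₁ p₂) (hn₁ : nameIn S p₁ = c₁.getLeft?)
    (hn₂ : nameIn S p₂ = c₂.getLeft?) {P : Fin n → Prop}
    (hP : ∀ s, IsLeafOf S p₁ p₂ s → (P s ↔ T.Adj c₁ (Sum.inl s))) :
    SteinerEquivalent (spanTree T S) (spanName T S) (bistarTree S p₁ p₂ P).graph
      (bistarTree S p₁ p₂ P).name := by
  unfold bistarTree
  rw [hn₁, hn₂]
  refine h.bistar.steinerEquivalent h.root.1 (nodup_leafList _ _ _) (fun v => ?_) (fatherOf_le P)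
    fun s hs => ?_
  · rw [mem_leafList, h.isLeafOf_iff]
  · rw [fatherOf_eq_zero_iff, hP s (mem_leafList.1 hs)]

/-- The subtree spanned by `S` in a well-structured root is one of the trees in the family. -/
theorem IsCommonNeighborSet.exists_mem_trees {v : Fin n} (h : IsCommonNeighborSet G S u v)
    (hS : G.IsClique (S : Set (Fin n))) (hne : S.Nonempty) (hT : IsWellStructuredRoot G T) :
    ∃ Y ∈ trees G S u, SteinerEquivalent (spanTree T S) (spanName T S) (CodedTree.graph Y)
      (CodedTree.name Y) := by
  have hu : u ∉ S := fun hu => G.irrefl ((h.mem_iff u).1 hu).1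
  have hr := hT.1
  have hw := hT.2 S (h.isCliqueIntersection hS) hne
  rcases h.isStarAt_or_isBistarAt hr hS hne with ⟨c, hc⟩ | ⟨c₁, c₂, hc⟩
  · obtain ⟨p, hp, hrep, hname, -⟩ := exists_represented hu hc.real
    refine ⟨starTree S p, mem_trees.2 ⟨p, hp, .inl rfl⟩, ?_⟩
    unfold starTree
    rw [hname]
    refine hc.steinerEquivalent hr.1 (nodup_leafList _ _ _) fun v => ?_
    rw [mem_leafList]
    refine and_congr_right fun hv => ?_
    rw [and_self]
    exact not_congr (hrep v hv)
  -- Stated for arbitrary centres, because the labelling describes the leaves of the first centre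
  -- and the roles of the two centres may have to be exchanged.
  have key : ∀ {c₁ c₂ : Fin n ⊕ σ} {p₁ p₂ : Fin n}, BistarData G T S c₁ c₂ p₁ p₂ →
      (p₁ ∈ S ∨ p₁ = u) → (p₂ ∈ S ∨ p₂ = u) → (p₁ ≠ p₂ ∨ p₁ = u) →
      nameIn S p₁ = c₁.getLeft? → nameIn S p₂ = c₂.getLeft? →
      (∃ f, (f ∈ S ∨ f = u) ∧ ∃ P : Fin n → Prop, (P = (· = f) ∨
        ∃ β : Prop, P = Label G S p₁ p₂ β f) ∧
        ∀ s, IsLeafOf S p₁ p₂ s → (P s ↔ T.Adj c₁ (Sum.inl s))) →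
      ∃ Y ∈ trees G S u, SteinerEquivalent (spanTree T S) (spanName T S) (CodedTree.graph Y)
        (CodedTree.name Y) := by
    rintro c₁ c₂ p₁ p₂ hd hp₁ hp₂ hp hn₁ hn₂ ⟨f, hf, P, hP, hPs⟩
    refine ⟨_, mem_trees.2 ⟨p₁, hp₁, .inr ⟨p₂, hp₂, hp, f, hf, ?_⟩⟩,
      hd.steinerEquivalent hn₁ hn₂ hPs⟩
    rcases hP with rfl | ⟨β, rfl⟩
    · exact .inl rfl
    · by_cases hβ : β
      · exact .inr (.inl (by rw [eq_true hβ]))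
      · exact .inr (.inr (by rw [eq_false hβ]))
  obtain ⟨p₁, hp₁, hrep₁, hn₁, hpc₁⟩ := exists_represented hu hc.real₁
  obtain ⟨p₂, hp₂, hrep₂, hn₂, hpc₂⟩ := exists_represented hu hc.real₂
  have hd : BistarData G T S c₁ c₂ p₁ p₂ := ⟨hr, hS, hc, hrep₁, hrep₂⟩
  have hp : p₁ ≠ p₂ ∨ p₁ = u := by
    by_contra hno
    push Not at hno
    obtain ⟨rfl, hpu⟩ := hno
    exact hc.adj_centre.ne ((hpc₁.resolve_left hpu).trans (hpc₂.resolve_left hpu).symm)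
  have hp' : p₂ ≠ p₁ ∨ p₂ = u := by
    rcases hp with hp | hp
    · exact .inl hp.symm
    · by_cases e : p₂ = p₁
      · exact .inr (e.trans hp)
      · exact .inl e
  -- Either the first centre has two leaves, or its only leaf `f` describes the partition.
  have one : ∀ {c₁ c₂ : Fin n ⊕ σ} {p₁ p₂ : Fin n}, BistarData G T S c₁ c₂ p₁ p₂ →
      (∃ a a', a ≠ a' ∧ IsLeafOf S p₁ p₂ a ∧ IsLeafOf S p₁ p₂ a' ∧ T.Adj c₁ (Sum.inl a) ∧
        T.Adj c₁ (Sum.inl a')) ∨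
      ∃ f, (f ∈ S ∨ f = u) ∧ ∃ P : Fin n → Prop, (P = (· = f) ∨
        ∃ β : Prop, P = Label G S p₁ p₂ β f) ∧
        ∀ s, IsLeafOf S p₁ p₂ s → (P s ↔ T.Adj c₁ (Sum.inl s)) := by
    intro c₁ c₂ p₁ p₂ hd
    obtain ⟨a, ha, ha2, hadj⟩ := hd.bistar.left
    have hal := hd.isLeafOf_of_left ha hadj ha2
    by_cases hex : ∃ a', a ≠ a' ∧ IsLeafOf S p₁ p₂ a' ∧ T.Adj c₁ (Sum.inl a')
    · obtain ⟨a', hne, hal', hadj'⟩ := hex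
      exact .inl ⟨a, a', hne, hal, hal', hadj, hadj'⟩
    · right
      push Not at hex
      refine ⟨a, .inl ha, (· = a), .inl rfl, fun s hs => ⟨fun e => ?_, fun hs' => ?_⟩⟩
      · subst e
        exact hadj
      · by_contra hne
        exact hex s (Ne.symm hne) hs hs'
  rcases one hd with hA | hA
  swap
  · exact key hd hp₁ hp₂ hp hn₁ hn₂ hA
  rcases one hd.symm with hB | hB
  swap
  · exact key hd.symm hp₂ hp₁ hp' hn₂ hn₁ hB
  -- A splitting vertex sees exactly one side; which one is the bit `β`, and `f` is irrelevant.
  by_cases hsp : ∃ y, Splits G S p₁ p₂ y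
  · refine key hd hp₁ hp₂ hp hn₁ hn₂ ?_
    cases hl : lastSat (Splits G S p₁ p₂) with
    | none => exact absurd hsp.choose_spec (lastSat_eq_none_iff.1 hl _)
    | some y =>
      have hlab : ∀ β s, Label G S p₁ p₂ β u s ↔ (G.Adj y s ↔ β) := by
        intro β s
        unfold Label
        rw [hl]
        simp
      rcases hd.adj_iff_of_splits (lastSat_eq_some hl).1 with hy | hy
      · refine ⟨u, .inr rfl, _, .inr ⟨True, rfl⟩, fun s hs => ?_⟩
        rw [hlab, hy s hs, iff_true]
      · refine ⟨u, .inr rfl, _, .inr ⟨False, rfl⟩, fun s hs => ?_⟩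
        rw [hlab, hy s hs, iff_false, not_not]
  · push Not at hsp
    have hun : UnsplitData G T S c₁ c₂ p₁ p₂ := ⟨hd, hA, by
      simpa only [BistarData.isLeafOf_comm (p₁ := p₂) (p₂ := p₁)] using hB, hsp⟩
    -- The centre with at most one free leaf is made the second one.
    rcases hd.free_subsingleton hw with hfree | hfree
    · obtain ⟨f, β, hf, hlab⟩ := hun.exists_label hu hfree
      exact key hd hp₁ hp₂ hp hn₁ hn₂ ⟨f, hf, _, .inr ⟨β, rfl⟩, hlab⟩
    · obtain ⟨f, β, hf, hlab⟩ := hun.symm.exists_label hu (by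
        intro s s' hs hs' hsf hsf' hn hn'
        rw [BistarData.isLeafOf_comm] at hs hs'
        rw [hd.adj_right_iff hs, not_not] at hn
        rw [hd.adj_right_iff hs', not_not] at hn'
        exact hfree s s' hs hs' hsf hsf' hn hn')
      exact key hd.symm hp₂ hp₁ hp' hn₂ hn₁ ⟨f, hf, _, .inr ⟨β, rfl⟩, hlab⟩

end Realize

end Family

/-! ### Specifications of loop programs -/

theorem iterateUpTo_induction {α : Type*} {n : ℕ} {f : ℕ → α → α} (J : ℕ → α → Prop)
    (hf : ∀ i < n, ∀ a, J i a → J (i + 1) (f i a)) {a : α} (ha : J 0 a) :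
    J n (iterateUpTo f n a) := by
  have key : ∀ k ≤ n, J k (iterateUpTo f k a) := by
    intro k
    induction k with
    | zero => exact fun _ => ha
    | succ k ih => exact fun hk => hf k (by omega) _ (ih (by omega))
  exact key n le_rfl

theorem List.flatMap_filter_eq {α β : Type*} (p : α → Prop) [DecidablePred p] (g : α → List β)
    (l : List α) : (l.filter p).flatMap g = l.flatMap fun a => if p a then g a else [] := by
  induction l with
  | nil => rfl
  | cons a l ih =>
    by_cases h : p a <;> simp [h, ih]

theorem flatMap_finRange_nil {α : Type*} (n : ℕ) :
    (List.finRange n).flatMap (fun _ => ([] : List α)) = [] :=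
  List.flatMap_eq_nil_iff.2 fun _ _ => rfl

namespace LoopExpr

/-- The value of a search for a vertex. -/
def ofOption {n : ℕ} (o : Option (Fin n)) : ℕ := o.elim n Fin.val

def or (a b : LoopExpr) : LoopExpr := .not (.and a.not b.not)

def eq (a b : LoopExpr) : LoopExpr := .and (.not (.lt a b)) (.not (.lt b a))

def iff (a b : LoopExpr) : LoopExpr := eq a.not b.not

def ex (a : LoopExpr) : LoopExpr := .not (.not (.count a))

variable {n : ℕ} {τ : ℕ → ℕ → ℕ → ℕ} {d : ℕ} {ρ : ℕ → ℕ} {a b : LoopExpr}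

theorem eval_or_ne_zero :
    (or a b).eval n τ d ρ ≠ 0 ↔ a.eval n τ d ρ ≠ 0 ∨ b.eval n τ d ρ ≠ 0 := by
  simp only [or, eval]
  split_ifs <;> simp_all

theorem eval_and_ne_zero :
    (and a b).eval n τ d ρ ≠ 0 ↔ a.eval n τ d ρ ≠ 0 ∧ b.eval n τ d ρ ≠ 0 := by
  simp only [eval]
  split_ifs <;> simp_all

theorem eval_not_ne_zero : (not a).eval n τ d ρ ≠ 0 ↔ ¬ a.eval n τ d ρ ≠ 0 := by
  simp only [eval]
  split_ifs <;> simp_all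

theorem eval_lt_ne_zero : (lt a b).eval n τ d ρ ≠ 0 ↔ a.eval n τ d ρ < b.eval n τ d ρ := by
  simp only [eval]
  split_ifs <;> simp_all

theorem eval_eq_ne_zero : (eq a b).eval n τ d ρ ≠ 0 ↔ a.eval n τ d ρ = b.eval n τ d ρ := by
  rw [eq, eval_and_ne_zero, eval_not_ne_zero, eval_not_ne_zero, eval_lt_ne_zero, eval_lt_ne_zero]
  omega

theorem eval_iff_ne_zero :
    (iff a b).eval n τ d ρ ≠ 0 ↔ (a.eval n τ d ρ ≠ 0 ↔ b.eval n τ d ρ ≠ 0) := by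
  rw [iff, eval_eq_ne_zero]
  simp only [eval]
  split_ifs <;> simp_all

open Classical in
theorem eval_count : (count a).eval n τ d ρ =
    (Finset.univ.filter fun i : Fin n => a.eval n τ (d + 1) (Function.update ρ d i) ≠ 0).card := by
  have key := iterateUpTo_induction (n := n) (a := 0)
    (f := fun i c => if a.eval n τ (d + 1) (Function.update ρ d i) ≠ 0 then c + 1 else c)
    (fun k c => c = ((Finset.range k).filter
      fun i => a.eval n τ (d + 1) (Function.update ρ d i) ≠ 0).card) (by
      intro i _ c hc
      rw [Finset.range_add_one, Finset.filter_insert]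
      subst hc
      split_ifs
      · rw [Finset.card_insert_of_notMem (by simp)]
      · rfl) (by simp)
  change iterateUpTo _ n 0 = _
  rw [key]
  refine (Finset.card_bij (fun i _ => i.1) ?_ ?_ ?_).symm
  · intro i hi
    simpa using hi
  · intro i _ j _ h
    exact Fin.ext h
  · intro i hi
    rw [Finset.mem_filter, Finset.mem_range] at hi
    exact ⟨⟨i, hi.1⟩, by simpa using hi.2, rfl⟩

theorem eval_ex_ne_zero : (ex a).eval n τ d ρ ≠ 0 ↔
    ∃ i : Fin n, a.eval n τ (d + 1) (Function.update ρ d i) ≠ 0 := by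
  classical
  rw [ex, eval_not_ne_zero, eval_not_ne_zero, not_not, eval_count, Finset.card_ne_zero]
  simp [Finset.Nonempty]

theorem eval_last : (last a).eval n τ d ρ =
    ofOption (lastSat fun i : Fin n => a.eval n τ (d + 1) (Function.update ρ d i) ≠ 0) := by
  -- After `k` rounds the value is the largest hit below `k`, or the default `n`.
  have key := iterateUpTo_induction (n := n) (a := n)
    (f := fun i c => if a.eval n τ (d + 1) (Function.update ρ d i) ≠ 0 then i else c)
    (fun k c => (c < k ∧ a.eval n τ (d + 1) (Function.update ρ d c) ≠ 0 ∧
        ∀ j < k, c < j → a.eval n τ (d + 1) (Function.update ρ d j) = 0) ∨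
      (c = n ∧ ∀ j < k, a.eval n τ (d + 1) (Function.update ρ d j) = 0)) (by
      intro i _ c hc
      split_ifs with h
      · exact .inl ⟨by omega, h, by omega⟩
      · rw [not_not] at h
        rcases hc with ⟨h1, h2, h3⟩ | ⟨h1, h2⟩
        · refine .inl ⟨by omega, h2, fun j hj hcj => ?_⟩
          rcases Nat.lt_succ_iff_lt_or_eq.1 hj with hj | rfl
          · exact h3 j hj hcj
          · exact h
        · refine .inr ⟨h1, fun j hj => ?_⟩
          rcases Nat.lt_succ_iff_lt_or_eq.1 hj with hj | rfl
          · exact h2 j hj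
          · exact h) (.inr ⟨rfl, by omega⟩)
  change iterateUpTo _ n n = _
  set c := iterateUpTo _ n n
  rcases key with ⟨h1, h2, h3⟩ | ⟨h1, h2⟩
  · have : lastSat (fun i : Fin n => a.eval n τ (d + 1) (Function.update ρ d i) ≠ 0) = some ⟨c, h1⟩ :=
      lastSat_eq_some_iff.2 ⟨h2, fun j hj => not_not.2 (h3 j j.2 hj)⟩
    rw [this]
    rfl
  · rw [lastSat_eq_none_iff.2 fun i => not_not.2 (h2 i i.2)]
    exact h1

theorem eval_tbl {k : ℕ} {i j : Fin n} (ha : a.eval n τ d ρ = i) (hb : b.eval n τ d ρ = j) :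
    (tbl k a b).eval n τ d ρ = τ k i j := by
  simp only [eval, ha, hb]
  rw [if_pos ⟨i.2, j.2⟩]

theorem ofOption_lt_iff {o : Option (Fin n)} : ofOption o < n ↔ o ≠ none := by
  cases o <;> simp [ofOption]

theorem ofOption_injective : Function.Injective (ofOption (n := n)) := by
  intro o o' h
  cases o with
  | none =>
    cases o' with
    | none => rfl
    | some j => exact absurd h (ne_of_gt j.2)
  | some i =>
    cases o' with
    | none => exact absurd h (ne_of_lt i.2)
    | some j => exact congrArg some (Fin.ext h)

end LoopExpr

namespace LoopStmt

/-- Whenever the tables satisfy `I`, the program `p` writes `g` and makes the tables satisfy `J`. -/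
def Produces (n d : ℕ) (ρ : ℕ → ℕ) (p : LoopStmt) (I : (ℕ → ℕ → ℕ → ℕ) → Prop) (g : List ℕ)
    (J : (ℕ → ℕ → ℕ → ℕ) → Prop) : Prop :=
  ∀ D : LoopData, I D.tab → (p.run n d ρ D).out = D.out ++ g ∧ J (p.run n d ρ D).tab

variable {n d : ℕ} {ρ : ℕ → ℕ} {p q : LoopStmt} {I J K : (ℕ → ℕ → ℕ → ℕ) → Prop} {g h : List ℕ}
  {e : LoopExpr}

theorem Produces.weaken (hp : Produces n d ρ p I g J) (hJ : ∀ τ, J τ → K τ) :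
    Produces n d ρ p I g K := fun D hD => ⟨(hp D hD).1, hJ _ (hp D hD).2⟩

theorem Produces.seq (hp : Produces n d ρ p I g J) (hq : Produces n d ρ q J h K) :
    Produces n d ρ (.seq p q) I (g ++ h) K := fun D hD => by
  obtain ⟨h1, h2⟩ := hp D hD
  obtain ⟨h3, h4⟩ := hq _ h2
  exact ⟨by rw [run, h3, h1, List.append_assoc], h4⟩

theorem Produces.emit {x : ℕ} (he : ∀ τ, I τ → e.eval n τ d ρ = x) :
    Produces n d ρ (.emit e) I [x] I := fun D hD => ⟨by simp only [run, he _ hD], hD⟩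

theorem Produces.whn {P : Prop} [Decidable P] (he : ∀ τ, I τ → (e.eval n τ d ρ ≠ 0 ↔ P))
    (hp : P → Produces n d ρ p I g I) :
    Produces n d ρ (.whn e p) I (if P then g else []) I := fun D hD => by
  by_cases h : P
  · rw [run, if_pos ((he _ hD).2 h), if_pos h]
    exact hp h D hD
  · rw [run, if_neg (mt (he _ hD).1 h), if_neg h]
    exact ⟨by simp, hD⟩

theorem Produces.bind {x : ℕ} (he : ∀ τ, I τ → e.eval n τ d ρ = x)
    (hp : Produces n (d + 1) (Function.update ρ d x) p I g J) :
    Produces n d ρ (.bind e p) I g J := fun D hD => by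
  rw [run, he _ hD]
  exact hp D hD

/-- The condition `J` on the tables may depend on the number of completed rounds, so that tables can
be filled step by step. -/
theorem Produces.each_progress {J : ℕ → (ℕ → ℕ → ℕ → ℕ) → Prop} {g : Fin n → List ℕ}
    (hp : ∀ i : Fin n, Produces n (d + 1) (Function.update ρ d i) p (J i) (g i) (J (i + 1))) :
    Produces n d ρ (.each p) (J 0) ((List.finRange n).flatMap g) (J n) := fun D hD => by
  have key := iterateUpTo_induction (n := n) (a := D)
    (f := fun i D => p.run n (d + 1) (Function.update ρ d i) D)
    (fun k D' => D'.out = D.out ++ ((List.finRange n).take k).flatMap g ∧ J k D'.tab) (by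
      intro i hi D' ⟨h1, h2⟩
      obtain ⟨h3, h4⟩ := hp ⟨i, hi⟩ D' h2
      refine ⟨?_, h4⟩
      rw [h3, h1, List.take_add_one, List.getElem?_eq_getElem (by simpa using hi)]
      simp) ⟨by simp, hD⟩
  rw [List.take_of_length_le (by simp)] at key
  exact key

theorem Produces.each {g : Fin n → List ℕ}
    (hp : ∀ i : Fin n, Produces n (d + 1) (Function.update ρ d i) p I (g i) I) :
    Produces n d ρ (.each p) I ((List.finRange n).flatMap g) I :=
  Produces.each_progress (J := fun _ => I) hp

/-- The tables agree, except possibly the `k`-th. -/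
def AgreeOff (k : ℕ) (τ τ' : ℕ → ℕ → ℕ → ℕ) : Prop := ∀ k' ≠ k, τ' k' = τ k'

theorem Produces.store {k : ℕ} {a b : LoopExpr} {i j : Fin n}
    (ha : ∀ τ, I τ → a.eval n τ d ρ = i) (hb : ∀ τ, I τ → b.eval n τ d ρ = j)
    (hJ : ∀ τ τ', I τ → AgreeOff k τ τ' → (∀ x y : Fin n, τ' k x y = if x = i ∧ y = j then
      e.eval n τ d ρ else τ k x y) → J τ') :
    Produces n d ρ (.store k a b e) I [] J := fun D hD => by
  rw [run, ha _ hD, hb _ hD, if_pos ⟨i.2, j.2⟩]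
  refine ⟨by simp, hJ _ _ hD (fun k' hk => ?_) fun x y => ?_⟩
  · funext x y
    dsimp only
    rw [if_neg fun h => hk h.1]
  · dsimp only
    simp only [true_and, Fin.ext_iff]

/-- Fill the diagonal of a table. -/
def fill (k d : ℕ) (e : LoopExpr) : LoopStmt := .each (.store k (.var d) (.var d) e)

/-- Since `I` is insensitive to table `k`, it stays true while the table is being filled, and each
entry is computed from `I` alone. -/
theorem Produces.fill {k : ℕ} (R : Fin n → ℕ → Prop)
    (hI : ∀ τ τ', AgreeOff k τ τ' → I τ → I τ')
    (he : ∀ τ, I τ → ∀ i : Fin n, R i (e.eval n τ (d + 1) (Function.update ρ d i))) :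
    Produces n d ρ (fill k d e) I [] (fun τ => I τ ∧ ∀ i : Fin n, R i (τ k i i)) := by
  have := Produces.each_progress (n := n) (d := d) (ρ := ρ) (p := .store k (.var d) (.var d) e)
    (J := fun m τ => I τ ∧ ∀ i : Fin n, i.1 < m → R i (τ k i i)) (g := fun _ => []) fun i =>
      Produces.store (i := i) (j := i)
        (fun _ _ => by simp [LoopExpr.eval]) (fun _ _ => by simp [LoopExpr.eval])
        (by
          intro τ τ' ⟨h1, h2⟩ hag hst
          refine ⟨hI _ _ hag h1, fun x hx => ?_⟩
          rw [hst]
          split_ifs with hxi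
          · rw [hxi.1]
            exact he τ h1 i
          · refine h2 x (lt_of_le_of_ne (by omega) fun h => hxi ?_)
            rw [and_self]
            exact Fin.ext h)
  intro D hD
  obtain ⟨h1, h2, h3⟩ := this D ⟨hD, by simp⟩
  rw [flatMap_finRange_nil] at h1
  exact ⟨h1, h2, fun i => h3 i i.2⟩

end LoopStmt

/-! ### The program: finding the minimal separators -/

namespace SeparatorProgram

open LoopExpr LoopStmt

/-- The vertex `a` is a common neighbour of `u` and `v`, the variables of level `0` and `1`. -/
def inSep (a : LoopExpr) : LoopExpr := .and (.tbl 0 (.var 0) a) (.tbl 0 (.var 1) a)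

/-- Mark in table `1` the neighbours of marked vertices that are not common neighbours of `u` and
`v`. -/
def markRound : LoopStmt :=
  fill 1 3 (or (.tbl 1 (.var 3) (.var 3)) (.and (.not (inSep (.var 3)))
    (ex (.and (.tbl 1 (.var 4) (.var 4)) (.tbl 0 (.var 4) (.var 3))))))

/-- Mark in table `1` the vertices that are reachable from `u` by a path that avoids the common
neighbours of `u` and `v`. -/
def markReachable : LoopStmt :=
  .seq (fill 1 2 (eq (.var 2) (.var 0)))
    (.each markRound)

/-- Mark in table `2` the pairs of vertices that are separated by their common neighbours. -/
def markPairs : LoopStmt :=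
  .each (.each (.seq markReachable (.store 2 (.var 0) (.var 1) (.not (.tbl 1 (.var 1) (.var 1))))))

variable {n : ℕ} {G : SimpleGraph (Fin n)}

/-- The table `t` is the adjacency matrix of `G`. -/
def IsAdjTable (G : SimpleGraph (Fin n)) (t : ℕ → ℕ → ℕ) : Prop :=
  ∀ x y : Fin n, t x y ≠ 0 ↔ G.Adj x y

/-- The common neighbours of `u` and `v` separate them. -/
def SeparatedPair (G : SimpleGraph (Fin n)) (u v : Fin n) : Prop :=
  ¬ ReachableAvoiding G (commonNbrs G u v) u v

/-- Some walk from `u` to `x` of length at most `k` avoids `S`. -/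
def ReachableWithin (G : SimpleGraph (Fin n)) (S : Finset (Fin n)) (u : Fin n) (k : ℕ) (x : Fin n) :
    Prop := ∃ p : G.Walk u x, p.length ≤ k ∧ ∀ y ∈ p.support, y ∉ S

theorem ReachableWithin.step {S : Finset (Fin n)} {u x : Fin n} {k : ℕ}
    (h : ReachableWithin G S u (k + 1) x) :
    ReachableWithin G S u k x ∨ x ∉ S ∧ ∃ y, ReachableWithin G S u k y ∧ G.Adj y x := by
  obtain ⟨p, h1, h2⟩ := h
  rcases Nat.eq_zero_or_pos p.length with h0 | h0
  · exact .inl ⟨p, by omega, h2⟩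
  · have hn : ¬ p.Nil := by
      rw [← SimpleGraph.Walk.length_eq_zero_iff]
      omega
    refine .inr ⟨h2 x p.end_mem_support, p.penultimate, ⟨p.dropLast, ?_, fun y hy => h2 y ?_⟩,
      p.adj_penultimate hn⟩
    · have := p.length_dropLast_add_one hn
      omega
    · rw [← p.support_dropLast_concat hn]
      simp [hy]

/-- A walk without repeated vertices is shorter than `n`, so `n` rounds of marking suffice. -/
theorem _root_.ReachableAvoiding.reachableWithin {S : Finset (Fin n)} {u x : Fin n}
    (h : ReachableAvoiding G S u x) : ReachableWithin G S u n x := by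
  classical
  obtain ⟨p, hp⟩ := h
  refine ⟨p.bypass, ?_, fun y hy => hp y (p.support_bypass_subset_support hy)⟩
  simpa using p.bypass_isPath.length_lt.le

theorem notMem_commonNbrs_left (u v : Fin n) : u ∉ commonNbrs G u v := fun h =>
  G.irrefl (mem_commonNbrs.1 h).1

theorem notMem_commonNbrs_right (u v : Fin n) : v ∉ commonNbrs G u v := fun h =>
  G.irrefl (mem_commonNbrs.1 h).2

theorem SeparatedPair.isCommonNeighborSet {u v : Fin n} (h : SeparatedPair G u v) :
    IsCommonNeighborSet G (commonNbrs G u v) u v where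
  ne := by
    rintro rfl
    exact h (.refl (notMem_commonNbrs_left u u))
  not_adj hadj := h (.of_adj hadj (notMem_commonNbrs_left u v) (notMem_commonNbrs_right u v))
  mem_iff _ := mem_commonNbrs

theorem eval_inSep {τ : ℕ → ℕ → ℕ → ℕ} {d : ℕ} {ρ : ℕ → ℕ} {a : LoopExpr} {u v x : Fin n}
    (hτ : IsAdjTable G (τ 0)) (hu : ρ 0 = u) (hv : ρ 1 = v) (hx : a.eval n τ d ρ = x) :
    (inSep a).eval n τ d ρ ≠ 0 ↔ x ∈ commonNbrs G u v := by
  have h0 : (var 0).eval n τ d ρ = u := hu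
  have h1 : (var 1).eval n τ d ρ = v := hv
  rw [inSep, eval_and_ne_zero, eval_tbl h0 hx, eval_tbl h1 hx, hτ, hτ, mem_commonNbrs]

/-- Table `2` is being filled by the surrounding loops; its current state `J` is carried through
unchanged. -/
theorem markReachable_produces {ρ : ℕ → ℕ} {u v : Fin n} (hu : ρ 0 = u) (hv : ρ 1 = v)
    {J : (ℕ → ℕ → ℕ) → Prop} :
    Produces n 2 ρ markReachable (fun τ => IsAdjTable G (τ 0) ∧ J (τ 2)) []
      (fun τ => (IsAdjTable G (τ 0) ∧ J (τ 2)) ∧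
        ∀ x : Fin n, τ 1 x x ≠ 0 ↔ ReachableAvoiding G (commonNbrs G u v) u x) := by
  set S := commonNbrs G u v with hS
  set I : (ℕ → ℕ → ℕ → ℕ) → Prop := fun τ => IsAdjTable G (τ 0) ∧ J (τ 2) with hI
  have hIoff : ∀ τ τ', AgreeOff 1 τ τ' → I τ → I τ' := by
    intro τ τ' h hτ
    rw [hI]
    dsimp only
    rw [h 0 (by omega), h 2 (by omega)]
    exact hτ
  have init : Produces n 2 ρ (fill 1 2 (eq (.var 2) (.var 0))) I []
      (fun τ => I τ ∧ ∀ x : Fin n, τ 1 x x ≠ 0 ↔ x = u) := by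
    refine Produces.fill (fun x a => a ≠ 0 ↔ x = u) hIoff fun τ hτ x => ?_
    rw [eval_eq_ne_zero]
    simp [eval, hu, Fin.ext_iff]
  -- A round reads the table that it updates, so marks may spread faster than one edge per round.
  -- Therefore the invariant gives only bounds: everything within `k` steps is marked, and only
  -- reachable vertices are.
  have rounds := Produces.each_progress (n := n) (d := 2) (ρ := ρ) (p := markRound)
    (J := fun k τ => I τ ∧ ∀ x : Fin n, (ReachableWithin G S u k x → τ 1 x x ≠ 0) ∧
      (τ 1 x x ≠ 0 → ReachableAvoiding G S u x)) (g := fun _ => []) (by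
    intro k
    have round := Produces.each_progress (n := n) (d := 3) (ρ := Function.update ρ 2 k)
      (p := .store 1 (.var 3) (.var 3) (or (.tbl 1 (.var 3) (.var 3)) (.and (.not (inSep (.var 3)))
        (ex (.and (.tbl 1 (.var 4) (.var 4)) (.tbl 0 (.var 4) (.var 3)))))))
      (J := fun m τ => I τ ∧ ∀ x : Fin n, (ReachableWithin G S u k x → τ 1 x x ≠ 0) ∧
        (x.1 < m → ReachableWithin G S u (k + 1) x → τ 1 x x ≠ 0) ∧
        (τ 1 x x ≠ 0 → ReachableAvoiding G S u x)) (g := fun _ => []) (by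
      intro y
      refine Produces.store (i := y) (j := y) (fun _ _ => by simp [eval]) (fun _ _ => by simp [eval])
        ?_
      intro τ τ' ⟨h1, h2⟩ hag hst
      refine ⟨hIoff _ _ hag h1, ?_⟩
      have hval : τ' 1 y y ≠ 0 ↔ τ 1 y y ≠ 0 ∨ (y ∉ S ∧ ∃ x : Fin n, τ 1 x x ≠ 0 ∧ G.Adj x y) := by
        rw [hst, if_pos ⟨rfl, rfl⟩, eval_or_ne_zero, eval_and_ne_zero, eval_not_ne_zero,
          eval_inSep (u := u) (v := v) (x := y) h1.1 (by simpa using hu) (by simpa using hv)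
            (by simp [eval]), eval_ex_ne_zero,
          eval_tbl (i := y) (j := y) (by simp [eval]) (by simp [eval])]
        refine or_congr_right (and_congr_right fun _ => exists_congr fun x => ?_)
        rw [eval_and_ne_zero, eval_tbl (i := x) (j := x) (by simp [eval]) (by simp [eval]),
          eval_tbl (i := x) (j := y) (by simp [eval]) (by simp [eval]), h1.1]
      intro x
      by_cases hxy : x = y
      · subst hxy
        rw [hval]
        refine ⟨fun h => .inl ((h2 x).1 h), fun _ h => ?_, ?_⟩
        · rcases h.step with h | ⟨hx, z, hz, hzx⟩
          · exact .inl ((h2 x).1 h)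
          · exact .inr ⟨hx, z, (h2 z).1 hz, hzx⟩
        · rintro (h | ⟨hx, z, hz, hzx⟩)
          · exact (h2 x).2.2 h
          · have hz := (h2 z).2.2 hz
            exact hz.trans (.of_adj hzx hz.right_notMem hx)
      · rw [hst, if_neg fun h => hxy h.1]
        refine ⟨(h2 x).1, fun hx => (h2 x).2.1 ?_, (h2 x).2.2⟩
        exact lt_of_le_of_ne (by omega) fun h => hxy (Fin.ext h))
    intro D ⟨h1, h2⟩
    obtain ⟨h3, h4, h5⟩ := round D ⟨h1, fun x => ⟨(h2 x).1, by simp, (h2 x).2⟩⟩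
    exact ⟨by rw [flatMap_finRange_nil] at h3; exact h3, h4,
      fun x => ⟨(h5 x).2.1 x.2, (h5 x).2.2⟩⟩)
  intro D hD
  obtain ⟨h1, h2, h3⟩ := init D hD
  obtain ⟨h4, h5, h6⟩ := rounds _ ⟨h2, fun x => ⟨fun ⟨p, hp, _⟩ => (h3 x).2
    (SimpleGraph.Walk.eq_of_length_eq_zero (Nat.le_zero.1 hp)).symm, fun h => by
      rw [(h3 x).1 h]
      exact .refl (notMem_commonNbrs_left u v)⟩⟩
  rw [flatMap_finRange_nil, List.append_nil, h1, List.append_nil] at h4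
  refine ⟨by rw [List.append_nil]; exact h4, h5, fun x => ⟨(h6 x).2, fun h => (h6 x).1 h.reachableWithin⟩⟩

theorem markPairs_produces (ρ : ℕ → ℕ) :
    Produces n 0 ρ markPairs (fun τ => IsAdjTable G (τ 0)) []
      (fun τ => IsAdjTable G (τ 0) ∧ ∀ u v : Fin n, τ 2 u v ≠ 0 ↔ SeparatedPair G u v) := by
  have outer := Produces.each_progress (n := n) (d := 0) (ρ := ρ)
    (p := .each (.seq markReachable (.store 2 (.var 0) (.var 1) (.not (.tbl 1 (.var 1) (.var 1))))))
    (J := fun k τ => IsAdjTable G (τ 0) ∧ ∀ u v : Fin n, u.1 < k → (τ 2 u v ≠ 0 ↔ SeparatedPair G u v))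
    (g := fun _ => []) (by
    intro u
    -- The pairs are treated in lexicographic order, and those before the current one are correct.
    have inner := Produces.each_progress (n := n) (d := 1) (ρ := Function.update ρ 0 u)
      (p := .seq markReachable (.store 2 (.var 0) (.var 1) (.not (.tbl 1 (.var 1) (.var 1)))))
      (J := fun k τ => IsAdjTable G (τ 0) ∧ ∀ u' v : Fin n, (u'.1 < u ∨ u' = u ∧ v.1 < k) →
        (τ 2 u' v ≠ 0 ↔ SeparatedPair G u' v)) (g := fun _ => []) (by
      intro v
      refine Produces.seq (markReachable_produces (u := u) (v := v) (by simp) (by simp) (J := fun t =>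
        ∀ u' v' : Fin n, (u'.1 < u ∨ u' = u ∧ v'.1 < v) → (t u' v' ≠ 0 ↔ SeparatedPair G u' v'))) ?_
      refine Produces.store (i := u) (j := v) (fun _ _ => by simp [eval]) (fun _ _ => by simp [eval])
        ?_
      intro τ τ' ⟨⟨h1, h2⟩, h3⟩ hag hst
      refine ⟨by rw [hag 0 (by omega)]; exact h1, fun u' v' huv => ?_⟩
      rw [hst]
      split_ifs with he
      · rw [eval_not_ne_zero, eval_tbl (i := v) (j := v) (by simp [eval]) (by simp [eval]), h3, he.1,
          he.2]
        rfl
      · refine h2 u' v' ?_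
        rcases huv with h | ⟨rfl, h⟩
        · exact .inl h
        · exact .inr ⟨rfl, lt_of_le_of_ne (by omega) fun h => he ⟨rfl, Fin.ext h⟩⟩)
    intro D ⟨h1, h2⟩
    obtain ⟨h3, h4, h5⟩ := inner D ⟨h1, fun u' v h => h2 u' v (h.resolve_right (by simp))⟩
    rw [flatMap_finRange_nil] at h3
    exact ⟨h3, h4, fun u' v h => h5 u' v (by
      rcases Nat.lt_succ_iff_lt_or_eq.1 h with h | h
      · exact .inl h
      · exact .inr ⟨Fin.ext h, v.2⟩)⟩)
  intro D hD
  obtain ⟨h1, h2, h3⟩ := outer D ⟨hD, by simp⟩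
  rw [flatMap_finRange_nil] at h1
  exact ⟨h1, h2, fun u v => h3 u v u.2⟩

end SeparatorProgram

/-! ### The program: tables for a separator -/

namespace SeparatorProgram

open LoopExpr LoopStmt

/-- The pair of variables of level `0` and `1` is the first one that is separated by its set of
common neighbours. -/
def isFirstPair : LoopExpr :=
  .and (.tbl 2 (.var 0) (.var 1)) (.not (ex (ex (.and
    (.and (or (.lt (.var 2) (.var 0)) (.and (eq (.var 2) (.var 0)) (.lt (.var 3) (.var 1))))
      (.tbl 2 (.var 2) (.var 3)))
    (.not (ex (.not (iff (inSep (.var 4))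
      (.and (.tbl 0 (.var 2) (.var 4)) (.tbl 0 (.var 3) (.var 4)))))))))))

/-- `s` is in the separator, but neither `a` nor `b`. -/
def isLeaf (a b s : LoopExpr) : LoopExpr := .and (inSep s) (.and (.not (eq s a)) (.not (eq s b)))

def isCentre (a : LoopExpr) : LoopExpr := or (inSep a) (eq a (.var 0))

def isDeficient (y : LoopExpr) : LoopExpr := .tbl 3 y y

def witnessOf (s : LoopExpr) : LoopExpr := .tbl 5 s s

/-- Fill table `3` with the deficient vertices, table `4` with the names of nodes, and table `5` with
the witnesses. -/
def prepare : LoopStmt :=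
  .seq (fill 3 2 (ex (.and (inSep (.var 3)) (.and (.not (eq (.var 3) (.var 2)))
    (.not (.tbl 0 (.var 2) (.var 3)))))))
  (.seq (fill 4 2 (.count (.and (inSep (.var 2)) (.not (.lt (.var 2) (.var 3))))))
  (fill 5 2 (.last (.and (.and (.not (inSep (.var 3))) (.not (isDeficient (.var 3))))
    (ex (.and (isDeficient (.var 4)) (.and (.tbl 0 (.var 4) (.var 2)) (.tbl 0 (.var 4) (.var 3)))))))))

/-- The last vertex that splits the leaves for the centres `2` and `3`. -/
def splitter : LoopExpr :=
  .last (.and (isDeficient (.var 4)) (.lt (.lit 1) (.count (.and (isLeaf (.var 2) (.var 3) (.var 5))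
    (.tbl 0 (.var 4) (.var 5))))))

def referenceLeaf : LoopExpr :=
  .last (.and (isLeaf (.var 2) (.var 3) (.var 5)) (.lt (witnessOf (.var 5)) .size))

/-- The leaf `6` is pinned to `c`. -/
def isPinned (c : LoopExpr) : LoopExpr :=
  .and (inSep c) (ex (.and (isDeficient (.var 7)) (.and (.tbl 0 (.var 7) (.var 6)) (.tbl 0 (.var 7) c))))

def isAligned : LoopExpr :=
  .and (.lt (.var 5) .size) (.and (.lt (witnessOf (.var 6)) .size)
    (or (eq (witnessOf (.var 6)) (witnessOf (.var 5)))
      (.tbl 0 (witnessOf (.var 6)) (witnessOf (.var 5)))))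

/-- The side of the leaf `6` is determined by the choice of a distinguished leaf. -/
def isLoose : LoopExpr :=
  .and (.not (.lt (.var 4) .size)) (.and (.not (isPinned (.var 2))) (.and (.not (isPinned (.var 3)))
    (.not (.lt (witnessOf (.var 6)) .size))))

/-- The leaf `6` is attached to the centre `2` in all trees for the parameter `b`. -/
def isFixed (b : LoopExpr) : LoopExpr :=
  or (.and (.lt (.var 4) .size) (iff (.tbl 0 (.var 4) (.var 6)) b))
    (.and (.not (.lt (.var 4) .size)) (or (isPinned (.var 2)) (.and (.not (isPinned (.var 3)))
      (.and (.lt (witnessOf (.var 6)) .size) (iff isAligned b)))))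

/-- Labels are tabulated before the loop over `f`: the search inside `isPinned`, performed for every
`f` and every leaf, would be a seventh nested loop. -/
def prepareSides : LoopStmt :=
  .seq (fill 6 6 isLoose) (.seq (fill 7 6 (isFixed (.lit 1))) (fill 8 6 (isFixed (.lit 0))))

variable {n : ℕ} {G : SimpleGraph (Fin n)}

/-- No smaller pair is separated by the same set of common neighbours. -/
def FirstPair (G : SimpleGraph (Fin n)) (u v : Fin n) : Prop :=
  SeparatedPair G u v ∧ ¬ ∃ u' v', (u' < u ∨ u' = u ∧ v' < v) ∧ SeparatedPair G u' v' ∧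
    commonNbrs G u' v' = commonNbrs G u v

def nameCode (o : Option (Fin n)) : ℕ := o.elim 0 (· + 1)

/-- The tables that do not depend on the separator. -/
def GlobalTables (G : SimpleGraph (Fin n)) (τ : ℕ → ℕ → ℕ → ℕ) : Prop :=
  IsAdjTable G (τ 0) ∧ ∀ u v : Fin n, τ 2 u v ≠ 0 ↔ SeparatedPair G u v

/-- The tables for the separator `S`. -/
def SeparatorTables (G : SimpleGraph (Fin n)) (S : Finset (Fin n)) (τ : ℕ → ℕ → ℕ → ℕ) : Prop :=
  ((GlobalTables G τ ∧ ∀ y : Fin n, τ 3 y y ≠ 0 ↔ Deficient G S y) ∧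
    ∀ x : Fin n, τ 4 x x = nameCode (nameIn S x)) ∧ ∀ s : Fin n, τ 5 s s = ofOption (witness G S s)

def Loose (G : SimpleGraph (Fin n)) (S : Finset (Fin n)) (c₁ c₂ s : Fin n) : Prop :=
  lastSat (Splits G S c₁ c₂) = none ∧ ¬ Pinned G S s c₁ ∧ ¬ Pinned G S s c₂ ∧ witness G S s = none

def Fixed (G : SimpleGraph (Fin n)) (S : Finset (Fin n)) (c₁ c₂ : Fin n) (β : Prop) (s : Fin n) :
    Prop :=
  (∃ y, lastSat (Splits G S c₁ c₂) = some y ∧ (G.Adj y s ↔ β)) ∨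
  (lastSat (Splits G S c₁ c₂) = none ∧
    (Pinned G S s c₁ ∨ (¬ Pinned G S s c₂ ∧ witness G S s ≠ none ∧ (AlignedWith G S c₁ c₂ s ↔ β))))

/-- Separates the dependence on `f`: it concerns loose leaves only, and everything else depends on
the centres and the bit alone. -/
theorem label_iff {S : Finset (Fin n)} {c₁ c₂ : Fin n} {β : Prop} {f s : Fin n} :
    Label G S c₁ c₂ β f s ↔ Fixed G S c₁ c₂ β s ∨ (Loose G S c₁ c₂ s ∧ s ≠ f) := by
  unfold Label Fixed Loose
  generalize (∃ y, lastSat (Splits G S c₁ c₂) = some y ∧ (G.Adj y s ↔ β)) = a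
  generalize (lastSat (Splits G S c₁ c₂) = none) = b
  generalize (AlignedWith G S c₁ c₂ s ↔ β) = c
  rw [ne_eq]
  generalize (witness G S s = none) = e
  by_cases h : Pinned G S s c₁ <;> by_cases h' : Pinned G S s c₂ <;> by_cases he : e <;>
    simp [h, h', he, or_and_left]

/-- The tables for the separator `S` and the pair of centres `c₁`, `c₂`. -/
def CentreTables (G : SimpleGraph (Fin n)) (S : Finset (Fin n)) (c₁ c₂ : Fin n)
    (τ : ℕ → ℕ → ℕ → ℕ) : Prop :=
  ((SeparatorTables G S τ ∧ ∀ s : Fin n, τ 6 s s ≠ 0 ↔ Loose G S c₁ c₂ s) ∧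
    ∀ s : Fin n, τ 7 s s ≠ 0 ↔ Fixed G S c₁ c₂ True s) ∧
    ∀ s : Fin n, τ 8 s s ≠ 0 ↔ Fixed G S c₁ c₂ False s

theorem GlobalTables.agreeOff {τ τ' : ℕ → ℕ → ℕ → ℕ} {k : ℕ} (h : GlobalTables G τ)
    (hag : AgreeOff k τ τ') (hk : 3 ≤ k) : GlobalTables G τ' := by
  unfold GlobalTables
  rw [hag 0 (by omega), hag 2 (by omega)]
  exact h

theorem SeparatorTables.agreeOff {S : Finset (Fin n)} {τ τ' : ℕ → ℕ → ℕ → ℕ} {k : ℕ}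
    (h : SeparatorTables G S τ) (hag : AgreeOff k τ τ') (hk : 6 ≤ k) : SeparatorTables G S τ' := by
  unfold SeparatorTables
  rw [hag 3 (by omega), hag 4 (by omega), hag 5 (by omega)]
  exact ⟨⟨⟨h.1.1.1.agreeOff hag (by omega), h.1.1.2⟩, h.1.2⟩, h.2⟩

section Eval

variable {τ : ℕ → ℕ → ℕ → ℕ} {d : ℕ} {ρ : ℕ → ℕ} {u v : Fin n}

theorem eval_isFirstPair (hτ : GlobalTables G τ) (hu : ρ 0 = u) (hv : ρ 1 = v) :
    isFirstPair.eval n τ 2 ρ ≠ 0 ↔ FirstPair G u v := by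
  unfold isFirstPair FirstPair
  rw [eval_and_ne_zero, eval_tbl (i := u) (j := v) (by simpa [eval] using hu)
    (by simpa [eval] using hv), hτ.2, eval_not_ne_zero, eval_ex_ne_zero]
  refine and_congr_right fun _ => not_congr (exists_congr fun u' => ?_)
  rw [eval_ex_ne_zero]
  refine exists_congr fun v' => ?_
  rw [eval_and_ne_zero, eval_and_ne_zero, eval_or_ne_zero, eval_lt_ne_zero, eval_and_ne_zero,
    eval_eq_ne_zero, eval_lt_ne_zero, eval_tbl (i := u') (j := v') (by simp [eval])
    (by simp [eval]), hτ.2, eval_not_ne_zero, eval_ex_ne_zero, and_assoc]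
  refine and_congr ?_ (and_congr_right fun _ => ?_)
  · simp [eval, hu, hv, Fin.ext_iff]
  · rw [not_exists, Finset.ext_iff]
    refine forall_congr' fun x => ?_
    rw [eval_not_ne_zero, not_not, eval_iff_ne_zero, eval_inSep (u := u) (v := v) (x := x) hτ.1
      (by simpa using hu) (by simpa using hv) (by simp [eval]), eval_and_ne_zero,
      eval_tbl (i := u') (j := x) (by simp [eval]) (by simp [eval]),
      eval_tbl (i := v') (j := x) (by simp [eval]) (by simp [eval]), hτ.1, hτ.1,
      mem_commonNbrs (u := u')]
    exact iff_comm

theorem eval_isLeaf {a b s : LoopExpr} {c₁ c₂ x : Fin n} (hτ : IsAdjTable G (τ 0)) (hu : ρ 0 = u)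
    (hv : ρ 1 = v) (ha : a.eval n τ d ρ = c₁) (hb : b.eval n τ d ρ = c₂) (hs : s.eval n τ d ρ = x) :
    (isLeaf a b s).eval n τ d ρ ≠ 0 ↔ IsLeafOf (commonNbrs G u v) c₁ c₂ x := by
  unfold isLeaf IsLeafOf
  rw [eval_and_ne_zero, eval_and_ne_zero, eval_not_ne_zero, eval_not_ne_zero, eval_eq_ne_zero,
    eval_eq_ne_zero, eval_inSep hτ hu hv hs, ha, hb, hs]
  simp only [Fin.ext_iff, ne_eq]

theorem eval_isCentre {a : LoopExpr} {c : Fin n} (hτ : IsAdjTable G (τ 0)) (hu : ρ 0 = u)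
    (hv : ρ 1 = v) (ha : a.eval n τ d ρ = c) :
    (isCentre a).eval n τ d ρ ≠ 0 ↔ c ∈ commonNbrs G u v ∨ c = u := by
  unfold isCentre
  rw [eval_or_ne_zero, eval_eq_ne_zero, eval_inSep hτ hu hv ha, ha, Fin.ext_iff]
  simp only [eval, hu]

end Eval

theorem prepare_produces {ρ : ℕ → ℕ} {u v : Fin n} (hu : ρ 0 = u) (hv : ρ 1 = v) :
    Produces n 2 ρ prepare (GlobalTables G) [] (SeparatorTables G (commonNbrs G u v)) := by
  set S := commonNbrs G u v with hS
  refine Produces.seq (J := fun τ => GlobalTables G τ ∧ ∀ y : Fin n, τ 3 y y ≠ 0 ↔ Deficient G S y)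
    (h := []) (g := []) ?_ (Produces.seq (h := []) (g := []) (J := fun τ => (GlobalTables G τ ∧
      ∀ y : Fin n, τ 3 y y ≠ 0 ↔ Deficient G S y) ∧ ∀ x : Fin n, τ 4 x x = nameCode (nameIn S x)) ?_ ?_)
  · refine Produces.fill (fun y a => a ≠ 0 ↔ Deficient G S y)
      (fun τ τ' hag h => h.agreeOff hag (by omega)) fun τ hτ y => ?_
    rw [eval_ex_ne_zero]
    refine exists_congr fun s => ?_
    rw [eval_and_ne_zero, eval_inSep (u := u) (v := v) (x := s) hτ.1
      (by simpa using hu) (by simpa using hv) (by simp [eval]), eval_and_ne_zero, eval_not_ne_zero,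
      eval_eq_ne_zero, eval_not_ne_zero, eval_tbl (i := y) (j := s) (by simp [eval])
      (by simp [eval]), hτ.1]
    simp [eval, Fin.ext_iff, hS]
  -- The count of the `i ≤ x` is `x + 1` if `x` is in the separator, and `0` otherwise, which is the
  -- word written for the node.
  · refine Produces.fill (fun x a => a = nameCode (nameIn S x)) (fun τ τ' hag h =>
      ⟨h.1.agreeOff hag (by omega), by rw [hag 3 (by omega)]; exact h.2⟩) fun τ hτ x => ?_
    rw [eval_count]
    have hcond : ∀ i : Fin n, (LoopExpr.and (inSep (.var 2)) (.not (.lt (.var 2) (.var 3)))).eval n τ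
        (2 + 1 + 1) (Function.update (Function.update ρ 2 x) (2 + 1) i) ≠ 0 ↔ x ∈ S ∧ i ≤ x := by
      intro i
      rw [eval_and_ne_zero, eval_inSep (u := u) (v := v) (x := x) hτ.1.1
        (by simpa using hu) (by simpa using hv) (by simp [eval]), eval_not_ne_zero, eval_lt_ne_zero]
      simp [eval, hS]
    simp only [hcond]
    by_cases hx : x ∈ S
    · have : (Finset.univ.filter fun i : Fin n => x ∈ S ∧ i ≤ x) = Finset.Iic x := by
        ext i
        simp [hx]
      rw [this, Fin.card_Iic]
      simp [nameCode, nameIn, hx]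
    · simp [nameCode, nameIn, hx]
  · refine Produces.fill (fun s a => a = ofOption (witness G S s)) (fun τ τ' hag h =>
      ⟨⟨h.1.1.agreeOff hag (by omega), by rw [hag 3 (by omega)]; exact h.1.2⟩,
        by rw [hag 4 (by omega)]; exact h.2⟩) fun τ hτ s => ?_
    rw [eval_last]
    refine congrArg (fun P => ofOption (lastSat P)) (funext fun x => propext ?_)
    rw [eval_and_ne_zero, eval_and_ne_zero, eval_not_ne_zero, eval_not_ne_zero, eval_ex_ne_zero,
      eval_inSep (u := u) (v := v) (x := x) hτ.1.1.1
      (by simpa using hu) (by simpa using hv) (by simp [eval]), isDeficient,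
      eval_tbl (i := x) (j := x) (by simp [eval]) (by simp [eval]), hτ.1.2, and_assoc]
    refine and_congr_right fun _ => and_congr_right fun _ => exists_congr fun y => ?_
    rw [eval_and_ne_zero, eval_and_ne_zero, isDeficient,
      eval_tbl (i := y) (j := y) (by simp [eval]) (by simp [eval]), hτ.1.2,
      eval_tbl (i := y) (j := s) (by simp [eval]) (by simp [eval]),
      eval_tbl (i := y) (j := x) (by simp [eval]) (by simp [eval]), hτ.1.1.1, hτ.1.1.1]

theorem eval_splitter {τ : ℕ → ℕ → ℕ → ℕ} {ρ : ℕ → ℕ} {u v c₁ c₂ : Fin n}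
    (hτ : SeparatorTables G (commonNbrs G u v) τ) (hu : ρ 0 = u) (hv : ρ 1 = v) (h₁ : ρ 2 = c₁)
    (h₂ : ρ 3 = c₂) :
    splitter.eval n τ 4 ρ = ofOption (lastSat (Splits G (commonNbrs G u v) c₁ c₂)) := by
  classical
  unfold splitter
  rw [eval_last]
  refine congrArg (fun P => ofOption (lastSat P)) (funext fun y => propext ?_)
  unfold Splits
  rw [eval_and_ne_zero, isDeficient, eval_tbl (i := y) (j := y) (by simp [eval]) (by simp [eval]),
    hτ.1.1.2, eval_lt_ne_zero, eval_count, Set.ncard_eq_toFinset_card']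
  refine and_congr_right fun _ => ?_
  rw [show (lit 1).eval n τ (4 + 1) (Function.update ρ 4 y) = 1 from rfl]
  refine iff_of_eq (congrArg (1 < ·) (congrArg Finset.card ?_))
  ext b
  rw [Finset.mem_filter, Set.mem_toFinset, eval_and_ne_zero,
    eval_isLeaf (u := u) (v := v) (c₁ := c₁) (c₂ := c₂) (x := b) hτ.1.1.1.1 (by simpa using hu)
      (by simpa using hv) (by simpa [eval] using h₁) (by simpa [eval] using h₂) (by simp [eval]),
    eval_tbl (i := y) (j := b) (by simp [eval]) (by simp [eval]), hτ.1.1.1.1]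
  simp

theorem eval_witnessOf {τ : ℕ → ℕ → ℕ → ℕ} {d : ℕ} {ρ : ℕ → ℕ} {S : Finset (Fin n)}
    (hτ : SeparatorTables G S τ) {a : LoopExpr} {s : Fin n} (ha : a.eval n τ d ρ = s) :
    (witnessOf a).eval n τ d ρ = ofOption (witness G S s) := by
  rw [witnessOf, eval_tbl ha ha, hτ.2]

theorem eval_referenceLeaf {τ : ℕ → ℕ → ℕ → ℕ} {ρ : ℕ → ℕ} {u v c₁ c₂ : Fin n}
    (hτ : SeparatorTables G (commonNbrs G u v) τ) (hu : ρ 0 = u) (hv : ρ 1 = v) (h₁ : ρ 2 = c₁)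
    (h₂ : ρ 3 = c₂) :
    referenceLeaf.eval n τ 5 ρ = ofOption (reference G (commonNbrs G u v) c₁ c₂) := by
  unfold referenceLeaf
  rw [eval_last]
  refine congrArg (fun P => ofOption (lastSat P)) (funext fun s => propext ?_)
  rw [eval_and_ne_zero,
    eval_isLeaf (u := u) (v := v) (c₁ := c₁) (c₂ := c₂) (x := s) hτ.1.1.1.1 (by simpa using hu)
      (by simpa using hv) (by simpa [eval] using h₁) (by simpa [eval] using h₂) (by simp [eval]),
    eval_lt_ne_zero, eval_witnessOf hτ (s := s) (by simp [eval])]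
  exact and_congr_right fun _ => ofOption_lt_iff

/-- Level `7` is excluded for the centre, because the inner search binds it. -/
theorem eval_isPinned {τ : ℕ → ℕ → ℕ → ℕ} {ρ : ℕ → ℕ} {u v c s : Fin n} {k : ℕ}
    (hτ : SeparatorTables G (commonNbrs G u v) τ) (hu : ρ 0 = u) (hv : ρ 1 = v) (hk : k ≠ 7)
    (hc : ρ k = c) (hs : ρ 6 = s) :
    (isPinned (.var k)).eval n τ 7 ρ ≠ 0 ↔ Pinned G (commonNbrs G u v) s c := by
  unfold isPinned Pinned
  rw [eval_and_ne_zero, eval_inSep (x := c) hτ.1.1.1.1 hu hv (by simpa [eval] using hc),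
    eval_ex_ne_zero]
  refine and_congr_right fun _ => exists_congr fun y => ?_
  rw [eval_and_ne_zero, eval_and_ne_zero, isDeficient,
    eval_tbl (i := y) (j := y) (by simp [eval]) (by simp [eval]), hτ.1.1.2,
    eval_tbl (i := y) (j := s) (by simp [eval]) (by simpa [eval] using hs),
    eval_tbl (i := y) (j := c) (by simp [eval]) (by simpa [eval, Function.update_of_ne hk] using hc),
    hτ.1.1.1.1, hτ.1.1.1.1]

theorem eval_isAligned {τ : ℕ → ℕ → ℕ → ℕ} {ρ : ℕ → ℕ} {S : Finset (Fin n)} {c₁ c₂ s : Fin n}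
    (hτ : SeparatorTables G S τ) (hr : ρ 5 = ofOption (reference G S c₁ c₂)) (hs : ρ 6 = s) :
    isAligned.eval n τ 7 ρ ≠ 0 ↔ AlignedWith G S c₁ c₂ s := by
  unfold isAligned AlignedWith
  have hws := eval_witnessOf (d := 7) (ρ := ρ) hτ (a := .var 6) (s := s) hs
  rw [eval_and_ne_zero, eval_and_ne_zero, eval_or_ne_zero, eval_eq_ne_zero, eval_lt_ne_zero,
    eval_lt_ne_zero, hws]
  simp only [show (LoopExpr.var 5).eval n τ 7 ρ = ofOption (reference G S c₁ c₂) from hr,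
    show LoopExpr.size.eval n τ 7 ρ = n from rfl, ofOption_lt_iff]
  cases href : reference G S c₁ c₂ with
  | none => simp
  | some r =>
    have hwr := eval_witnessOf (d := 7) (ρ := ρ) hτ (a := .var 5) (s := r) (by
      rw [href] at hr
      exact hr)
    rw [hwr]
    -- The reference leaf was chosen among the leaves that have a witness.
    obtain ⟨y, hy⟩ := Option.ne_none_iff_exists'.1 (lastSat_eq_some href).1.2
    rw [hy] at hwr ⊢
    cases hx : witness G S s with
    | none => simp
    | some x =>
      rw [hx] at hws
      rw [eval_tbl (i := x) (j := y) hws hwr, hτ.1.1.1.1, ofOption_injective.eq_iff]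
      simp [hy]

theorem prepareSides_produces {ρ : ℕ → ℕ} {u v c₁ c₂ : Fin n} (hu : ρ 0 = u) (hv : ρ 1 = v)
    (h₁ : ρ 2 = c₁) (h₂ : ρ 3 = c₂)
    (hy : ρ 4 = ofOption (lastSat (Splits G (commonNbrs G u v) c₁ c₂)))
    (hr : ρ 5 = ofOption (reference G (commonNbrs G u v) c₁ c₂)) :
    Produces n 6 ρ prepareSides (SeparatorTables G (commonNbrs G u v)) []
      (CentreTables G (commonNbrs G u v) c₁ c₂) := by
  set S := commonNbrs G u v with hS
  have hsplit : ∀ (τ : ℕ → ℕ → ℕ → ℕ) (s : Fin n), (LoopExpr.lt (.var 4) .size).eval n τ 7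
      (Function.update ρ 6 s) ≠ 0 ↔ lastSat (Splits G S c₁ c₂) ≠ none := fun τ s => by
    rw [eval_lt_ne_zero, ← ofOption_lt_iff]
    simp [eval, hy]
  have hwit : ∀ (τ : ℕ → ℕ → ℕ → ℕ) (s : Fin n), SeparatorTables G S τ →
      ((LoopExpr.lt (witnessOf (.var 6)) .size).eval n τ 7 (Function.update ρ 6 s) ≠ 0 ↔
        witness G S s ≠ none) := fun τ s hτ => by
    rw [eval_lt_ne_zero, ← ofOption_lt_iff, eval_witnessOf hτ (s := s) (by simp [eval])]
    rfl
  have hpin : ∀ (τ : ℕ → ℕ → ℕ → ℕ) (s : Fin n), SeparatorTables G S τ →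
      ((isPinned (.var 2)).eval n τ 7 (Function.update ρ 6 s) ≠ 0 ↔ Pinned G S s c₁) ∧
      ((isPinned (.var 3)).eval n τ 7 (Function.update ρ 6 s) ≠ 0 ↔ Pinned G S s c₂) :=
    fun τ s hτ => ⟨eval_isPinned hτ (by simpa using hu) (by simpa using hv) (by omega)
      (by simpa using h₁) (by simp), eval_isPinned hτ (by simpa using hu) (by simpa using hv)
        (by omega) (by simpa using h₂) (by simp)⟩
  have hfixed : ∀ (τ : ℕ → ℕ → ℕ → ℕ) (s : Fin n) (b : LoopExpr) (β : Prop), SeparatorTables G S τ →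
      (b.eval n τ 7 (Function.update ρ 6 s) ≠ 0 ↔ β) →
      ((isFixed b).eval n τ 7 (Function.update ρ 6 s) ≠ 0 ↔ Fixed G S c₁ c₂ β s) := by
    intro τ s b β hτ hb
    unfold isFixed Fixed
    rw [eval_or_ne_zero, eval_and_ne_zero, eval_and_ne_zero, eval_not_ne_zero, hsplit, not_not,
      eval_iff_ne_zero, hb, eval_or_ne_zero, (hpin τ s hτ).1, eval_and_ne_zero, eval_not_ne_zero,
      (hpin τ s hτ).2, eval_and_ne_zero, hwit τ s hτ, eval_iff_ne_zero, hb,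
      eval_isAligned (S := S) (c₁ := c₁) (c₂ := c₂) (s := s) hτ (by simpa using hr) (by simp)]
    refine or_congr_left ?_
    cases hl : lastSat (Splits G S c₁ c₂) with
    | none => simp
    | some y =>
      rw [hl] at hy
      rw [eval_tbl (i := y) (j := s) (by simpa [eval, ofOption] using hy) (by simp [eval]), hτ.1.1.1.1]
      simp
  refine Produces.seq (h := []) (g := []) (J := fun τ => SeparatorTables G S τ ∧
    ∀ s : Fin n, τ 6 s s ≠ 0 ↔ Loose G S c₁ c₂ s) ?_ (Produces.seq (h := []) (g := [])
      (J := fun τ => (SeparatorTables G S τ ∧ ∀ s : Fin n, τ 6 s s ≠ 0 ↔ Loose G S c₁ c₂ s) ∧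
        ∀ s : Fin n, τ 7 s s ≠ 0 ↔ Fixed G S c₁ c₂ True s) ?_ ?_)
  · refine Produces.fill (fun s a => a ≠ 0 ↔ Loose G S c₁ c₂ s)
      (fun τ τ' hag h => h.agreeOff hag (by omega)) fun τ hτ s => ?_
    unfold isLoose Loose
    rw [eval_and_ne_zero, eval_not_ne_zero, hsplit, eval_and_ne_zero, eval_not_ne_zero,
      (hpin τ s hτ).1, eval_and_ne_zero, eval_not_ne_zero, (hpin τ s hτ).2, eval_not_ne_zero,
      hwit τ s hτ, not_not, not_not]
  · exact Produces.fill (fun s a => a ≠ 0 ↔ Fixed G S c₁ c₂ True s)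
      (fun τ τ' hag h => ⟨h.1.agreeOff hag (by omega), by rw [hag 6 (by omega)]; exact h.2⟩)
      fun τ hτ s => hfixed τ s _ True hτ.1 (by simp [eval])
  · exact Produces.fill (fun s a => a ≠ 0 ↔ Fixed G S c₁ c₂ False s)
      (fun τ τ' hag h => ⟨⟨h.1.1.agreeOff hag (by omega), by rw [hag 6 (by omega)]; exact h.1.2⟩,
        by rw [hag 7 (by omega)]; exact h.2⟩)
      fun τ hτ s => hfixed τ s _ False hτ.1.1 (by simp [eval])

end SeparatorProgram

/-! ### The program: writing the trees -/

namespace SeparatorProgram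

open LoopExpr LoopStmt

/-- Write a node, with a mark in front. -/
def emitNode (a b : LoopExpr) : LoopStmt := .seq (.emit (.lit 1)) (.seq (.emit a) (.emit b))

def emitName (x : ℕ) (b : LoopExpr) : LoopStmt := emitNode (.tbl 4 (.var x) (.var x)) b

def emitStar : LoopStmt :=
  .seq (.emit (.lit 1)) (.seq (emitName 2 (.lit 0))
    (.seq (.each (.whn (isLeaf (.var 2) (.var 2) (.var 3)) (emitName 3 (.lit 0)))) (.emit (.lit 0))))

/-- Write a bistar; `e` says which leaves are attached to the first centre. -/
def emitBistar (e : LoopExpr) : LoopStmt :=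
  .seq (.emit (.lit 1)) (.seq (emitName 2 (.lit 0)) (.seq (emitName 3 (.lit 0))
    (.seq (.each (.whn (isLeaf (.var 2) (.var 3) (.var 7)) (emitName 7 (.not e)))) (.emit (.lit 0)))))

/-- The label of the leaf `7` according to table `k`, where the leaf `6` is distinguished. -/
def label (k : ℕ) : LoopExpr :=
  or (.tbl k (.var 7) (.var 7)) (.and (.tbl 6 (.var 7) (.var 7)) (.not (eq (.var 7) (.var 6))))

/-- The last splitting vertex and the reference leaf are bound to the levels `4` and `5`; level `6`
then runs through the distinguished leaves `f`. -/
def emitBistars : LoopStmt :=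
  .bind splitter (.bind referenceLeaf (.seq prepareSides (.each (.whn (isCentre (.var 6))
    (.seq (emitBistar (eq (.var 7) (.var 6))) (.seq (emitBistar (label 7)) (emitBistar (label 8))))))))

def emitTrees : LoopStmt :=
  .each (.whn (isCentre (.var 2)) (.seq emitStar (.each (.whn (.and (isCentre (.var 3))
    (or (.not (eq (.var 2) (.var 3))) (eq (.var 2) (.var 0)))) emitBistars))))

def emitSeparators : LoopStmt :=
  .each (.each (.whn isFirstPair (.seq (.emit (.lit 1))
    (.seq (.seq (.each (.whn (inSep (.var 2)) (.seq (.emit (.lit 1)) (.emit (.var 2))))) (.emit (.lit 0)))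
      (.seq prepare (.seq emitTrees (.emit (.lit 0))))))))

/-- Write the minimal separators, each with the family of trees. -/
def main : LoopStmt := .seq markPairs (.seq emitSeparators (.emit (.lit 0)))

theorem scoped_main : main.Scoped 0 = true := by decide

/-- The deepest nests include `u`, `v`, the two centres, `f`, and the leaf that is written. -/
theorem depth_main : main.depth = 6 := by decide

variable {n : ℕ} {G : SimpleGraph (Fin n)} {ρ : ℕ → ℕ} {u v c₁ c₂ : Fin n}

/-- The elements of a list as they are written. -/
def writeItems {α : Type} (f : α → List ℕ) (l : List α) : List ℕ := l.flatMap (fun a => 1 :: f a)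

theorem writeList_eq {α : Type} (f : α → List ℕ) (l : List α) :
    writeList f l = writeItems f l ++ [0] := rfl

theorem writeItems_cons {α : Type} (f : α → List ℕ) (a : α) (l : List α) :
    writeItems f (a :: l) = (1 :: f a) ++ writeItems f l := rfl

theorem writeItems_flatMap {α β : Type} (f : α → List ℕ) (g : β → List α) (l : List β) :
    writeItems f (l.flatMap g) = l.flatMap fun b => writeItems f (g b) := List.flatMap_assoc

theorem writeItems_ite {α : Type} (f : α → List ℕ) (P : Prop) [Decidable P] (l : List α) :
    writeItems f (if P then l else []) = if P then writeItems f l else [] := by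
  split_ifs <;> rfl

theorem emitName_produces {d x a : ℕ} {i : Fin n} {S : Finset (Fin n)} {e : LoopExpr}
    {I : (ℕ → ℕ → ℕ → ℕ) → Prop} (hI : ∀ τ, I τ → SeparatorTables G S τ) (hx : ρ x = i)
    (he : ∀ τ, I τ → e.eval n τ d ρ = a) :
    Produces n d ρ (emitName x e) I (1 :: writeNode (nameIn S i, a)) I := by
  refine Produces.seq (g := [1]) (.emit fun _ _ => rfl) (Produces.seq (g := [_]) (h := [_])
    (.emit fun τ hτ => ?_) (.emit he))
  have hx' : (var x).eval n τ d ρ = i := hx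
  rw [eval_tbl hx' hx', (hI τ hτ).1.2]
  cases nameIn S i <;> rfl

open Classical in
theorem emitLeaves_produces {d x y : ℕ} {I : (ℕ → ℕ → ℕ → ℕ) → Prop}
    (hI : ∀ τ, I τ → SeparatorTables G (commonNbrs G u v) τ) (hu : ρ 0 = u) (hv : ρ 1 = v)
    (h₁ : ρ x = c₁) (h₂ : ρ y = c₂) (hd : 2 ≤ d) (hx : x < d) (hy : y < d) {e : LoopExpr}
    {φ : Fin n → ℕ}
    (he : ∀ τ, I τ → ∀ s : Fin n, e.eval n τ (d + 1) (Function.update ρ d s) = φ s) :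
    Produces n d ρ (.seq (.each (.whn (isLeaf (.var x) (.var y) (.var d)) (emitName d e)))
      (.emit (.lit 0))) I
      (writeList writeNode ((leafList (commonNbrs G u v) c₁ c₂).map fun s => (some s, φ s))) I := by
  rw [writeList_eq, writeItems, List.flatMap_map, leafList, List.flatMap_filter_eq]
  refine Produces.seq (Produces.each fun s => ?_) (.emit fun _ _ => rfl)
  have h0 : (0 : ℕ) ≠ d := by omega
  have h1 : (1 : ℕ) ≠ d := by omega
  refine Produces.whn (fun τ hτ => eval_isLeaf (hI τ hτ).1.1.1.1
    (by rw [Function.update_of_ne h0, hu]) (by rw [Function.update_of_ne h1, hv])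
    (by simp [eval, Function.update_of_ne hx.ne, h₁])
    (by simp [eval, Function.update_of_ne hy.ne, h₂]) (by simp [eval])) fun hs => ?_
  have := emitName_produces (n := n) (d := d + 1) (ρ := Function.update ρ d s) (x := d) (i := s) hI
    (by simp) (fun τ hτ => he τ hτ s)
  rwa [show nameIn (commonNbrs G u v) s = some s from if_pos hs.1] at this

theorem emitStar_produces (hu : ρ 0 = u) (hv : ρ 1 = v) (h₁ : ρ 2 = c₁) :
    Produces n 3 ρ emitStar (SeparatorTables G (commonNbrs G u v))
      (1 :: writeList writeNode (starTree (commonNbrs G u v) c₁))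
      (SeparatorTables G (commonNbrs G u v)) := by
  have e : 1 :: writeList writeNode (starTree (commonNbrs G u v) c₁) =
      [1] ++ ((1 :: writeNode (nameIn (commonNbrs G u v) c₁, 0)) ++ writeList writeNode
        ((leafList (commonNbrs G u v) c₁ c₁).map fun s => (some s, 0))) := by
    simp [starTree, CodedTree.star, writeList]
  rw [e]
  exact .seq (.emit fun _ _ => rfl) (.seq (emitName_produces (fun _ h => h) h₁ fun _ _ => rfl)
    (emitLeaves_produces (fun _ h => h) hu hv h₁ h₁ (by omega) (by omega) (by omega)
      fun _ _ _ => rfl))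

theorem emitBistar_produces (hu : ρ 0 = u) (hv : ρ 1 = v) (h₁ : ρ 2 = c₁) (h₂ : ρ 3 = c₂)
    {e : LoopExpr} {P : Fin n → Prop}
    (he : ∀ τ, CentreTables G (commonNbrs G u v) c₁ c₂ τ → ∀ s : Fin n,
      (e.eval n τ 8 (Function.update ρ 7 s) ≠ 0 ↔ P s)) :
    Produces n 7 ρ (emitBistar e) (CentreTables G (commonNbrs G u v) c₁ c₂)
      (1 :: writeList writeNode (bistarTree (commonNbrs G u v) c₁ c₂ P))
      (CentreTables G (commonNbrs G u v) c₁ c₂) := by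
  have e : 1 :: writeList writeNode (bistarTree (commonNbrs G u v) c₁ c₂ P) =
      [1] ++ ((1 :: writeNode (nameIn (commonNbrs G u v) c₁, 0)) ++
        ((1 :: writeNode (nameIn (commonNbrs G u v) c₂, 0)) ++ writeList writeNode
        ((leafList (commonNbrs G u v) c₁ c₂).map fun s => (some s, fatherOf P s)))) := by
    simp [bistarTree, CodedTree.bistar, writeList]
  rw [e]
  have hI : ∀ τ, CentreTables G (commonNbrs G u v) c₁ c₂ τ → SeparatorTables G (commonNbrs G u v) τ :=
    fun _ h => h.1.1.1
  refine .seq (.emit fun _ _ => rfl) (.seq (emitName_produces hI h₁ fun _ _ => rfl)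
    (.seq (emitName_produces hI h₂ fun _ _ => rfl)
    (emitLeaves_produces hI hu hv h₁ h₂ (by omega) (by omega) (by omega) fun τ hτ s => ?_)))
  -- The negation of the test is the index of the father: `0` for the first centre, `1` for the
  -- second.
  have := he τ hτ s
  unfold fatherOf
  simp only [eval]
  split_ifs <;> simp_all

theorem eval_label {τ : ℕ → ℕ → ℕ → ℕ} {k : ℕ} {β : Prop} {f s : Fin n} {S : Finset (Fin n)}
    (hτ : CentreTables G S c₁ c₂ τ) (hk : ∀ s : Fin n, τ k s s ≠ 0 ↔ Fixed G S c₁ c₂ β s)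
    (hf : ρ 6 = f) (hs : ρ 7 = s) :
    (label k).eval n τ 8 ρ ≠ 0 ↔ Label G S c₁ c₂ β f s := by
  have hs' : (var 7).eval n τ 8 ρ = s := hs
  rw [label_iff, label, eval_or_ne_zero, eval_tbl hs' hs', hk, eval_and_ne_zero, eval_tbl hs' hs', hτ.1.1.2, eval_not_ne_zero, eval_eq_ne_zero, ne_eq, Fin.ext_iff,
    ← hs, ← hf]
  rfl

theorem emitBistars_produces (hu : ρ 0 = u) (hv : ρ 1 = v) (h₁ : ρ 2 = c₁) (h₂ : ρ 3 = c₂) :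
    Produces n 4 ρ emitBistars (SeparatorTables G (commonNbrs G u v))
      (writeItems (writeList writeNode) (bistarTrees G (commonNbrs G u v) u c₁ c₂))
      (SeparatorTables G (commonNbrs G u v)) := by
  set S := commonNbrs G u v with hS
  rw [bistarTrees, writeItems_flatMap]
  simp only [writeItems_ite]
  refine .bind (fun τ hτ => eval_splitter hτ hu hv h₁ h₂) (.bind (fun τ hτ => eval_referenceLeaf hτ
    (by simpa using hu) (by simpa using hv) (by simpa using h₁) (by simpa using h₂)) ?_)
  refine .seq (g := []) (prepareSides_produces (by simpa using hu) (by simpa using hv)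
    (by simpa using h₁) (by simpa using h₂) (by simp) (by simp)) (Produces.weaken
    (J := CentreTables G S c₁ c₂) (.each fun f => ?_) fun _ h => h.1.1.1)
  refine Produces.whn (P := f ∈ S ∨ f = u) (fun τ hτ => eval_isCentre hτ.1.1.1.1.1.1.1
    (by simpa using hu) (by simpa using hv) (by simp [eval])) fun _ => ?_
  have e : writeItems (writeList writeNode) [bistarTree S c₁ c₂ (· = f),
      bistarTree S c₁ c₂ (Label G S c₁ c₂ True f), bistarTree S c₁ c₂ (Label G S c₁ c₂ False f)] =
      (1 :: writeList writeNode (bistarTree S c₁ c₂ (· = f))) ++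
        ((1 :: writeList writeNode (bistarTree S c₁ c₂ (Label G S c₁ c₂ True f))) ++
          (1 :: writeList writeNode (bistarTree S c₁ c₂ (Label G S c₁ c₂ False f)))) := by
    simp [writeItems]
  rw [e]
  refine .seq (emitBistar_produces (by simpa using hu) (by simpa using hv) (by simpa using h₁)
    (by simpa using h₂) fun τ hτ s => ?_) (.seq (emitBistar_produces (by simpa using hu)
    (by simpa using hv) (by simpa using h₁) (by simpa using h₂) fun τ hτ s => ?_)
    (emitBistar_produces (by simpa using hu) (by simpa using hv) (by simpa using h₁)
    (by simpa using h₂) fun τ hτ s => ?_))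
  · rw [eval_eq_ne_zero]
    simp [eval, Fin.ext_iff]
  · exact eval_label hτ hτ.1.2 (by simp) (by simp)
  · exact eval_label hτ hτ.2 (by simp) (by simp)

theorem emitTrees_produces (hu : ρ 0 = u) (hv : ρ 1 = v) :
    Produces n 2 ρ emitTrees (SeparatorTables G (commonNbrs G u v))
      (writeItems (writeList writeNode) (trees G (commonNbrs G u v) u))
      (SeparatorTables G (commonNbrs G u v)) := by
  set S := commonNbrs G u v with hS
  rw [trees, writeItems_flatMap]
  simp only [writeItems_ite]
  refine Produces.each fun c₁ => Produces.whn (P := c₁ ∈ S ∨ c₁ = u) (fun τ hτ =>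
    eval_isCentre hτ.1.1.1.1 (by simpa using hu) (by simpa using hv) (by simp [eval])) fun _ => ?_
  rw [treesAt, writeItems_cons, writeItems_flatMap]
  simp only [writeItems_ite]
  refine .seq (emitStar_produces (by simpa using hu) (by simpa using hv) (by simp)) (.each fun c₂ =>
    Produces.whn (P := (c₂ ∈ S ∨ c₂ = u) ∧ (c₁ ≠ c₂ ∨ c₁ = u)) (fun τ hτ => ?_) fun _ => emitBistars_produces (by simpa using hu) (by simpa using hv)
      (by simp) (by simp))
  rw [eval_and_ne_zero, eval_isCentre (u := u) (v := v) (c := c₂) hτ.1.1.1.1 (by simpa using hu)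
    (by simpa using hv) (by simp [eval]), eval_or_ne_zero, eval_not_ne_zero, eval_eq_ne_zero,
    eval_eq_ne_zero]
  simp [eval, Fin.ext_iff, hu, hS]

open Classical in
/-- The collection that the program writes. -/
noncomputable def collection (G : SimpleGraph (Fin n)) : List (List (Fin n) × List (CodedTree n)) :=
  (List.finRange n).flatMap fun u => (List.finRange n).flatMap fun v => if FirstPair G u v then
    [((List.finRange n).filter (· ∈ commonNbrs G u v), trees G (commonNbrs G u v) u)] else []

theorem main_produces : Produces n 0 ρ main (fun τ => IsAdjTable G (τ 0))
    (writeCollection (collection G)) (GlobalTables G) := by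
  classical
  rw [writeCollection, writeList_eq, collection, writeItems_flatMap]
  simp only [writeItems_flatMap, writeItems_ite]
  refine .seq (g := []) (markPairs_produces ρ) (.seq (.each fun u => .each fun v => Produces.whn
    (P := FirstPair G u v) (fun τ hτ => eval_isFirstPair hτ (by simp) (by simp)) fun _ => ?_) (.emit fun _ _ => rfl))
  set S := commonNbrs G u v with hS
  have e : writeItems (fun p : List (Fin n) × List (CodedTree n) =>
      writeList (fun v => [v.1]) p.1 ++ writeList (writeList writeNode) p.2)
      [((List.finRange n).filter (· ∈ S), trees G S u)] =
      [1] ++ ((writeItems (fun v => [v.1]) ((List.finRange n).filter (· ∈ S)) ++ [0]) ++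
        ([] ++ (writeItems (writeList writeNode) (trees G S u) ++ [0]))) := by
    simp [writeItems, writeList]
  rw [e, writeItems, List.flatMap_filter_eq]
  refine .seq (.emit fun _ _ => rfl) (.seq (.seq (.each fun x => Produces.whn (P := x ∈ S) (fun τ hτ => eval_inSep hτ.1
    (by simp) (by simp) (by simp [eval])) fun _ => .seq (g := [1]) (.emit fun _ _ => rfl)
    (.emit fun τ hτ => ?_)) (.emit fun _ _ => rfl)) (.seq (prepare_produces (by simp) (by simp))
      (.weaken (.seq (emitTrees_produces (by simp) (by simp)) (.emit fun _ _ => rfl))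
        fun _ h => h.1.1.1)))
  simp [eval]

end SeparatorProgram

/-! ### The collection of separators -/

namespace SeparatorProgram

open LoopExpr LoopStmt

variable {n : ℕ} {G : SimpleGraph (Fin n)}

open Classical in
theorem collection_eq : collection G =
    ((List.finRange n ×ˢ List.finRange n).filter fun p => FirstPair G p.1 p.2).map fun p =>
      ((List.finRange n).filter (· ∈ commonNbrs G p.1 p.2), trees G (commonNbrs G p.1 p.2) p.1) := by
  rw [List.map_eq_flatMap, List.flatMap_filter_eq]
  change _ = ((List.finRange n).flatMap fun a => (List.finRange n).map (Prod.mk a)).flatMap _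
  rw [List.flatMap_assoc]
  simp only [List.flatMap_map]
  rfl

theorem toFinset_filter_finRange (S : Finset (Fin n)) [DecidablePred (· ∈ S)] :
    ((List.finRange n).filter (· ∈ S)).toFinset = S := by
  ext x
  simp

open Classical in
theorem mem_collection {p : List (Fin n) × List (CodedTree n)} : p ∈ collection G ↔
    ∃ u v, FirstPair G u v ∧ p = ((List.finRange n).filter (· ∈ commonNbrs G u v),
      trees G (commonNbrs G u v) u) := by
  simp [collection]

theorem FirstPair.eq {u v u' v' : Fin n} (h : FirstPair G u v) (h' : FirstPair G u' v')
    (he : commonNbrs G u v = commonNbrs G u' v') : u = u' ∧ v = v' := by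
  rcases lt_trichotomy u u' with hu | hu | hu
  · exact absurd ⟨u, v, .inl hu, h.1, he⟩ h'.2
  · refine ⟨hu, ?_⟩
    rcases lt_trichotomy v v' with hv | hv | hv
    · exact absurd ⟨u, v, .inr ⟨hu, hv⟩, h.1, he⟩ h'.2
    · exact hv
    · exact absurd ⟨u', v', .inr ⟨hu.symm, hv⟩, h'.1, he.symm⟩ h.2
  · exact absurd ⟨u', v', .inl hu, h'.1, he.symm⟩ h.2

theorem nodup_collection : ((collection G).map fun p => p.1.toFinset).Nodup := by
  classical
  rw [collection_eq, List.map_map]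
  refine List.Nodup.map_on ?_ (((List.nodup_finRange n).product (List.nodup_finRange n)).filter _)
  rintro ⟨u, v⟩ h ⟨u', v'⟩ h' he
  simp only [List.mem_filter, decide_eq_true_eq] at h h'
  simp only [Function.comp_apply, toFinset_filter_finRange] at he
  obtain ⟨rfl, rfl⟩ := h.2.eq h'.2 he
  rfl

/-- Takes the lexicographically least of the separated pairs with the same common neighbours. -/
theorem SeparatedPair.exists_firstPair {u v : Fin n} (h : SeparatedPair G u v) :
    ∃ u' v', FirstPair G u' v' ∧ commonNbrs G u' v' = commonNbrs G u v := by
  obtain ⟨p, ⟨hp, he⟩, hmin⟩ := (wellFounded_lt (α := Fin n ×ₗ Fin n)).has_min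
    {p | SeparatedPair G (ofLex p).1 (ofLex p).2 ∧
      commonNbrs G (ofLex p).1 (ofLex p).2 = commonNbrs G u v} ⟨toLex (u, v), h, rfl⟩
  refine ⟨(ofLex p).1, (ofLex p).2, ⟨hp, ?_⟩, he⟩
  rintro ⟨u', v', hlt, h', he'⟩
  exact hmin (toLex (u', v')) ⟨h', he'.trans he⟩ (Prod.Lex.lt_iff.2 hlt)

theorem isMinimalSeparator_iff_mem_collection (hG : IsChordal G) (S : Finset (Fin n)) :
    IsMinimalSeparator G S ↔ ∃ p ∈ collection G, p.1.toFinset = S := by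
  classical
  rw [hG.isMinimalSeparator_iff]
  constructor
  · rintro ⟨u, v, h, h'⟩
    have hS : S = commonNbrs G u v := by
      ext x
      rw [h.mem_iff, mem_commonNbrs]
    obtain ⟨u', v', hf, he⟩ := SeparatedPair.exists_firstPair (G := G) (u := u) (v := v) (by
      rw [SeparatedPair, ← hS]
      exact h')
    exact ⟨_, mem_collection.2 ⟨u', v', hf, rfl⟩, by rw [toFinset_filter_finRange, he, hS]⟩
  · rintro ⟨p, hp, rfl⟩
    obtain ⟨u, v, hf, rfl⟩ := mem_collection.1 hp
    rw [toFinset_filter_finRange]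
    exact ⟨u, v, hf.1.isCommonNeighborSet, hf.1⟩

/-- In a connected graph the empty set separates nothing. Nonemptiness is needed for the bound on
the number of trees and for well-structuredness at the separator. -/
theorem SeparatedPair.nonempty (hG : G.Connected) {u v : Fin n} (h : SeparatedPair G u v) :
    (commonNbrs G u v).Nonempty := by
  rw [Finset.nonempty_iff_ne_empty]
  intro he
  unfold SeparatedPair at h
  rw [he] at h
  obtain ⟨p⟩ := hG.preconnected u v
  exact h ⟨p, by simp⟩

theorem isAdjTable_inputState : IsAdjTable G fun x y => (inputState G).mem ((0 * n + x) * n + y) := by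
  classical
  intro x y
  unfold inputState
  dsimp only
  rw [ite_ne_right_iff]
  simp only [ne_eq, one_ne_zero, not_false_eq_true, and_true]
  constructor
  · rintro ⟨u, v, h, hadj⟩
    obtain ⟨-, hx, hy⟩ := address_injective (k' := 0) x.2 y.2 u.2 v.2 (h.trans (by simp))
    rwa [Fin.ext hx, Fin.ext hy]
  · exact fun h => ⟨x, y, by simp, h⟩

/-- The input already has `n` in register `0` and `0` in register `2`; the leading instruction sets
register `1`. -/
theorem exec_program {w : ℕ} (hw : (n + 2) ^ 6 ≤ 2 ^ w) (G : SimpleGraph (Fin n)) :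
    ∃ s t, RamExec w (.seq (.const 1 1) (main.compile 0)) (inputState G) s t ∧
      t ≤ 1 + main.cost n ∧ s.out = writeCollection (collection G) := by
  have h1 : 1 % 2 ^ w = 1 := Nat.mod_eq_of_lt ((word_bounds hw).1.trans' (by omega))
  obtain ⟨s, c, h, hc, -, ho⟩ := main.compile_exec hw 0 (fun _ => 0)
    ⟨fun k x y => (inputState G).mem ((k * n + x) * n + y), []⟩
    { inputState G with
      reg := Function.update (inputState G).reg 1 (1 % 2 ^ w) } scoped_main
    ⟨by simp [inputState], by simp [h1], by simp [inputState], by simp, fun _ _ _ _ _ => rfl⟩ rfl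
  refine ⟨s, _, .seq (.const _ _ _) h, by omega, ?_⟩
  rw [ho, (main_produces (G := G) _ isAdjTable_inputState).1, List.nil_append]

end SeparatorProgram

/-- A connected graph has `n ≤ m + 1`, so one factor `n` can be traded for `m`. The summand `1`
covers `m = 0`, where `n = 1`. -/
theorem SimpleGraph.Connected.succ_pow_six_le {n : ℕ} {G : SimpleGraph (Fin n)} (hG : G.Connected) :
    (n + 1) ^ 6 ≤ 128 * (n ^ 5 * G.edgeSet.ncard + 1) := by
  have h1 : n ≤ G.edgeSet.ncard + 1 := by
    simpa using hG.card_vert_le_card_edgeSet_add_one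
  have h0 : 0 < n := Fin.pos_iff_nonempty.2 hG.nonempty
  set m := G.edgeSet.ncard
  have h2 : (n + 1) ^ 6 ≤ (2 * n) ^ 6 := Nat.pow_le_pow_left (by omega) 6
  have h3 : n ^ 5 * n ≤ n ^ 5 * (m + 1) := Nat.mul_le_mul_left _ h1
  have h4 : n ^ 5 ≤ n ^ 5 * m + 1 := by
    rcases Nat.eq_zero_or_pos m with hm | hm
    · have : n = 1 := by omega
      simp [this]
    · exact (Nat.le_mul_of_pos_right _ hm).trans (Nat.le_succ _)
  calc (n + 1) ^ 6 ≤ 64 * (n ^ 5 * n) := h2.trans_eq (by ring)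
    _ ≤ _ := by nlinarith

theorem theorem6p1 :
    ∃ (prog : RamProg) (c C : ℕ),
      ∀ (n : ℕ) (G : SimpleGraph (Fin n)), G.Connected → IsChordal G →
      ∀ w : ℕ, (n + 2) ^ c ≤ 2 ^ w →
      ∃ (F : List (List (Fin n) × List (CodedTree n))) (s : RamState) (t : ℕ),
        -- the program halts in time `O(n ^ 5 * m)` and outputs the collection `F`
        RamExec w prog (inputState G) s t ∧
        t ≤ C * (n ^ 5 * G.edgeSet.ncard + 1) ∧
        s.out = writeCollection F ∧
        -- `F` is indexed by the minimal separators, each occurring exactly once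
        (∀ p ∈ F, p.1.Nodup) ∧
        (F.map (fun p => p.1.toFinset)).Nodup ∧
        (∀ S : Finset (Fin n), IsMinimalSeparator G S ↔ ∃ p ∈ F, p.1.toFinset = S) ∧
        -- the family of `S` consists of `O(|S| ^ 5)` trees with `S` as set of real nodes
        (∀ p ∈ F, p.2.length ≤ C * p.1.toFinset.card ^ 5 ∧
          ∀ Y ∈ p.2, CodedTree.IsTreeOn Y p.1.toFinset) ∧
        -- and it captures the subtree `T⟨S⟩` for all well-structured `4`-Steiner roots `T`
        (∀ (σ : Type) [Finite σ] (T : SimpleGraph (Fin n ⊕ σ)), IsWellStructuredRoot G T →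
          ∀ p ∈ F, ∃ Y ∈ p.2,
            SteinerEquivalent (spanTree T p.1.toFinset) (spanName T p.1.toFinset)
              (CodedTree.graph Y) (CodedTree.name Y)) := by
  obtain ⟨K, hK⟩ := SeparatorProgram.main.exists_cost_le
  rw [SeparatorProgram.depth_main] at hK
  -- Exponent `6` is what `word_bounds` needs. In the constant, `128 * K` pays for the loops, `32`
  -- for the number of trees, and `1` for the leading instruction.
  refine ⟨.seq (.const 1 1) (SeparatorProgram.main.compile 0), 6, 128 * K + 33, ?_⟩
  intro n G hconn hG w hw
  classical
  obtain ⟨s, t, hexec, ht, hout⟩ := SeparatorProgram.exec_program hw G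
  refine ⟨SeparatorProgram.collection G, s, t, hexec, ?_, hout, ?_,
    SeparatorProgram.nodup_collection, SeparatorProgram.isMinimalSeparator_iff_mem_collection hG,
    ?_, ?_⟩
  · have h1 := Nat.mul_le_mul_left K hconn.succ_pow_six_le
    have h2 := hK n
    calc t ≤ 1 + K * (128 * (n ^ 5 * G.edgeSet.ncard + 1)) := by omega
      _ ≤ _ := by
        generalize n ^ 5 * G.edgeSet.ncard = x
        nlinarith
  · intro p hp
    obtain ⟨u, v, -, rfl⟩ := SeparatorProgram.mem_collection.1 hp
    exact (List.nodup_finRange n).filter _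
  · intro p hp
    obtain ⟨u, v, hf, rfl⟩ := SeparatorProgram.mem_collection.1 hp
    rw [SeparatorProgram.toFinset_filter_finRange]
    exact ⟨(length_trees_le (hf.1.nonempty hconn)).trans (Nat.mul_le_mul_right _ (by omega)),
      fun Y hY => isTreeOn_of_mem_trees (SeparatorProgram.notMem_commonNbrs_left u v) hY⟩
  · intro σ _ T hT p hp
    obtain ⟨u, v, hf, rfl⟩ := SeparatorProgram.mem_collection.1 hp
    rw [SeparatorProgram.toFinset_filter_finRange]
    have hsep := hf.1.isCommonNeighborSet
    exact hsep.exists_mem_trees (hG.isClique_of_minimal (hsep.minimal_isSeparator hf.1))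
      (hf.1.nonempty hconn) hT
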